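/- Let $S$ be an $n$-qubit stabilizer (an abelian subgroup of the $n$-qubit Pauli group not containing $-I$), let $Q$ be its stabilizer code, with orthogonal projector $P_Q=|S|^{-1}\sum_{R\in S}R$, and let $k$ be its number of logical qubits. Assume that $Q$ is free of trivially encoded qubits: for every $j\in\{1,\dots,n\}$ some element of $S$ acts on the $j$th qubit as a non-identity Pauli matrix. A choice of logical Pauli operators of $Q$ is given by an isometry $E$ from $k$ qubits onto $Q$ such that every Pauli operator $P$ on the $k$ qubits has a Pauli operator $P'$ in the centralizer of $S$ with $P'E=EP$; in particular $\bar Z_lE=EZ_l$ and $\bar X_lE=EX_l$. A transversal gate on $r$ blocks $Q^{\otimes r}$ is $U=\bigotimes_{j=1}^nU_j$, where $U_j$ is an $r$-qubit unitary acting on the $j$th qubits of the $r$ blocks and $U$ commutes with $P_Q^{\otimes r}$. It acts on the logical qubits as $W$ if $UE^{\otimes r}=E^{\otimes r}W$. A gate $W$ keeps $\mathrm{span}\langle\pm Z_i\rangle$ invariant if $WMW^\dagger$ lies in the complex linear span of the group generated by the $\pm Z_i$ ($i$ ranging over all qubits on which $W$ acts) for every $M$ in that span. The Clifford group consists of the unitaries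 mapping the Pauli group to itself under conjugation; a local Clifford is a tensor product of single-qubit Clifford gates. 1. Fix any choice of logical Pauli operators. Let $U=\bigotimes_jU_j$ be a transversal gate on $Q^{\otimes r}$ such that no $U_j$ is a Clifford gate, and suppose that $U$ acts as an $r$-qubit logical gate $V$ on $r$ encoded qubits, one from each block (and as the identity on any other encoded qubits). Then $V$ keeps $\mathrm{span}\langle\pm\bar Z_i\rangle_{i=1}^r$ invariant up to a local Clifford: there is a local Clifford $L=L_1\otimes\cdots\otimes L_r$ such that $L^\dagger VL$ keeps $\mathrm{span}\langle\pm Z_i\rangle_{i=1}^r$ invariant. 2. More generally, let $U=\bigotimes_jU_j$ be any transversal gate on $Q^{\otimes r}$ such that no $U_j$ is a Clifford gate. Then the logical Pauli operators of $Q$ can be chosen (the same choice in every block) such that the logical action of $U$ on the $rk$ encoded qubits keeps the span of the group generated by $\pm$ the logical Pauli $Z$ operators of all encoded qubits invariant. 3. For any choice of logical Pauli operators and any logical qubit $s$ of $Q$, the Hadamard gate on logical qubit $s$ (one block) and the Toffoli gate on the logical qubits $s$ of three blocks are not both the logical action of transversal gates. -/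

import Mathlib

open Matrix

/-- Qubits are labelled by a type `ι`; an operator on them is a matrix indexed by bit strings. -/
abbrev QOp (ι : Type) : Type := Matrix (ι → Fin 2) (ι → Fin 2) ℂ

/-- The tensor product `⊗ᵢ Aᵢ` of (possibly rectangular) matrices. -/
def piTensor {ι α β : Type} [Fintype ι] (A : ι → Matrix α β ℂ) : Matrix (ι → α) (ι → β) ℂ :=
  Matrix.of fun x y => ∏ i, A i (x i) (y i)

/-- The Pauli matrices `I, X, Y, Z`, numbered `0, 1, 2, 3`. -/
noncomputable def pauliMat : Fin 4 → Matrix (Fin 2) (Fin 2) ℂ :=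
  ![1, !![0, 1; 1, 0], !![0, -Complex.I; Complex.I, 0], !![1, 0; 0, -1]]

/-- The Pauli string `⊗ᵢ σ_{p i}`. -/
noncomputable def pauliString {ι : Type} [Fintype ι] (p : ι → Fin 4) : QOp ι :=
  piTensor fun i => pauliMat (p i)

/-- The Pauli group on the qubits `ι`: Pauli strings with a phase in `{±1, ±i}`. -/
def pauliGroup (ι : Type) [Fintype ι] : Set (QOp ι) :=
  {M | ∃ c ∈ ({1, -1, Complex.I, -Complex.I} : Set ℂ), ∃ p : ι → Fin 4, M = c • pauliString p}

/-- The support of a Pauli operator: the qubits on which it is not the identity. -/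
def pauliSupport {ι : Type} [Fintype ι] (M : QOp ι) : Set ι :=
  {j | ∃ c ∈ ({1, -1, Complex.I, -Complex.I} : Set ℂ), ∃ p : ι → Fin 4,
    M = c • pauliString p ∧ p j ≠ 0}

/-- The Clifford group: unitaries that map the Pauli group to itself under conjugation. -/
def IsClifford {ι : Type} [Fintype ι] [DecidableEq ι] (V : QOp ι) : Prop :=
  V ∈ unitaryGroup (ι → Fin 2) ℂ ∧ ∀ P ∈ pauliGroup ι, V * P * Vᴴ ∈ pauliGroup ι

/-- A local Clifford operation: a tensor product of single-qubit Clifford gates. -/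
def IsLocalClifford {ι : Type} [Fintype ι] (L : QOp ι) : Prop :=
  ∃ A : ι → Matrix (Fin 2) (Fin 2) ℂ,
    (∀ i, IsClifford (piTensor fun _ : Fin 1 => A i)) ∧ L = piTensor A

/-- A stabilizer: an abelian subgroup of the `n`-qubit Pauli group that does not contain `-I`. -/
structure IsStabilizer {n : ℕ} (S : Subgroup (unitaryGroup (Fin n → Fin 2) ℂ)) : Prop where
  pauli : ∀ g ∈ S, (g : QOp (Fin n)) ∈ pauliGroup (Fin n)
  comm : ∀ g ∈ S, ∀ h ∈ S, g * h = h * g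
  neg_one : ∀ g ∈ S, (g : QOp (Fin n)) ≠ -1

/-- The code has no trivially encoded qubit: every qubit is acted on by some stabilizer element. -/
def FreeOfTriviallyEncodedQubits {n : ℕ} (S : Subgroup (unitaryGroup (Fin n → Fin 2) ℂ)) : Prop :=
  ∀ j : Fin n, ∃ g ∈ S, j ∈ pauliSupport (g : QOp (Fin n))

/-- The orthogonal projector `P_Q = |S|⁻¹ ∑_{R ∈ S} R` onto the code `Q` stabilized by `S`
(a stabilizer is a finite group, so the sum is a finite one). -/
noncomputable def codeProjector {n : ℕ} (S : Subgroup (unitaryGroup (Fin n → Fin 2) ℂ)) :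
    QOp (Fin n) :=
  (Nat.card S : ℂ)⁻¹ • ∑ᶠ g : S, ((g : unitaryGroup (Fin n → Fin 2) ℂ) : QOp (Fin n))

/-- The gate `⊗ⱼ Uⱼ` on `r` blocks of `n` qubits, `Uⱼ` acting on the `j`-th qubit of each block. A
basis state `x` of the blocks has the bit `x i j` at the `j`-th qubit of block `i`. -/
def transversalGate {n r : ℕ} (U : Fin n → QOp (Fin r)) :
    Matrix (Fin r → Fin n → Fin 2) (Fin r → Fin n → Fin 2) ℂ :=
  (piTensor U).submatrix (fun x j i => x i j) (fun x j i => x i j)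

/-- `⊗ⱼ Uⱼ` is a transversal gate on `Q^{⊗r}`: all `Uⱼ` are unitary and the gate is logical, i.e. it
commutes with the projector `P_Q^{⊗r}`. -/
def IsTransversal {n r : ℕ} (S : Subgroup (unitaryGroup (Fin n → Fin 2) ℂ))
    (U : Fin n → QOp (Fin r)) : Prop :=
  (∀ j, U j ∈ unitaryGroup (Fin r → Fin 2) ℂ) ∧
    Commute (transversalGate U) (piTensor fun _ : Fin r => codeProjector S)

/-- A choice of logical Pauli operators for the code of `S`, given as the corresponding encoding map
`E`: an isometry from `k` qubits onto the code under which every Pauli operator `P` on the `k`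
logical qubits is implemented by a physical Pauli operator `P'` in the centralizer of `S`
(so `Z̄ₗ E = E Zₗ` and `X̄ₗ E = E Xₗ`). -/
structure IsLogicalEncoding {n k : ℕ} (S : Subgroup (unitaryGroup (Fin n → Fin 2) ℂ))
    (E : Matrix (Fin n → Fin 2) (Fin k → Fin 2) ℂ) : Prop where
  isometry : Eᴴ * E = 1
  range : E * Eᴴ = codeProjector S
  pauli : ∀ P ∈ pauliGroup (Fin k), ∃ P' ∈ pauliGroup (Fin n),
    (∀ g ∈ S, Commute (g : QOp (Fin n)) P') ∧ P' * E = E * P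

/-- The encoding map `E^{⊗r}` of `r` blocks; `(i, l)` is the `l`-th logical qubit of block `i`. -/
def blockEncoding {n k : ℕ} (r : ℕ) (E : Matrix (Fin n → Fin 2) (Fin k → Fin 2) ℂ) :
    Matrix (Fin r → Fin n → Fin 2) (Fin r × Fin k → Fin 2) ℂ :=
  (piTensor fun _ : Fin r => E).submatrix id (fun y i l => y (i, l))

/-- The physical gate `⊗ⱼ Uⱼ` acts on the encoded qubits as the gate `W`. -/
def ActsAs {n k r : ℕ} (E : Matrix (Fin n → Fin 2) (Fin k → Fin 2) ℂ)
    (U : Fin n → QOp (Fin r)) (W : QOp (Fin r × Fin k)) : Prop :=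
  transversalGate U * blockEncoding r E = blockEncoding r E * W

/-- The `r`-qubit gate `V` applied to the (distinct) qubits `t 0, …, t (r-1)` of the register `ι`,
and the identity on all other qubits. -/
def gateOn {ι : Type} [Fintype ι] [DecidableEq ι] {r : ℕ} (t : Fin r → ι) (V : QOp (Fin r)) :
    QOp ι :=
  Matrix.of fun x y => if ∀ q, (∀ i, t i ≠ q) → x q = y q then V (x ∘ t) (y ∘ t) else 0

/-- The Pauli `Z` operator on the qubit `i`. -/
noncomputable def zAt {ι : Type} [Fintype ι] [DecidableEq ι] (i : ι) : QOp ι :=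
  pauliString fun q => if q = i then 3 else 0

/-- The linear span of the group `⟨±Zᵢ⟩` (each `±Zᵢ` is its own inverse, so the generated monoid is
the generated group). -/
noncomputable def zSpan (ι : Type) [Fintype ι] [DecidableEq ι] : Submodule ℂ (QOp ι) :=
  Submodule.span ℂ
    (Submonoid.closure {M : QOp ι | ∃ i, M = zAt i ∨ M = -zAt i} : Set (QOp ι))

/-- Conjugation by `W` leaves the span of `⟨±Zᵢ⟩` invariant. -/
def KeepsZSpan {ι : Type} [Fintype ι] [DecidableEq ι] (W : QOp ι) : Prop :=
  ∀ M ∈ zSpan ι, W * M * Wᴴ ∈ zSpan ι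

/-- The Hadamard gate. -/
noncomputable def hadamardGate : QOp (Fin 1) :=
  piTensor fun _ => ((Real.sqrt 2 : ℂ))⁻¹ • !![1, 1; 1, -1]

/-- The Toffoli gate `|a, b, c⟩ ↦ |a, b, c ⊕ ab⟩`. -/
def toffoliGate : QOp (Fin 3) :=
  Matrix.of fun x y => if x = ![y 0, y 1, y 2 + y 0 * y 1] then 1 else 0

/-- The `r`-qubit gate `V` on the logical qubits number `s` of the `r` blocks is transversal: it is
the logical action of some transversal gate on `Q^{⊗r}`. -/
def GateIsTransversal {n k r : ℕ} (S : Subgroup (unitaryGroup (Fin n → Fin 2) ℂ))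
    (E : Matrix (Fin n → Fin 2) (Fin k → Fin 2) ℂ) (s : Fin k) (V : QOp (Fin r)) : Prop :=
  ∃ U : Fin n → QOp (Fin r), IsTransversal S U ∧ ActsAs E U (gateOn (fun i => (i, s)) V)

/-!
A transversal gate commutes with the code projector, whose Pauli expansion consists exactly of the
stabilizer elements, and in the Pauli basis conjugation by `⨂ⱼ Uⱼ` is a product over the physical
qubits of the coefficients `conjCoeff (U j)`. Moving the factors outside a set `B` of qubits to the
other side of the invariance of the projector and comparing coefficients gives the rigidity lemma
`prod_conjCoeff_eq_zero`: if `B` supports no nontrivial stabilizer element, a product over `B` of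
coefficients of the `Uⱼ` vanishes unless it leads from stabilizer elements to stabilizer elements.

Applied to a stabilizer element of least weight through a given qubit, with `B` consisting of one or
two qubits of its support, this yields a trichotomy (`qubit_trichotomy`). The qubit belongs to a set
of qubits in a pure state, which carries no logical information; or all transversal gates preserve
the strings in a fixed Pauli axis at this qubit; or all transversal gates act on it by mapping Pauli
strings to Pauli strings, so they are Clifford there. The trichotomy is recorded by a `PauliFrame`:
at each qubit there are spaces `small ≤ big` of Pauli labels, equal unless every gate at this qubit
is Clifford, such that gates preserve `small` and map strings in `big` to a single coset of `small`.

Pauli strings are treated as vectors over the field with two elements with the symplectic form that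
records anticommutation. Outside the pure part, `small` contains the symplectic complement of `big`.
Hence, by symplectic reduction (`PauliFrame.exists_add_of_mem_perp`), the logical Paulis represented
in `small` contain those that commute with all logical Paulis represented in `big`, and they
commute with one another. If no `Uⱼ` is Clifford, then `big = small`, and the logical Paulis in
`small` form a maximal commuting set that is preserved by the logical action of the gate.

For a gate `V` on one logical qubit per block, compare what `V` does to the affected tensor factors
with what the whole gate does: the change of each factor is a single-qubit logical Pauli in `small`.
These lie on one axis per logical qubit, which a local Clifford gate rotates to `Z`
(`exists_localClifford_of_actsAs`). For arbitrary gates, a symplectic basis whose `Z` half spans the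
maximal commuting set modulo the stabilizer is completed to an encoding map
(`exists_isLogicalEncoding`), for which the preserved span is that of the logical `Z` operators.

Hadamard and Toffoli on the logical qubit `s`: if no nontrivial Pauli of `s` is represented in
`small`, then all Paulis of `s` extend to `big`, and each of them is mapped by the Toffoli gate to a
multiple of a single Pauli string, which is false. Otherwise the Hadamard gate preserves the unique
such Pauli, which must be `Y`; but the Toffoli gate multiplies `Y` on the target by a controlled `Z`
gate and so does not preserve this axis (`not_hadamard_and_toffoli`).
-/

namespace StabilizerCode

/-! ### Tensor products of matrices -/

section Tensor

variable {ι α β γ : Type} [Fintype ι]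

lemma piTensor_apply (A : ι → Matrix α β ℂ) (x : ι → α) (y : ι → β) :
    piTensor A x y = ∏ i, A i (x i) (y i) := rfl

lemma piTensor_mul [DecidableEq ι] [Fintype β] (A : ι → Matrix α β ℂ) (B : ι → Matrix β γ ℂ) :
    piTensor A * piTensor B = piTensor fun i => A i * B i := by
  ext x y
  simp only [Matrix.mul_apply, piTensor_apply, ← Finset.prod_mul_distrib]
  rw [Fintype.prod_sum]

lemma piTensor_conjTranspose (A : ι → Matrix α β ℂ) :
    (piTensor A)ᴴ = piTensor fun i => (A i)ᴴ := by
  ext x y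
  simp [Matrix.conjTranspose_apply, piTensor_apply]

lemma piTensor_one [DecidableEq α] : piTensor (fun _ : ι => (1 : Matrix α α ℂ)) = 1 := by
  classical
  ext x y
  simp only [piTensor_apply, Matrix.one_apply]
  rw [Finset.prod_ite_zero]
  simp [funext_iff]

lemma piTensor_smul (c : ι → ℂ) (A : ι → Matrix α β ℂ) :
    piTensor (fun i => c i • A i) = (∏ i, c i) • piTensor A := by
  ext x y
  simp [piTensor_apply, Finset.prod_mul_distrib]

lemma piTensor_eq_zero {A : ι → Matrix α β ℂ} {i : ι} (h : A i = 0) : piTensor A = 0 := by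
  ext x y
  exact Finset.prod_eq_zero (Finset.mem_univ i) (by simp [h])

lemma piTensor_sum [DecidableEq ι] {κ : Type} [Fintype κ] (A : ι → κ → Matrix α β ℂ) :
    piTensor (fun i => ∑ a, A i a) = ∑ f : ι → κ, piTensor fun i => A i (f i) := by
  ext x y
  simp only [piTensor_apply, Matrix.sum_apply]
  rw [Fintype.prod_sum]

lemma trace_piTensor [DecidableEq ι] [Fintype α] (A : ι → Matrix α α ℂ) :
    (piTensor A).trace = ∏ i, (A i).trace := by
  simp only [Matrix.trace, Matrix.diag_apply, piTensor_apply]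
  rw [Fintype.prod_sum]

end Tensor

/-! ### Pauli labels and the symplectic form -/

/-- The label `(x, z)` of a single-qubit Pauli matrix: `(1, 0)` is `X`, `(0, 1)` is `Z`, and
`(1, 1)` is `Y`. Products of Pauli matrices are sums of labels up to a phase. -/
abbrev Label : Type := ZMod 2 × ZMod 2

/-- The number of a label in the order `I, X, Y, Z`. -/
def labelCode (q : Label) : Fin 4 :=
  if q.1 = 0 then (if q.2 = 0 then 0 else 3) else (if q.2 = 0 then 1 else 2)

lemma labelCode_surjective : Function.Surjective labelCode := by decide

lemma labelCode_eq_zero : ∀ q : Label, labelCode q = 0 ↔ q = 0 := by decide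

lemma label_cases : ∀ q : Label, q = (0, 0) ∨ q = (1, 0) ∨ q = (1, 1) ∨ q = (0, 1) := by decide

/-- The symplectic form on single-qubit labels: `1` exactly when the Pauli matrices anticommute. -/
def symp₁ (p q : Label) : ZMod 2 := p.1 * q.2 + p.2 * q.1

/-- The symplectic form on labels of Pauli strings. -/
def symp {ι : Type} [Fintype ι] (u v : ι → Label) : ZMod 2 := ∑ i, symp₁ (u i) (v i)

/-- The sign `(-1)ᵃ`. -/
noncomputable def sgn (a : ZMod 2) : ℂ := if a = 0 then 1 else -1

@[simp] lemma sgn_zero : sgn 0 = 1 := by simp [sgn]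

@[simp] lemma sgn_one : sgn 1 = -1 := by simp [sgn]

lemma zmod2_cases : ∀ a : ZMod 2, a = 0 ∨ a = 1 := by decide

lemma sgn_add (a b : ZMod 2) : sgn (a + b) = sgn a * sgn b := by
  have h : (1 + 1 : ZMod 2) = 0 := by decide
  rcases zmod2_cases a with rfl | rfl <;> rcases zmod2_cases b with rfl | rfl <;> simp [h]

lemma sgn_mul_self (a : ZMod 2) : sgn a * sgn a = 1 := by
  rcases zmod2_cases a with rfl | rfl <;> simp

lemma sgn_injective : Function.Injective sgn := by
  intro a b h
  rcases zmod2_cases a with rfl | rfl <;> rcases zmod2_cases b with rfl | rfl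
  · rfl
  · norm_num at h
  · norm_num at h
  · rfl

lemma sgn_ne_zero (a : ZMod 2) : sgn a ≠ 0 := by
  rcases zmod2_cases a with rfl | rfl <;> simp

lemma sgn_sum {ι : Type} [Fintype ι] (f : ι → ZMod 2) : sgn (∑ i, f i) = ∏ i, sgn (f i) := by
  classical
  induction (Finset.univ : Finset ι) using Finset.induction_on with
  | empty => simp
  | insert a s ha ih => rw [Finset.sum_insert ha, Finset.prod_insert ha, sgn_add, ih]

section Symp

variable {ι : Type} [Fintype ι]

lemma symp₁_comm (p q : Label) : symp₁ p q = symp₁ q p := by simp only [symp₁]; ring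

lemma symp₁_self : ∀ p : Label, symp₁ p p = 0 := by decide

lemma symp₁_add_left (p p' q : Label) : symp₁ (p + p') q = symp₁ p q + symp₁ p' q := by
  simp only [symp₁, Prod.fst_add, Prod.snd_add]; ring

@[simp] lemma symp₁_zero_left (q : Label) : symp₁ 0 q = 0 := by simp [symp₁]

@[simp] lemma symp₁_zero_right (q : Label) : symp₁ q 0 = 0 := by simp [symp₁]

lemma symp_comm (u v : ι → Label) : symp u v = symp v u := by
  simp only [symp, symp₁_comm]

lemma symp_self (u : ι → Label) : symp u u = 0 := by simp [symp, symp₁_self]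

lemma symp_add_left (u u' v : ι → Label) : symp (u + u') v = symp u v + symp u' v := by
  simp [symp, symp₁_add_left, Finset.sum_add_distrib]

lemma symp_add_right (u v v' : ι → Label) : symp u (v + v') = symp u v + symp u v' := by
  rw [symp_comm, symp_add_left, symp_comm v, symp_comm v']

@[simp] lemma symp_zero_left (v : ι → Label) : symp 0 v = 0 := by simp [symp]

@[simp] lemma symp_zero_right (v : ι → Label) : symp v 0 = 0 := by simp [symp]

lemma label_add_self {V : Type} [AddCommGroup V] [Module (ZMod 2) V] (u : V) : u + u = 0 := by
  have h : (2 : ZMod 2) • u = u + u := two_smul _ u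
  rw [← h, show (2 : ZMod 2) = 0 by decide, zero_smul]

lemma label_sub {V : Type} [AddCommGroup V] [Module (ZMod 2) V] (u v : V) : u - v = u + v := by
  rw [sub_eq_iff_eq_add, add_assoc, label_add_self, add_zero]

lemma symp_smul_left (a : ZMod 2) (u v : ι → Label) : symp (a • u) v = a * symp u v := by
  rcases zmod2_cases a with rfl | rfl <;> simp

lemma symp_smul_right (a : ZMod 2) (u v : ι → Label) : symp u (a • v) = a * symp u v := by
  rcases zmod2_cases a with rfl | rfl <;> simp

lemma symp_sum_right {κ : Type} (u : ι → Label) (s : Finset κ) (f : κ → ι → Label) :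
    symp u (∑ l ∈ s, f l) = ∑ l ∈ s, symp u (f l) := by
  classical
  induction s using Finset.induction_on with
  | empty => simp
  | insert a s ha ih => rw [Finset.sum_insert ha, Finset.sum_insert ha, symp_add_right, ih]

lemma symp_sum_left {κ : Type} (v : ι → Label) (s : Finset κ) (f : κ → ι → Label) :
    symp (∑ l ∈ s, f l) v = ∑ l ∈ s, symp (f l) v := by
  simp only [symp_comm _ v, symp_sum_right]

lemma symp_single_right [DecidableEq ι] (u : ι → Label) (i : ι) (q : Label) :
    symp u (Pi.single i q) = symp₁ (u i) q := by
  rw [symp, Finset.sum_eq_single i] <;> simp +contextual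

lemma symp_single_left [DecidableEq ι] (u : ι → Label) (i : ι) (q : Label) :
    symp (Pi.single i q) u = symp₁ q (u i) := by
  rw [symp_comm, symp_single_right, symp₁_comm]

/-- Every linear functional on labels is the pairing with some label. -/
lemma exists_symp_eq [DecidableEq ι] (f : (ι → Label) →ₗ[ZMod 2] ZMod 2) :
    ∃ y, ∀ v, symp y v = f v := by
  refine ⟨fun j => (f (Pi.single j (0, 1)), f (Pi.single j (1, 0))), fun v => ?_⟩
  conv_rhs => rw [← Finset.univ_sum_single v]
  rw [map_sum, symp]
  refine Finset.sum_congr rfl fun j _ => ?_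
  have hj : (Pi.single j (v j) : ι → Label) = (v j).2 • (Pi.single j (0, 1) : ι → Label) +
      (v j).1 • (Pi.single j (1, 0) : ι → Label) := by
    rw [← Pi.single_smul, ← Pi.single_smul, ← Pi.single_add]
    simp
  rw [hj, map_add, map_smul, map_smul, symp₁, smul_eq_mul, smul_eq_mul]
  ring

/-- The labels commuting with all labels of `N`. -/
def perp (N : Submodule (ZMod 2) (ι → Label)) : Submodule (ZMod 2) (ι → Label) where
  carrier := {v | ∀ w ∈ N, symp v w = 0}
  add_mem' := fun ha hb w hw => by rw [symp_add_left, ha w hw, hb w hw, add_zero]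
  zero_mem' := fun w _ => by simp
  smul_mem' := fun c v hv w hw => by rw [symp_smul_left, hv w hw, mul_zero]

lemma mem_perp {N : Submodule (ZMod 2) (ι → Label)} {v : ι → Label} :
    v ∈ perp N ↔ ∀ w ∈ N, symp v w = 0 := Iff.rfl

/-- One half of `Nᗮᗮ = N` for the symplectic form. -/
lemma mem_of_forall_mem_perp [DecidableEq ι] {N : Submodule (ZMod 2) (ι → Label)} {v : ι → Label}
    (h : ∀ w ∈ perp N, symp w v = 0) : v ∈ N := by
  by_contra hv
  obtain ⟨f, hf, hN⟩ := Submodule.exists_le_ker_of_notMem hv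
  obtain ⟨y, hy⟩ := exists_symp_eq f
  refine hf ?_
  rw [← hy]
  refine h y fun w hw => ?_
  rw [hy]
  exact hN hw

end Symp

/-! ### Pauli strings -/

lemma mem_phases_iff_pow_four (c : ℂ) :
    c ∈ ({1, -1, Complex.I, -Complex.I} : Set ℂ) ↔ c ^ 4 = 1 := by
  have hI : Complex.I ^ 2 = -1 := Complex.I_sq
  constructor
  · rintro (rfl | rfl | rfl | rfl)
    · norm_num
    · norm_num
    · exact Complex.I_pow_four
    · rw [neg_pow, Complex.I_pow_four]; norm_num
  · intro h
    have : (c - 1) * (c + 1) * (c - Complex.I) * (c + Complex.I) = 0 := by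
      have : (c - 1) * (c + 1) * (c - Complex.I) * (c + Complex.I)
        = c ^ 4 - Complex.I ^ 2 * c ^ 2 - c ^ 2 + Complex.I ^ 2 := by ring
      rw [this, h, hI]; ring
    simp only [mul_eq_zero, sub_eq_zero, add_eq_zero_iff_eq_neg] at this
    simp only [Set.mem_insert_iff, Set.mem_singleton_iff]
    tauto

/-- The Pauli matrix with a given label. -/
noncomputable def sigma (q : Label) : Matrix (Fin 2) (Fin 2) ℂ := pauliMat (labelCode q)

/-- The power of `i` that makes `XˣZᶻ` Hermitian. -/
noncomputable def yPhase (q : Label) : ℂ := if q = (1, 1) then Complex.I else 1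

lemma yPhase_pow (q : Label) : yPhase q ^ 4 = 1 := by
  unfold yPhase; split_ifs <;> simp [Complex.I_pow_four]

/-- A bit as an element of the field with two elements. -/
def bit (a : Fin 2) : ZMod 2 := if a = 0 then 0 else 1

lemma bit_bijective : Function.Bijective bit := by decide

lemma sigma_apply (q : Label) (a b : Fin 2) :
    sigma q a b = if bit a = bit b + q.1 then yPhase q * sgn (q.2 * bit b) else 0 := by
  have h : (1 + 1 : ZMod 2) = 0 := by decide
  rcases label_cases q with rfl | rfl | rfl | rfl <;> fin_cases a <;> fin_cases b <;>
    simp [sigma, labelCode, pauliMat, yPhase, h, bit]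

lemma sigma_zero : sigma 0 = 1 := by simp [sigma, labelCode, pauliMat]

lemma sigma_conjTranspose (q : Label) : (sigma q)ᴴ = sigma q := by
  rcases label_cases q with rfl | rfl | rfl | rfl <;> ext a b <;> fin_cases a <;> fin_cases b <;>
    simp [sigma, labelCode, pauliMat, Matrix.conjTranspose_apply]

lemma trace_sigma (q : Label) : (sigma q).trace = if q = 0 then 2 else 0 := by
  rcases label_cases q with rfl | rfl | rfl | rfl <;>
    simp [sigma, labelCode, pauliMat, Matrix.trace_fin_two]

/-- The phase of a product of two Pauli matrices. -/
noncomputable def mulPhase (p q : Label) : ℂ :=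
  yPhase p * yPhase q * (yPhase (p + q))⁻¹ * sgn (p.2 * q.1)

lemma mulPhase_pow (p q : Label) : mulPhase p q ^ 4 = 1 := by
  have : sgn (p.2 * q.1) ^ 4 = 1 := by
    rw [show 4 = 2 * 2 by norm_num, pow_mul, sq, sq, sgn_mul_self, one_mul]
  simp [mulPhase, mul_pow, yPhase_pow, this]

lemma sigma_mul (p q : Label) : sigma p * sigma q = mulPhase p q • sigma (p + q) := by
  have h : (1 + 1 : ZMod 2) = 0 := by decide
  rcases label_cases p with rfl | rfl | rfl | rfl <;>
  rcases label_cases q with rfl | rfl | rfl | rfl <;>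
  simp [sigma, labelCode, pauliMat, mulPhase, yPhase, h, Matrix.one_fin_two]

lemma mulPhase_comm (p q : Label) : mulPhase p q = sgn (symp₁ p q) * mulPhase q p := by
  have h2 : sgn (symp₁ p q) = sgn (p.2 * q.1) * sgn (q.2 * p.1) := by
    rw [← sgn_add, symp₁]; congr 1; ring
  rw [h2, mulPhase, mulPhase, add_comm q p]
  linear_combination (-yPhase p * yPhase q * (yPhase (p + q))⁻¹ * sgn (p.2 * q.1)) *
    sgn_mul_self (q.2 * p.1)

/-- The Pauli string with a given label. -/
noncomputable def tau {ι : Type} [Fintype ι] (v : ι → Label) : QOp ι := piTensor fun i => sigma (v i)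

section Tau

variable {ι : Type} [Fintype ι]

lemma mem_pauliGroup_iff {M : QOp ι} :
    M ∈ pauliGroup ι ↔ ∃ c : ℂ, c ^ 4 = 1 ∧ ∃ v : ι → Label, M = c • tau v := by
  constructor
  · rintro ⟨c, hc, p, rfl⟩
    choose v hv using fun i => labelCode_surjective (p i)
    exact ⟨c, (mem_phases_iff_pow_four c).1 hc, v, by simp [tau, pauliString, sigma, hv]⟩
  · rintro ⟨c, hc, v, rfl⟩
    exact ⟨c, (mem_phases_iff_pow_four c).2 hc, fun i => labelCode (v i), rfl⟩

lemma tau_zero : tau (0 : ι → Label) = 1 := by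
  simp [tau, sigma_zero, piTensor_one]

lemma tau_conjTranspose (v : ι → Label) : (tau v)ᴴ = tau v := by
  simp [tau, piTensor_conjTranspose, sigma_conjTranspose]

variable [DecidableEq ι]

lemma tau_mul (u v : ι → Label) :
    tau u * tau v = (∏ i, mulPhase (u i) (v i)) • tau (u + v) := by
  simp only [tau, piTensor_mul, sigma_mul, piTensor_smul, Pi.add_apply]

lemma exists_tau_mul (u v : ι → Label) : ∃ c : ℂ, c ^ 4 = 1 ∧ tau u * tau v = c • tau (u + v) :=
  ⟨_, by simp [← Finset.prod_pow, mulPhase_pow], tau_mul u v⟩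

lemma tau_comm (u v : ι → Label) : tau u * tau v = sgn (symp u v) • (tau v * tau u) := by
  rw [tau_mul, tau_mul, smul_smul, symp, sgn_sum, ← Finset.prod_mul_distrib, add_comm v u]
  simp only [← mulPhase_comm]

lemma tau_comm_of_symp_eq_zero {u v : ι → Label} (h : symp u v = 0) :
    tau u * tau v = tau v * tau u := by
  rw [tau_comm, h, sgn_zero, one_smul]

lemma tau_mul_self (v : ι → Label) : tau v * tau v = 1 := by
  rw [tau, piTensor_mul, ← piTensor_one]
  congr 1
  funext i
  rcases label_cases (v i) with h | h | h | h <;> rw [h, sigma_mul, label_add_self, sigma_zero] <;>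
    simp [mulPhase, yPhase, label_add_self, Prod.ext_iff]

lemma trace_tau (v : ι → Label) : (tau v).trace = if v = 0 then 2 ^ Fintype.card ι else 0 := by
  rw [tau, trace_piTensor]
  simp only [trace_sigma]
  rw [Finset.prod_ite_zero]
  simp [funext_iff]

lemma phase_ne_zero {c : ℂ} (h : c ^ 4 = 1) : c ≠ 0 := by
  rintro rfl; norm_num at h

lemma tau_ne_zero (v : ι → Label) : tau v ≠ 0 := by
  intro h
  have := tau_mul_self v
  rw [h, zero_mul] at this
  exact zero_ne_one this

/-- The coefficient of the Pauli string `tau v` in the Pauli expansion of `M`. -/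
noncomputable def coeff (v : ι → Label) (M : QOp ι) : ℂ :=
  (2 ^ Fintype.card ι)⁻¹ * (tau v * M).trace

lemma trace_tau_mul_tau (u v : ι → Label) :
    (tau u * tau v).trace = if u = v then 2 ^ Fintype.card ι else 0 := by
  obtain ⟨c, -, hc⟩ := exists_tau_mul u v
  split_ifs with h
  · subst h
    rw [tau_mul_self, ← tau_zero, trace_tau, if_pos rfl]
  · rw [hc, Matrix.trace_smul, trace_tau, if_neg, smul_zero]
    rwa [← label_sub, sub_eq_zero]

lemma coeff_tau (u v : ι → Label) : coeff u (tau v) = if u = v then 1 else 0 := by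
  rw [coeff, trace_tau_mul_tau]
  split_ifs <;> simp

lemma coeff_smul (v : ι → Label) (c : ℂ) (M : QOp ι) : coeff v (c • M) = c * coeff v M := by
  simp [coeff]; ring

lemma coeff_sum {κ : Type} (s : Finset κ) (v : ι → Label) (f : κ → QOp ι) :
    coeff v (∑ a ∈ s, f a) = ∑ a ∈ s, coeff v (f a) := by
  simp [coeff, Matrix.trace_sum, Finset.mul_sum]

/-- Completeness of the Pauli matrices. -/
lemma sum_sigma_apply (a b c d : Fin 2) :
    ∑ q, sigma q a b * sigma q c d = if a = d ∧ b = c then 2 else 0 := by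
  rw [Fintype.sum_prod_type]
  simp only [show (Finset.univ : Finset (ZMod 2)) = {0, 1} by decide]
  fin_cases a <;> fin_cases b <;> fin_cases c <;> fin_cases d <;>
    simp [sigma, labelCode, pauliMat] <;> norm_num

lemma sum_tau_apply (x y z w : ι → Fin 2) :
    ∑ v, tau v x y * tau v z w = if x = w ∧ y = z then 2 ^ Fintype.card ι else 0 := by
  simp only [tau, piTensor_apply, ← Finset.prod_mul_distrib]
  rw [← Fintype.prod_sum (f := fun i q => sigma q (x i) (y i) * sigma q (z i) (w i))]
  simp only [sum_sigma_apply]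
  rw [Finset.prod_ite_zero]
  simp [funext_iff, forall_and]

/-- The Pauli expansion. -/
lemma sum_coeff_smul_tau (M : QOp ι) : ∑ v, coeff v M • tau v = M := by
  ext z w
  simp only [Matrix.sum_apply, Matrix.smul_apply, smul_eq_mul, coeff, Matrix.trace,
    Matrix.diag_apply, Matrix.mul_apply]
  simp only [mul_assoc, ← Finset.mul_sum, Finset.sum_mul]
  rw [Finset.sum_comm]
  simp only [Finset.sum_comm (s := (Finset.univ : Finset (ι → Label)))]
  simp only [mul_comm (M _ _)]
  simp only [← mul_assoc, ← Finset.sum_mul, sum_tau_apply]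
  simp [ite_and]

lemma eq_of_coeff_eq {M N : QOp ι} (h : ∀ v, coeff v M = coeff v N) : M = N := by
  rw [← sum_coeff_smul_tau M, ← sum_coeff_smul_tau N]
  simp only [h]

lemma exists_coeff_ne_zero {M : QOp ι} (h : M ≠ 0) : ∃ v, coeff v M ≠ 0 := by
  by_contra! h0
  exact h (eq_of_coeff_eq fun v => by rw [h0 v]; simp [coeff])

end Tau

/-! ### Stabilizers and code projectors in terms of labels -/

section Stabilizer

lemma eq_zero_of_eq_neg {α β : Type} {M : Matrix α β ℂ} (h : M = -M) : M = 0 := by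
  ext i j
  have := congrFun (congrFun h i) j
  rw [Matrix.neg_apply] at this
  exact self_eq_neg.1 this

variable {n : ℕ} {S : Subgroup (unitaryGroup (Fin n → Fin 2) ℂ)}

/-- The labels of the elements of a stabilizer, forming a binary linear code. -/
def stabLabels (S : Subgroup (unitaryGroup (Fin n → Fin 2) ℂ)) :
    Submodule (ZMod 2) (Fin n → Label) where
  carrier := {v | ∃ g ∈ S, ∃ c : ℂ, (g : QOp (Fin n)) = c • tau v}
  add_mem' := by
    rintro u v ⟨g, hg, c, hc⟩ ⟨h, hh, d, hd⟩
    obtain ⟨e, -, he⟩ := exists_tau_mul u v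
    refine ⟨g * h, S.mul_mem hg hh, c * d * e, ?_⟩
    rw [Submonoid.coe_mul, hc, hd, smul_mul_smul_comm, he, smul_smul]
  zero_mem' := ⟨1, S.one_mem, 1, by simp [tau_zero]⟩
  smul_mem' := by
    rintro a v ⟨g, hg, c, hc⟩
    rcases zmod2_cases a with rfl | rfl
    · exact ⟨1, S.one_mem, 1, by simp [tau_zero]⟩
    · exact ⟨g, hg, c, by simpa using hc⟩

lemma label_eq_of_smul_tau_eq {ι : Type} [Fintype ι] [DecidableEq ι] {u v : ι → Label} {c d : ℂ}
    (hc : c ≠ 0) (h : c • tau u = d • tau v) : u = v ∧ c = d := by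
  have h1 := congrArg (coeff u) h
  rw [coeff_smul, coeff_smul, coeff_tau, coeff_tau, if_pos rfl] at h1
  split_ifs at h1 with huv
  · exact ⟨huv, by simpa using h1⟩
  · simp [hc] at h1

lemma exists_label (hS : IsStabilizer S) {g : unitaryGroup (Fin n → Fin 2) ℂ} (hg : g ∈ S) :
    ∃ v ∈ stabLabels S, ∃ c : ℂ, (c = 1 ∨ c = -1) ∧ (g : QOp (Fin n)) = c • tau v := by
  obtain ⟨c, hc, v, hv⟩ := mem_pauliGroup_iff.1 (hS.pauli g hg)
  refine ⟨v, ⟨g, hg, c, hv⟩, c, ?_, hv⟩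
  have h2 : (c ^ 2 - 1) * (c ^ 2 + 1) = 0 := by linear_combination hc
  rcases mul_eq_zero.1 h2 with h | h
  · exact sq_eq_one_iff.1 (sub_eq_zero.1 h)
  · exfalso
    refine hS.neg_one (g * g) (S.mul_mem hg hg) ?_
    rw [Submonoid.coe_mul, hv, smul_mul_smul_comm, tau_mul_self, ← sq,
      eq_neg_of_add_eq_zero_left h, neg_smul, one_smul]

lemma phase_of_mem (hS : IsStabilizer S) {g : unitaryGroup (Fin n → Fin 2) ℂ} (hg : g ∈ S)
    {c : ℂ} {v : Fin n → Label} (h : (g : QOp (Fin n)) = c • tau v) : c = 1 ∨ c = -1 := by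
  obtain ⟨w, -, d, hd, hw⟩ := exists_label hS hg
  have hd0 : d ≠ 0 := by rcases hd with rfl | rfl <;> norm_num
  obtain ⟨-, rfl⟩ := label_eq_of_smul_tau_eq hd0 (hw.symm.trans h)
  exact hd

lemma eq_of_label_eq (hS : IsStabilizer S) {g h : unitaryGroup (Fin n → Fin 2) ℂ} (hg : g ∈ S)
    (hh : h ∈ S) {c d : ℂ} {v : Fin n → Label} (hc : (g : QOp (Fin n)) = c • tau v)
    (hd : (h : QOp (Fin n)) = d • tau v) : g = h := by
  have h0 : ¬ c * d = -1 := fun he => by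
    refine hS.neg_one (g * h) (S.mul_mem hg hh) ?_
    rw [Submonoid.coe_mul, hc, hd, smul_mul_smul_comm, tau_mul_self, he, neg_smul, one_smul]
  have hcd : c = d := by
    rcases phase_of_mem hS hg hc with rfl | rfl <;> rcases phase_of_mem hS hh hd with rfl | rfl <;>
      first | rfl | norm_num at h0
  exact Subtype.ext (by rw [hc, hd, hcd])

lemma stabLabels_isotropic (hS : IsStabilizer S) {u v : Fin n → Label} (hu : u ∈ stabLabels S)
    (hv : v ∈ stabLabels S) : symp u v = 0 := by
  obtain ⟨g, hg, c, hc⟩ := hu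
  obtain ⟨h, hh, d, hd⟩ := hv
  have hc0 : c ≠ 0 := by rcases phase_of_mem hS hg hc with rfl | rfl <;> norm_num
  have hd0 : d ≠ 0 := by rcases phase_of_mem hS hh hd with rfl | rfl <;> norm_num
  have h1 := congrArg (Subtype.val) (hS.comm g hg h hh)
  simp only [Submonoid.coe_mul] at h1
  rw [hc, hd, smul_mul_smul_comm, smul_mul_smul_comm, tau_comm u v, smul_smul, tau_mul, smul_smul,
    smul_smul] at h1
  have h2 := (label_eq_of_smul_tau_eq (by
    have := sgn_ne_zero (symp u v)
    have h3 : (∏ i, mulPhase (v i) (u i)) ≠ 0 :=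
      Finset.prod_ne_zero_iff.2 fun i _ => phase_ne_zero (mulPhase_pow _ _)
    positivity) h1).2
  have h3 : (∏ i, mulPhase (v i) (u i)) ≠ 0 :=
    Finset.prod_ne_zero_iff.2 fun i _ => phase_ne_zero (mulPhase_pow _ _)
  have h4 : sgn (symp u v) = sgn 0 := by
    rw [sgn_zero]
    have : (c * d * ∏ i, mulPhase (v i) (u i)) ≠ 0 := by positivity
    apply mul_right_cancel₀ this
    linear_combination h2
  exact sgn_injective h4

lemma finite_of_isStabilizer (hS : IsStabilizer S) : Finite S := by
  have h : ∀ g : S, ∃ v : Fin n → Label, ∃ c : ℂ,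
      ((g : unitaryGroup (Fin n → Fin 2) ℂ) : QOp (Fin n)) = c • tau v := fun g => by
    obtain ⟨v, -, c, -, h⟩ := exists_label hS g.2
    exact ⟨v, c, h⟩
  choose f c hf using h
  refine Finite.of_injective f fun g h hgh => Subtype.ext ?_
  exact eq_of_label_eq hS g.2 h.2 (hf g) (by rw [hgh]; exact hf h)

lemma codeProjector_eq_sum [Fintype S] : codeProjector S =
    (Nat.card S : ℂ)⁻¹ • ∑ g : S, ((g : unitaryGroup (Fin n → Fin 2) ℂ) : QOp (Fin n)) := by
  rw [codeProjector, finsum_eq_sum_of_fintype]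

lemma natCard_ne_zero (hS : IsStabilizer S) : (Nat.card S : ℂ) ≠ 0 := by
  have := finite_of_isStabilizer hS
  exact_mod_cast Nat.card_pos.ne'

/-- The Pauli strings occurring in the code projector are those of the stabilizer. -/
lemma coeff_codeProjector_ne_zero_iff (hS : IsStabilizer S) (v : Fin n → Label) :
    coeff v (codeProjector S) ≠ 0 ↔ v ∈ stabLabels S := by
  have := finite_of_isStabilizer hS
  have := Fintype.ofFinite S
  rw [codeProjector_eq_sum, coeff_smul, coeff_sum]
  constructor
  · intro h
    obtain ⟨g, -, hg⟩ := Finset.exists_ne_zero_of_sum_ne_zero (right_ne_zero_of_mul h)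
    obtain ⟨w, hw, c, -, hc⟩ := exists_label hS g.2
    rw [hc, coeff_smul, coeff_tau] at hg
    split_ifs at hg with hvw
    · exact hvw ▸ hw
    · simp at hg
  · rintro ⟨g, hg, c, hc⟩
    rw [Finset.sum_eq_single ⟨g, hg⟩]
    · rw [hc, coeff_smul, coeff_tau, if_pos rfl, mul_one]
      refine mul_ne_zero (inv_ne_zero (natCard_ne_zero hS)) ?_
      rcases phase_of_mem hS hg hc with rfl | rfl <;> norm_num
    · intro h _ hne
      obtain ⟨w, hw, d, -, hd⟩ := exists_label hS h.2
      rw [hd, coeff_smul, coeff_tau, if_neg, mul_zero]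
      rintro rfl
      exact hne (Subtype.ext (eq_of_label_eq hS h.2 hg hd hc))
    · simp

lemma stab_mul_codeProjector (hS : IsStabilizer S) {g : unitaryGroup (Fin n → Fin 2) ℂ}
    (hg : g ∈ S) : (g : QOp (Fin n)) * codeProjector S = codeProjector S := by
  have := finite_of_isStabilizer hS
  have := Fintype.ofFinite S
  rw [codeProjector_eq_sum, Matrix.mul_smul, Finset.mul_sum]
  congr 1
  exact Fintype.sum_equiv (Equiv.mulLeft (⟨g, hg⟩ : S)) _ _ fun h => rfl

lemma codeProjector_mul_self (hS : IsStabilizer S) :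
    codeProjector S * codeProjector S = codeProjector S := by
  have := finite_of_isStabilizer hS
  have := Fintype.ofFinite S
  conv_lhs => enter [1]; rw [codeProjector_eq_sum]
  rw [Matrix.smul_mul, Finset.sum_mul]
  simp only [fun g : S => stab_mul_codeProjector hS g.2]
  rw [Finset.sum_const, Finset.card_univ, ← Nat.card_eq_fintype_card, ← Nat.cast_smul_eq_nsmul ℂ,
    smul_smul, inv_mul_cancel₀ (natCard_ne_zero hS), one_smul]

lemma codeProjector_conjTranspose (hS : IsStabilizer S) :
    (codeProjector S)ᴴ = codeProjector S := by
  have := finite_of_isStabilizer hS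
  have := Fintype.ofFinite S
  rw [codeProjector_eq_sum, Matrix.conjTranspose_smul, Matrix.conjTranspose_sum]
  congr 1
  · simp
  · exact Fintype.sum_equiv (Equiv.inv S) _ _ fun h => rfl

lemma codeProjector_mul_stab (hS : IsStabilizer S) {g : unitaryGroup (Fin n → Fin 2) ℂ}
    (hg : g ∈ S) : codeProjector S * (g : QOp (Fin n)) = codeProjector S := by
  have h := congrArg Matrix.conjTranspose (stab_mul_codeProjector hS (S.inv_mem hg))
  rw [Matrix.conjTranspose_mul, codeProjector_conjTranspose hS] at h
  rw [← h]
  congr 1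
  change _ = ((g : QOp (Fin n))ᴴ)ᴴ
  rw [Matrix.conjTranspose_conjTranspose]

lemma codeProjector_ne_zero (hS : IsStabilizer S) : codeProjector S ≠ 0 := by
  intro h
  refine (coeff_codeProjector_ne_zero_iff hS 0).2 (Submodule.zero_mem _) ?_
  rw [h]; simp [coeff]

/-- A Pauli string in the centralizer of the stabilizer preserves the code. -/
lemma tau_mul_codeProjector_comm (hS : IsStabilizer S) {v : Fin n → Label}
    (hv : v ∈ perp (stabLabels S)) :
    tau v * codeProjector S = codeProjector S * tau v := by
  have := finite_of_isStabilizer hS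
  have := Fintype.ofFinite S
  rw [codeProjector_eq_sum, Matrix.mul_smul, Matrix.smul_mul, Finset.mul_sum, Finset.sum_mul]
  congr 1
  refine Finset.sum_congr rfl fun g _ => ?_
  obtain ⟨w, hw, c, -, hc⟩ := exists_label hS g.2
  rw [hc, Matrix.mul_smul, Matrix.smul_mul, tau_comm_of_symp_eq_zero (hv w hw)]

/-- A Pauli string that anticommutes with a stabilizer element maps the code to its complement. -/
lemma codeProjector_mul_tau_mul (hS : IsStabilizer S) {v : Fin n → Label}
    (hv : v ∉ perp (stabLabels S)) :
    codeProjector S * tau v * codeProjector S = 0 := by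
  rw [mem_perp] at hv
  push Not at hv
  obtain ⟨w, ⟨g, hg, c, hc⟩, hw⟩ := hv
  have hw1 : symp v w = 1 := (zmod2_cases _).resolve_left hw
  have h1 : tau v * (g : QOp (Fin n)) = -((g : QOp (Fin n)) * tau v) := by
    rw [hc, Matrix.mul_smul, Matrix.smul_mul, tau_comm, hw1, sgn_one, neg_one_smul, smul_neg]
  have h2 : codeProjector S * tau v * codeProjector S =
      -(codeProjector S * tau v * codeProjector S) := by
    nth_rewrite 2 [← stab_mul_codeProjector hS hg]
    rw [← mul_assoc, mul_assoc _ (tau v), h1, mul_neg, ← mul_assoc, codeProjector_mul_stab hS hg,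
      neg_mul]
  exact eq_zero_of_eq_neg h2

end Stabilizer

/-! ### Conjugation by transversal gates -/

section ConjCoeff

variable {ι : Type} [Fintype ι] [DecidableEq ι]

/-- The matrix entries of conjugation by `U` in the Pauli basis. -/
noncomputable def conjCoeff (U : QOp ι) (q p : ι → Label) : ℂ := coeff q (U * tau p * Uᴴ)

lemma sum_conjCoeff (U : QOp ι) (p : ι → Label) :
    ∑ q, conjCoeff U q p • tau q = U * tau p * Uᴴ := sum_coeff_smul_tau _

lemma conjCoeff_one (q p : ι → Label) : conjCoeff 1 q p = if q = p then 1 else 0 := by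
  simp [conjCoeff, coeff_tau]

lemma unitary_mul_conjTranspose {U : QOp ι} (hU : U ∈ unitaryGroup (ι → Fin 2) ℂ) :
    U * Uᴴ = 1 := Matrix.mem_unitaryGroup_iff.1 hU

lemma unitary_conjTranspose_mul {U : QOp ι} (hU : U ∈ unitaryGroup (ι → Fin 2) ℂ) :
    Uᴴ * U = 1 := Matrix.mem_unitaryGroup_iff'.1 hU

lemma conjCoeff_zero_right {U : QOp ι} (hU : U ∈ unitaryGroup (ι → Fin 2) ℂ) (q : ι → Label) :
    conjCoeff U q 0 = if q = 0 then 1 else 0 := by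
  rw [conjCoeff, tau_zero, mul_one, unitary_mul_conjTranspose hU, ← tau_zero, coeff_tau]

lemma conjCoeff_zero_left {U : QOp ι} (hU : U ∈ unitaryGroup (ι → Fin 2) ℂ) (p : ι → Label) :
    conjCoeff U 0 p = if p = 0 then 1 else 0 := by
  rw [conjCoeff, coeff, tau_zero, one_mul, Matrix.trace_mul_comm, ← mul_assoc,
    unitary_conjTranspose_mul hU, one_mul, ← one_mul (tau p), ← tau_zero (ι := ι)]
  change coeff 0 (tau p) = _
  rw [coeff_tau]
  simp only [eq_comm]

lemma exists_conjCoeff_ne_zero {U : QOp ι} (hU : U ∈ unitaryGroup (ι → Fin 2) ℂ) (p : ι → Label) :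
    ∃ q, conjCoeff U q p ≠ 0 := by
  refine exists_coeff_ne_zero fun h => tau_ne_zero p ?_
  have : Uᴴ * (U * tau p * Uᴴ) * U = tau p := by
    rw [← mul_assoc, ← mul_assoc, unitary_conjTranspose_mul hU, one_mul, mul_assoc,
      unitary_conjTranspose_mul hU, mul_one]
  rw [← this, h, mul_zero, zero_mul]

end ConjCoeff

section Transversal

variable {n r : ℕ}

lemma transversalGate_mul (U V : Fin n → QOp (Fin r)) :
    transversalGate U * transversalGate V = transversalGate fun j => U j * V j := by
  have := Matrix.submatrix_mul_equiv (piTensor U) (piTensor V)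
    (Equiv.piComm fun (_ : Fin r) (_ : Fin n) => Fin 2)
    (Equiv.piComm fun (_ : Fin r) (_ : Fin n) => Fin 2)
    (Equiv.piComm fun (_ : Fin r) (_ : Fin n) => Fin 2)
  rw [piTensor_mul] at this
  exact this

lemma transversalGate_conjTranspose (U : Fin n → QOp (Fin r)) :
    (transversalGate U)ᴴ = transversalGate fun j => (U j)ᴴ := by
  rw [transversalGate, Matrix.conjTranspose_submatrix, piTensor_conjTranspose]
  rfl

lemma transversalGate_one : transversalGate (fun _ : Fin n => (1 : QOp (Fin r))) = 1 := by
  rw [transversalGate, piTensor_one]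
  exact Matrix.submatrix_one_equiv (Equiv.piComm fun (_ : Fin r) (_ : Fin n) => Fin 2)

/-- The Pauli string on `r` blocks of `n` qubits with label `m i` on block `i`. -/
noncomputable def blockTau (m : Fin r → Fin n → Label) :
    Matrix (Fin r → Fin n → Fin 2) (Fin r → Fin n → Fin 2) ℂ :=
  piTensor fun i => tau (m i)

lemma transversalGate_tau (m : Fin r → Fin n → Label) :
    transversalGate (fun j => tau fun i => m i j) = blockTau m := by
  ext x y
  simp only [transversalGate, blockTau, tau, piTensor_apply, Matrix.submatrix_apply]
  exact Finset.prod_comm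

lemma trace_blockTau_mul (h m : Fin r → Fin n → Label) :
    (blockTau h * blockTau m).trace = if h = m then ((2 : ℂ) ^ n) ^ r else 0 := by
  rw [blockTau, blockTau, piTensor_mul, trace_piTensor]
  simp only [trace_tau_mul_tau]
  rw [Finset.prod_ite_zero]
  simp [funext_iff]

lemma eq_of_sum_smul_blockTau_eq {a b : (Fin r → Fin n → Label) → ℂ}
    (h : ∑ m, a m • blockTau m = ∑ m, b m • blockTau m) : a = b := by
  funext w
  have key : ∀ c : (Fin r → Fin n → Label) → ℂ,
      (blockTau w * ∑ m, c m • blockTau m).trace = c w * ((2 : ℂ) ^ n) ^ r := fun c => by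
    simp [Matrix.mul_sum, Matrix.trace_sum, trace_blockTau_mul]
  have h1 := key a
  rw [h, key b] at h1
  have h2 : ((2 : ℂ) ^ n) ^ r ≠ 0 := pow_ne_zero _ (pow_ne_zero _ two_ne_zero)
  exact (mul_right_cancel₀ h2 h1).symm

/-- In the Pauli basis, conjugation by a transversal gate is a product over the physical qubits. -/
lemma transversal_conj_blockTau (U : Fin n → QOp (Fin r)) (m : Fin r → Fin n → Label) :
    transversalGate U * blockTau m * (transversalGate U)ᴴ =
      ∑ w : Fin r → Fin n → Label,
        (∏ j, conjCoeff (U j) (fun i => w i j) fun i => m i j) • blockTau w := by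
  rw [← transversalGate_tau, transversalGate_conjTranspose, transversalGate_mul,
    transversalGate_mul]
  simp only [← sum_conjCoeff, transversalGate]
  rw [piTensor_sum]
  simp only [piTensor_smul]
  rw [← (Equiv.piComm fun (_ : Fin r) (_ : Fin n) => Label).sum_comp]
  ext x y
  simp only [Matrix.submatrix_apply, Matrix.sum_apply, Matrix.smul_apply]
  refine Finset.sum_congr rfl fun w _ => ?_
  rw [← transversalGate_tau]
  rfl

lemma blockProjector_eq_sum (P : QOp (Fin n)) :
    (piTensor fun _ : Fin r => P) =
      ∑ m : Fin r → Fin n → Label, (∏ i, coeff (m i) P) • blockTau m := by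
  conv_lhs => enter [1]; ext i; rw [← sum_coeff_smul_tau P]
  rw [piTensor_sum]
  simp only [piTensor_smul, blockTau]

lemma transversal_conj_blockProjector (U : Fin n → QOp (Fin r)) (P : QOp (Fin n)) :
    transversalGate U * (piTensor fun _ : Fin r => P) * (transversalGate U)ᴴ =
      ∑ w : Fin r → Fin n → Label, (∑ m : Fin r → Fin n → Label, (∏ i, coeff (m i) P) *
        ∏ j, conjCoeff (U j) (fun i => w i j) fun i => m i j) • blockTau w := by
  rw [blockProjector_eq_sum, Matrix.mul_sum, Matrix.sum_mul]
  simp only [Matrix.mul_smul, Matrix.smul_mul, transversal_conj_blockTau, Finset.smul_sum,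
    smul_smul, Finset.sum_smul]
  rw [Finset.sum_comm]

variable {S : Subgroup (unitaryGroup (Fin n → Fin 2) ℂ)}

lemma transversalGate_mul_conjTranspose {U : Fin n → QOp (Fin r)}
    (hU : ∀ j, U j ∈ unitaryGroup (Fin r → Fin 2) ℂ) :
    transversalGate U * (transversalGate U)ᴴ = 1 := by
  rw [transversalGate_conjTranspose, transversalGate_mul]
  simp only [unitary_mul_conjTranspose (hU _), transversalGate_one]

lemma transversal_conj_eq {U : Fin n → QOp (Fin r)} (hU : IsTransversal S U) :
    transversalGate U * (piTensor fun _ : Fin r => codeProjector S) * (transversalGate U)ᴴ =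
      piTensor fun _ : Fin r => codeProjector S := by
  rw [hU.2.eq, mul_assoc, transversalGate_mul_conjTranspose hU.1, mul_one]

/-- Moving the factors of a transversal gate outside `B` to the other side of the invariance of the
code projector, and comparing the coefficients of the Pauli string `h`, which agrees off `B` with
the string `g` of stabilizer elements: on one side only `g` contributes, on the other nothing. -/
lemma prod_conjCoeff_eq_zero (hS : IsStabilizer S) {U : Fin n → QOp (Fin r)}
    (hU : IsTransversal S U) {A : Fin n → Prop} {B : Finset (Fin n)} (hBA : ∀ j ∈ B, A j)
    {g h : Fin r → Fin n → Label} (hg : ∀ i, g i ∈ stabLabels S) (hgA : ∀ i j, ¬ A j → g i j = 0)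
    (hh : ∀ i, ∀ j ∉ B, h i j = g i j)
    (hB : ∀ s ∈ stabLabels S, (∀ j ∉ B, s j = 0) → s = 0)
    (hhB : ∀ m : Fin r → Fin n → Label, (∀ i, m i ∈ stabLabels S) →
      (∀ i j, ¬ A j → m i j = 0) → ∃ j ∈ B, ∃ i, m i j ≠ h i j) :
    ∏ j ∈ B, conjCoeff (U j) (fun i => h i j) (fun i => g i j) = 0 := by
  set D : Fin n → QOp (Fin r) := fun j => if j ∈ B then U j else 1 with hD
  set D' : Fin n → QOp (Fin r) := fun j => if j ∈ B then 1 else (U j)ᴴ with hD'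
  have hDD : transversalGate D = transversalGate D' * transversalGate U := by
    rw [transversalGate_mul]
    congr 1
    funext j
    by_cases hj : j ∈ B <;> simp [hD, hD', hj, unitary_conjTranspose_mul (hU.1 j)]
  have hconj : transversalGate D * (piTensor fun _ : Fin r => codeProjector S) *
      (transversalGate D)ᴴ = transversalGate D' * (piTensor fun _ : Fin r => codeProjector S) *
      (transversalGate D')ᴴ := by
    conv_rhs => rw [← transversal_conj_eq hU]
    rw [hDD, Matrix.conjTranspose_mul]
    simp only [mul_assoc]
  rw [transversal_conj_blockProjector, transversal_conj_blockProjector] at hconj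
  have heq := congrFun (eq_of_sum_smul_blockTau_eq hconj) h
  have hrows : ∀ m : Fin r → Fin n → Label, ∏ i, coeff (m i) (codeProjector S) ≠ 0 →
      ∀ i, m i ∈ stabLabels S := fun m hm i =>
    (coeff_codeProjector_ne_zero_iff hS _).1 (Finset.prod_ne_zero_iff.1 hm i (Finset.mem_univ i))
  have hD'U : ∀ j, D' j ∈ unitaryGroup (Fin r → Fin 2) ℂ := fun j => by
    by_cases hj : j ∈ B
    · simp only [hD', hj, if_true]; exact one_mem _
    · simp only [hD', hj, if_false]; exact Unitary.star_mem (hU.1 j)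
  -- On the right side a contributing string of stabilizer elements would extend `h` on `B`.
  have hright : ∑ m : Fin r → Fin n → Label, (∏ i, coeff (m i) (codeProjector S)) *
      ∏ j, conjCoeff (D' j) (fun i => h i j) (fun i => m i j) = 0 := by
    refine Finset.sum_eq_zero fun m _ => ?_
    by_contra hne
    have h1 := hrows m (left_ne_zero_of_mul hne)
    have h2 := fun j => Finset.prod_ne_zero_iff.1 (right_ne_zero_of_mul hne) j (Finset.mem_univ j)
    obtain ⟨j, hj, i, hij⟩ := hhB m h1 fun i j hj => by
      have hjB : j ∉ B := fun hb => hj (hBA j hb)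
      have h3 := h2 j
      have h4 : (fun i => h i j) = 0 := by
        funext i
        rw [hh i j hjB, hgA i j hj]; rfl
      rw [h4, conjCoeff_zero_left (hD'U j)] at h3
      have h5 : (fun i => m i j) = 0 := by
        by_contra hc
        exact h3 (if_neg hc)
      exact congrFun h5 i
    have h3 := h2 j
    simp only [hD', hj, if_true, conjCoeff_one] at h3
    refine hij ?_
    have h5 : (fun i => h i j) = fun i => m i j := by
      by_contra hc
      exact h3 (if_neg hc)
    exact (congrFun h5 i).symm
  have hleft : ∑ m : Fin r → Fin n → Label, (∏ i, coeff (m i) (codeProjector S)) *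
      ∏ j, conjCoeff (D j) (fun i => h i j) (fun i => m i j) =
      (∏ i, coeff (g i) (codeProjector S)) *
      ∏ j, conjCoeff (D j) (fun i => h i j) (fun i => g i j) := by
    refine Finset.sum_eq_single g (fun m _ hmg => ?_) (by simp)
    by_contra hne
    have h1 := hrows m (left_ne_zero_of_mul hne)
    have h2 := fun j => Finset.prod_ne_zero_iff.1 (right_ne_zero_of_mul hne) j (Finset.mem_univ j)
    refine hmg (funext fun i => sub_eq_zero.1
      (hB (m i - g i) (Submodule.sub_mem _ (h1 i) (hg i)) fun j hj => ?_))
    have h3 := h2 j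
    simp only [hD, hj, if_false, conjCoeff_one] at h3
    have h5 : (fun i => h i j) = fun i => m i j := by
      by_contra hc
      exact h3 (if_neg hc)
    rw [Pi.sub_apply, ← congrFun h5 i, hh i j hj, sub_self]
  rw [hleft, hright] at heq
  have h6 := (mul_eq_zero.1 heq).resolve_left (Finset.prod_ne_zero_iff.2 fun i _ =>
    (coeff_codeProjector_ne_zero_iff hS _).2 (hg i))
  rw [← h6, ← Finset.prod_subset (Finset.subset_univ B)]
  · exact Finset.prod_congr rfl fun j hj => by simp [hD, hj]
  · intro j _ hj
    simp only [hD, hj, if_false, conjCoeff_one]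
    exact if_pos (funext fun i => hh i j hj)

end Transversal

/-! ### Classification of the physical qubits -/

section Classification

variable {n : ℕ} {S : Subgroup (unitaryGroup (Fin n → Fin 2) ℂ)}

/-- The label `v` vanishes off the set `A` of qubits. -/
def SupportedIn (A : Finset (Fin n)) (v : Fin n → Label) : Prop := ∀ j ∉ A, v j = 0

lemma SupportedIn.add {A : Finset (Fin n)} {u v : Fin n → Label} (hu : SupportedIn A u)
    (hv : SupportedIn A v) : SupportedIn A (u + v) := fun j hj => by
  rw [Pi.add_apply, hu j hj, hv j hj, add_zero]

/-- The stabilizer elements supported in `A` form a maximal commuting set of Pauli strings on `A`: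
they stabilize a pure state of the qubits in `A`, which is a tensor factor of every code state. -/
def IsPure (S : Subgroup (unitaryGroup (Fin n → Fin 2) ℂ)) (A : Finset (Fin n)) : Prop :=
  ∀ t, SupportedIn A t → (∀ s ∈ stabLabels S, SupportedIn A s → symp t s = 0) → t ∈ stabLabels S

lemma isPure_empty : IsPure S ∅ := fun t ht _ => by
  have : t = 0 := funext fun j => ht j (by simp)
  rw [this]; exact Submodule.zero_mem _

/-- Given a string `t` on `A ∪ B`, its restriction to `A` is a stabilizer label, and so is the
remainder, which is supported in `B`. -/
lemma IsPure.union (hS : IsStabilizer S) {A B : Finset (Fin n)} (hA : IsPure S A)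
    (hB : IsPure S B) : IsPure S (A ∪ B) := by
  intro t ht hts
  set tA : Fin n → Label := fun j => if j ∈ A then t j else 0 with htA
  have h1 : tA ∈ stabLabels S := by
    refine hA tA (fun j hj => by simp [htA, hj]) fun s hs hsA => ?_
    rw [← hts s hs fun j hj => hsA j fun h => hj (Finset.mem_union_left _ h)]
    refine Finset.sum_congr rfl fun j _ => ?_
    by_cases hj : j ∈ A
    · simp [htA, hj]
    · simp [hsA j hj]
  have h2 : t - tA ∈ stabLabels S := by
    refine hB _ (fun j hj => ?_) fun s hs hsB => ?_
    · by_cases hjA : j ∈ A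
      · simp [htA, hjA]
      · simp [htA, hjA, ht j (by simp [hjA, hj])]
    · rw [label_sub, symp_add_left, stabLabels_isotropic hS h1 hs,
        hts s hs fun j hj => hsB j fun h => hj (Finset.mem_union_right _ h), add_zero]
  have := Submodule.add_mem _ h2 h1
  rwa [sub_add_cancel] at this

lemma exists_stabLabel_ne_zero (hfree : FreeOfTriviallyEncodedQubits S) (j : Fin n) :
    ∃ v ∈ stabLabels S, v j ≠ 0 := by
  obtain ⟨g, hg, c, -, p, hgp, hpj⟩ := hfree j
  choose v hv using fun i => labelCode_surjective (p i)
  refine ⟨v, ⟨g, hg, c, ?_⟩, fun h => hpj ?_⟩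
  · rw [hgp]
    simp [tau, pauliString, sigma, hv]
  · rw [← hv j, (labelCode_eq_zero _).2 h]

/-- A stabilizer element of least weight among those acting on `j`. -/
lemma exists_minimal_support (hfree : FreeOfTriviallyEncodedQubits S) (j : Fin n) :
    ∃ v ∈ stabLabels S, v j ≠ 0 ∧ ∃ A : Finset (Fin n), j ∈ A ∧ SupportedIn A v ∧
      ∀ s ∈ stabLabels S, SupportedIn A s → s j ≠ 0 → ∀ i ∈ A, s i ≠ 0 := by
  classical
  obtain ⟨v₀, hv₀, hj₀⟩ := exists_stabLabel_ne_zero hfree j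
  obtain ⟨v, hv, hmin⟩ := Finset.exists_min_image
    (Finset.univ.filter fun v : Fin n → Label => v ∈ stabLabels S ∧ v j ≠ 0)
    (fun v => (Finset.univ.filter fun i => v i ≠ 0).card) ⟨v₀, by simp [hv₀, hj₀]⟩
  simp only [Finset.mem_filter, Finset.mem_univ, true_and] at hv hmin
  refine ⟨v, hv.1, hv.2, Finset.univ.filter fun i => v i ≠ 0, by simpa using hv.2,
    fun i hi => by simpa using hi, fun s hs hsA hsj i hi => ?_⟩
  have hsub : (Finset.univ.filter fun i => s i ≠ 0) ⊆ Finset.univ.filter fun i => v i ≠ 0 := by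
    intro i hi
    by_contra hc
    exact (Finset.mem_filter.1 hi).2 (hsA i hc)
  have heq := Finset.eq_of_subset_of_card_le hsub (hmin s ⟨hs, hsj⟩)
  rw [← heq] at hi
  exact (Finset.mem_filter.1 hi).2

lemma label_span_pair (a b x : Label) (ha : a ≠ 0) (hb : b ≠ 0) (hab : a ≠ b) :
    x = 0 ∨ x = a ∨ x = b ∨ x = a + b := by
  have : ∀ a b x : Label, a ≠ 0 ∧ b ≠ 0 ∧ a ≠ b → x ∈ ({0, a, b, a + b} : Finset Label) := by
    decide
  simpa using this a b x ⟨ha, hb, hab⟩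

/-- Three nonzero labels `a, b, a + b` cannot all remain nonzero after adding a nonzero `m`. -/
lemma label_four_ne (a b m : Label) (ha : a ≠ 0) (hb : b ≠ 0) (hab : a + b ≠ 0) (hm : m ≠ 0)
    (ham : a + m ≠ 0) (hbm : b + m ≠ 0) (h : a + b + m ≠ 0) : False := by
  rw [← label_sub, sub_ne_zero] at hab ham hbm h
  have := label_span_pair a b m ha hb hab
  tauto

lemma label_eq_zero_of_symp : ∀ a b x : Label, a ≠ 0 → b ≠ 0 → a ≠ b → symp₁ x a = 0 →
    symp₁ x b = 0 → x = 0 := by decide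

lemma label_eq_of_symp : ∀ a x : Label, a ≠ 0 → symp₁ x a = 0 → x = 0 ∨ x = a := by decide

/-- Every transversal gate maps the Pauli strings with labels in `{0, z}` on the blocks at qubit `j`
to combinations of such strings. -/
def PreservesAxis (S : Subgroup (unitaryGroup (Fin n → Fin 2) ℂ)) (j : Fin n) (z : Label) : Prop :=
  ∀ (r : ℕ) (U : Fin n → QOp (Fin r)), IsTransversal S U → ∀ p q : Fin r → Label,
    (∀ i, p i = 0 ∨ p i = z) → conjCoeff (U j) q p ≠ 0 → ∀ i, q i = 0 ∨ q i = z

/-- Every transversal gate maps Pauli strings on the blocks at qubit `j` to multiples of Pauli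
strings. -/
def PermutesPaulis (S : Subgroup (unitaryGroup (Fin n → Fin 2) ℂ)) (j : Fin n) : Prop :=
  ∀ (r : ℕ) (U : Fin n → QOp (Fin r)), IsTransversal S U → ∀ p q q' : Fin r → Label,
    conjCoeff (U j) q p ≠ 0 → conjCoeff (U j) q' p ≠ 0 → q = q'

lemma symp_eq_of_supportedIn_singleton {j : Fin n} {u v : Fin n → Label}
    (hu : ∀ i, i ≠ j → u i = 0) : symp u v = symp₁ (u j) (v j) := by
  rw [symp, Finset.sum_eq_single j] <;> simp +contextual [hu]

/-- If only one nontrivial Pauli occurs at `j` in the stabilizer elements supported in a minimal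
`A ∋ j`, then that Pauli axis is preserved, unless the qubit `j` is in a pure state. -/
lemma preservesAxis_or_isPure (hS : IsStabilizer S) {j : Fin n} {v : Fin n → Label}
    {A : Finset (Fin n)} (hv : v ∈ stabLabels S) (hvj : v j ≠ 0) (hjA : j ∈ A)
    (hvA : SupportedIn A v)
    (hmin : ∀ s ∈ stabLabels S, SupportedIn A s → s j ≠ 0 → ∀ i ∈ A, s i ≠ 0)
    (hI : ∀ s ∈ stabLabels S, SupportedIn A s → s j = 0 ∨ s j = v j) :
    IsPure S A ∨ PreservesAxis S j (v j) := by
  by_cases hA : ∀ i ∈ A, i = j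
  · left
    intro t ht hts
    have htj : ∀ i, i ≠ j → t i = 0 := fun i hi => ht i fun h => hi (hA i h)
    have hvj' : ∀ i, i ≠ j → v i = 0 := fun i hi => hvA i fun h => hi (hA i h)
    have h1 := hts v hv hvA
    rw [symp_eq_of_supportedIn_singleton htj] at h1
    rcases label_eq_of_symp _ _ hvj h1 with h | h
    · have : t = 0 := funext fun i => by
        by_cases hi : i = j
        · rw [hi, h]; rfl
        · exact htj i hi
      rw [this]; exact Submodule.zero_mem _
    · have : t = v := funext fun i => by
        by_cases hi : i = j
        · rw [hi, h]
        · rw [htj i hi, hvj' i hi]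
      rwa [this]
  · right
    push Not at hA
    obtain ⟨i₀, hi₀, hne⟩ := hA
    intro r U hU p q hp hq
    by_contra! hcon
    obtain ⟨a, ha0, haz⟩ := hcon
    set g : Fin r → Fin n → Label := fun i => if p i = 0 then 0 else v with hg
    have hgj : ∀ i, g i j = p i := fun i => by
      simp only [hg]
      split_ifs with h
      · rw [h]; rfl
      · exact ((hp i).resolve_left h).symm
    have hgS : ∀ i, g i ∈ stabLabels S := fun i => by
      simp only [hg]; split_ifs
      · exact Submodule.zero_mem _
      · exact hv
    have hgA : ∀ i, SupportedIn A (g i) := fun i k hk => by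
      simp only [hg]; split_ifs
      · rfl
      · exact hvA k hk
    have := prod_conjCoeff_eq_zero hS hU (A := fun k => k ∈ A) (B := {j})
      (h := fun i => Function.update (g i) j (q i)) (g := g)
      (by simpa using hjA) hgS (fun i k hk => hgA i k hk)
      (fun i k hk => Function.update_of_ne (by simpa using hk) _ _)
      (fun s hs hsj => ?_) (fun m hm hmA => ⟨j, by simp, a, ?_⟩)
    · simp only [Finset.prod_singleton, Function.update_self, hgj] at this
      exact hq this
    · by_contra hs0
      have hsj' : s j ≠ 0 := fun h => hs0 (funext fun k => by
        by_cases hk : k = j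
        · rw [hk, h]; rfl
        · exact hsj k (by simpa using hk))
      exact hmin s hs (fun k hk => hsj k (by rintro hk'; rw [Finset.mem_singleton] at hk'
                                             exact hk (hk' ▸ hjA))) hsj' i₀ hi₀
        (hsj i₀ (by simpa using hne))
    · rw [Function.update_self]
      intro h
      rcases hI (m a) (hm a) (fun k hk => hmA a k hk) with h' | h' <;> rw [h] at h'
      · exact ha0 h'
      · exact haz h'

/-- If two nontrivial Paulis occur at `j` in the stabilizer elements supported in a minimal
`A ∋ j`, then these elements form a code that restricts at each qubit of `A` to all Paulis. For
two qubits this is a Bell pair; for more, a transversal gate must permute the Pauli strings at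
`j`. -/
lemma permutesPaulis_or_isPure (hS : IsStabilizer S) {j : Fin n} {v w : Fin n → Label}
    {A : Finset (Fin n)} (hv : v ∈ stabLabels S) (hvj : v j ≠ 0) (hjA : j ∈ A)
    (hvA : SupportedIn A v)
    (hmin : ∀ s ∈ stabLabels S, SupportedIn A s → s j ≠ 0 → ∀ i ∈ A, s i ≠ 0)
    (hw : w ∈ stabLabels S) (hwA : SupportedIn A w) (hwj : w j ≠ 0) (hwv : w j ≠ v j) :
    IsPure S A ∨ PermutesPaulis S j := by
  have hvw : v + w ∈ stabLabels S := Submodule.add_mem _ hv hw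
  have hvwj : (v + w) j ≠ 0 := by
    rw [Pi.add_apply, ← label_sub, sub_ne_zero]
    exact hwv.symm
  -- An element vanishing at `j` but not at `i` could be added to reduce some weight.
  have hfull : ∀ s ∈ stabLabels S, SupportedIn A s → s ≠ 0 → ∀ i ∈ A, s i ≠ 0 := by
    intro s hs hsA hs0
    by_cases hsj : s j = 0
    · exfalso
      obtain ⟨i, hi⟩ := Function.ne_iff.1 hs0
      have hiA : i ∈ A := by by_contra h; exact hi (hsA i h)
      have key : ∀ u ∈ stabLabels S, SupportedIn A u → u j ≠ 0 → u i ≠ 0 ∧ u i + s i ≠ 0 :=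
        fun u hu huA huj => ⟨hmin u hu huA huj i hiA,
          hmin (u + s) (Submodule.add_mem _ hu hs) (huA.add hsA)
            (by rwa [Pi.add_apply, hsj, add_zero]) i hiA⟩
      obtain ⟨a1, a2⟩ := key v hv hvA hvj
      obtain ⟨b1, b2⟩ := key w hw hwA hwj
      obtain ⟨c1, c2⟩ := key (v + w) hvw (hvA.add hwA) hvwj
      exact label_four_ne _ _ _ a1 b1 c1 hi a2 b2 c2
    · exact hmin s hs hsA hsj
  have hval : ∀ x : Label, ∃ s ∈ stabLabels S, SupportedIn A s ∧ s j = x := by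
    intro x
    rcases label_span_pair (v j) (w j) x hvj hwj hwv.symm with rfl | rfl | rfl | rfl
    · exact ⟨0, Submodule.zero_mem _, fun _ _ => rfl, rfl⟩
    · exact ⟨v, hv, hvA, rfl⟩
    · exact ⟨w, hw, hwA, rfl⟩
    · exact ⟨v + w, hvw, hvA.add hwA, rfl⟩
  have hinj : ∀ s ∈ stabLabels S, SupportedIn A s → ∀ t ∈ stabLabels S, SupportedIn A t →
      ∀ i ∈ A, s i = t i → s = t := by
    intro s hs hsA t ht htA i hi hst
    by_contra hne
    refine hfull (s + t) (Submodule.add_mem _ hs ht) (hsA.add htA) ?_ i hi ?_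
    · rwa [← label_sub, sub_ne_zero]
    · rw [Pi.add_apply, hst, label_add_self]
  by_cases hcard : ∃ i ∈ A, i ≠ j ∧ ∃ l ∈ A, l ≠ i ∧ l ≠ j
  · right
    obtain ⟨i, hiA, hij, l, hlA, hli, hlj⟩ := hcard
    intro r U hU p q q' hq hq'
    choose f hfS hfA hfj using hval
    have hzero : ∀ x : Fin r → Label, conjCoeff (U j) x p ≠ 0 → ∀ y : Fin r → Label,
        conjCoeff (U i) y (fun a => f (p a) i) ≠ 0 → y = fun a => f (x a) i := by
      intro x hx y hy
      by_contra hne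
      obtain ⟨a, ha⟩ := Function.ne_iff.1 hne
      have := prod_conjCoeff_eq_zero hS hU (A := fun k => k ∈ A) (B := {j, i})
        (h := fun a => Function.update (Function.update (f (p a)) i (y a)) j (x a))
        (g := fun a => f (p a))
        (fun k hk => by
          rcases Finset.mem_insert.1 hk with rfl | hk
          · exact hjA
          · rw [Finset.mem_singleton] at hk; rw [hk]; exact hiA)
        (fun a => hfS _) (fun a k hk => hfA _ k hk)
        (fun a k hk => by
          simp only [Finset.mem_insert, Finset.mem_singleton, not_or] at hk
          rw [Function.update_of_ne hk.1, Function.update_of_ne hk.2])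
        (fun s hs hsB => ?_) (fun m hm hmA => ?_)
      · rw [Finset.prod_pair hij.symm] at this
        simp only [Function.update_self, Function.update_of_ne hij, hfj] at this
        rcases mul_eq_zero.1 this with h | h
        · exact hx h
        · exact hy h
      · by_contra hs0
        refine hfull s hs (fun k hk => hsB k fun h => hk ?_) hs0 l hlA
          (hsB l (by simp [hli, hlj]))
        rcases Finset.mem_insert.1 h with rfl | h
        · exact hjA
        · rw [Finset.mem_singleton] at h; rw [h]; exact hiA
      · by_cases hmj : m a j = x a
        · refine ⟨i, by simp, a, ?_⟩
          rw [Function.update_of_ne hij, Function.update_self,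
            hinj (m a) (hm a) (fun k hk => hmA a k hk) (f (x a)) (hfS _) (hfA _) j hjA
              (by rw [hmj, hfj])]
          exact ha.symm
        · exact ⟨j, by simp, a, by rwa [Function.update_self]⟩
    obtain ⟨y, hy⟩ := exists_conjCoeff_ne_zero (hU.1 i) (fun a => f (p a) i)
    have h1 := hzero q hq y hy
    have h2 := hzero q' hq' y hy
    funext a
    have h3 : f (q a) i = f (q' a) i := congrFun (h1.symm.trans h2) a
    rw [← hfj (q a), ← hfj (q' a), hinj _ (hfS _) (hfA _) _ (hfS _) (hfA _) i hiA h3]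
  · left
    push Not at hcard
    intro t ht hts
    obtain ⟨s, hs, hsA, hsj⟩ := hval (t j)
    have hu : SupportedIn A (t + s) := ht.add hsA
    have huj : (t + s) j = 0 := by rw [Pi.add_apply, hsj, label_add_self]
    have huc : ∀ x ∈ stabLabels S, SupportedIn A x → symp (t + s) x = 0 := fun x hx hxA => by
      rw [symp_add_left, hts x hx hxA, stabLabels_isotropic hS hs hx, add_zero]
    suffices h : t + s = 0 by
      rw [← label_sub, sub_eq_zero] at h
      rwa [h]
    funext i
    by_cases hi : i ∈ A ∧ i ≠ j
    · have honly : ∀ k, k ≠ i → (t + s) k = 0 := fun k hk => by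
        by_cases hkA : k ∈ A
        · rw [hcard i hi.1 hi.2 k hkA hk, huj]
        · exact hu k hkA
      have e1 := huc v hv hvA
      have e2 := huc w hw hwA
      rw [symp_eq_of_supportedIn_singleton honly] at e1 e2
      refine label_eq_zero_of_symp (v i) (w i) _ (hfull v hv hvA ?_ i hi.1)
        (hfull w hw hwA ?_ i hi.1) ?_ e1 e2
      · exact fun h => hvj (by rw [h]; rfl)
      · exact fun h => hwj (by rw [h]; rfl)
      · intro h
        exact hwv (congrFun (hinj w hw hwA v hv hvA i hi.1 h.symm) j)
    · by_cases hij : i = j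
      · rw [hij, huj]; rfl
      · exact hu i fun h => hi ⟨h, hij⟩

/-- Each physical qubit lies in a set of qubits in a pure state, has an axis preserved by all
transversal gates, or admits only gates that map Pauli strings to multiples of Pauli strings. -/
lemma qubit_trichotomy (hS : IsStabilizer S) (hfree : FreeOfTriviallyEncodedQubits S) (j : Fin n) :
    (∃ A, IsPure S A ∧ j ∈ A) ∨ (∃ z ≠ 0, PreservesAxis S j z) ∨ PermutesPaulis S j := by
  obtain ⟨v, hv, hvj, A, hjA, hvA, hmin⟩ := exists_minimal_support hfree j
  by_cases hI : ∀ s ∈ stabLabels S, SupportedIn A s → s j = 0 ∨ s j = v j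
  · rcases preservesAxis_or_isPure hS hv hvj hjA hvA hmin hI with h | h
    · exact Or.inl ⟨A, h, hjA⟩
    · exact Or.inr (Or.inl ⟨v j, hvj, h⟩)
  · push Not at hI
    obtain ⟨w, hw, hwA, hwj, hwv⟩ := hI
    rcases permutesPaulis_or_isPure hS hv hvj hjA hvA hmin hw hwA hwj hwv with h | h
    · exact Or.inl ⟨A, h, hjA⟩
    · exact Or.inr (Or.inr h)

end Classification

/-! ### Pauli frames -/

section Frame

variable {n : ℕ} {S : Subgroup (unitaryGroup (Fin n → Fin 2) ℂ)}

/-- The classification of the physical qubits, assembled. Here `T` is a set of qubits in a pure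
state, carrying no logical information. Elsewhere `small j ≤ big j` are spaces of Pauli labels at
the qubit `j`: either both consist of the multiples of one preserved axis, or, where every
transversal gate is Clifford, `small j` is zero and `big j` is everything. -/
structure PauliFrame (S : Subgroup (unitaryGroup (Fin n → Fin 2) ℂ)) where
  T : Finset (Fin n)
  pure : IsPure S T
  big : Fin n → Submodule (ZMod 2) Label
  small : Fin n → Submodule (ZMod 2) Label
  big_eq_bot : ∀ j ∈ T, big j = ⊥
  small_le : ∀ j, small j ≤ big j
  dual : ∀ j ∉ T, ∀ x, (∀ d ∈ big j, symp₁ x d = 0) → x ∈ small j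
  isotropic : ∀ j, ∀ x ∈ small j, ∀ y ∈ small j, symp₁ x y = 0
  map_small : ∀ (r : ℕ) (U : Fin n → QOp (Fin r)), IsTransversal S U → ∀ j p q,
    (∀ i, p i ∈ small j) → conjCoeff (U j) q p ≠ 0 → ∀ i, q i ∈ small j
  map_big : ∀ (r : ℕ) (U : Fin n → QOp (Fin r)), IsTransversal S U → ∀ j p q q',
    (∀ i, p i ∈ big j) → conjCoeff (U j) q p ≠ 0 → conjCoeff (U j) q' p ≠ 0 →
      ∀ i, q i - q' i ∈ small j
  big_eq_small : ∀ (r : ℕ) (U : Fin n → QOp (Fin r)), IsTransversal S U → ∀ j,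
    ¬ IsClifford (U j) → big j = small j

lemma exists_isPure_maximal (hS : IsStabilizer S) :
    ∃ T : Finset (Fin n), IsPure S T ∧ ∀ A, IsPure S A → A ⊆ T := by
  classical
  refine ⟨(Finset.univ.filter fun A : Finset (Fin n) => IsPure S A).sup id, ?_, fun A hA => ?_⟩
  · refine Finset.sup_induction (p := IsPure S) isPure_empty (fun A hA B hB => hA.union hS hB) ?_
    intro A hA
    exact (Finset.mem_filter.1 hA).2
  · exact Finset.le_sup (f := id) (Finset.mem_filter.2 ⟨Finset.mem_univ _, hA⟩)

/-- A unitary that maps every Pauli string to a multiple of a Pauli string is Clifford: the multiple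
is a sign because Pauli strings are involutions. -/
lemma isClifford_of_conjCoeff {ι : Type} [Fintype ι] [DecidableEq ι] {U : QOp ι}
    (hU : U ∈ unitaryGroup (ι → Fin 2) ℂ)
    (h : ∀ p q q', conjCoeff U q p ≠ 0 → conjCoeff U q' p ≠ 0 → q = q') : IsClifford U := by
  refine ⟨hU, fun P hP => ?_⟩
  obtain ⟨c, hc, p, rfl⟩ := mem_pauliGroup_iff.1 hP
  obtain ⟨q, hq⟩ := exists_conjCoeff_ne_zero hU p
  have h1 : U * tau p * Uᴴ = conjCoeff U q p • tau q := by
    rw [← sum_conjCoeff]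
    refine Finset.sum_eq_single q (fun q' _ hne => ?_) (by simp)
    rw [show conjCoeff U q' p = 0 by by_contra h0; exact hne (h p q' q h0 hq), zero_smul]
  have h2 : (U * tau p * Uᴴ) * (U * tau p * Uᴴ) = 1 := by
    calc (U * tau p * Uᴴ) * (U * tau p * Uᴴ) = U * tau p * (Uᴴ * U) * tau p * Uᴴ := by
          simp only [mul_assoc]
      _ = 1 := by
          rw [unitary_conjTranspose_mul hU, mul_one, mul_assoc U, tau_mul_self, mul_one,
            unitary_mul_conjTranspose hU]
  have h3 : conjCoeff U q p * conjCoeff U q p = 1 := by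
    rw [h1, smul_mul_smul_comm, tau_mul_self, ← tau_zero] at h2
    have := congrArg (coeff 0) h2
    rwa [coeff_smul, coeff_tau, if_pos rfl, mul_one] at this
  refine mem_pauliGroup_iff.2 ⟨c * conjCoeff U q p, ?_, q, ?_⟩
  · rw [mul_pow, hc, one_mul, show 4 = 2 * 2 by norm_num, pow_mul, sq, sq, h3, one_mul]
  · rw [Matrix.mul_smul, Matrix.smul_mul, h1, smul_smul]

lemma mem_span_label_iff {z x : Label} : x ∈ Submodule.span (ZMod 2) {z} ↔ x = 0 ∨ x = z := by
  rw [Submodule.mem_span_singleton]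
  constructor
  · rintro ⟨a, rfl⟩
    rcases zmod2_cases a with rfl | rfl <;> simp
  · rintro (rfl | rfl)
    · exact ⟨0, by simp⟩
    · exact ⟨1, by simp⟩

lemma eq_zero_of_forall_symp₁ : ∀ x : Label, (∀ d, symp₁ x d = 0) → x = 0 := by decide

/-- On the largest set `T` of qubits in a pure state both spaces are taken to be zero; elsewhere the
other two cases of the trichotomy provide them. -/
theorem exists_pauliFrame (hS : IsStabilizer S) (hfree : FreeOfTriviallyEncodedQubits S) :
    Nonempty (PauliFrame S) := by
  obtain ⟨T, hT, hTmax⟩ := exists_isPure_maximal hS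
  have hzero : ∀ (r : ℕ) (U : Fin n → QOp (Fin r)), IsTransversal S U → ∀ j (p q : Fin r → Label),
      (∀ i, p i ∈ (⊥ : Submodule (ZMod 2) Label)) → conjCoeff (U j) q p ≠ 0 →
      ∀ i, q i ∈ (⊥ : Submodule (ZMod 2) Label) := by
    intro r U hU j p q hp hq i
    have hp0 : p = 0 := funext fun i => (Submodule.mem_bot _).1 (hp i)
    rw [hp0, conjCoeff_zero_right (hU.1 j)] at hq
    have hq0 : q = 0 := by
      by_contra h
      exact hq (if_neg h)
    rw [hq0]; exact Submodule.zero_mem _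
  have key : ∀ j, ∃ D D₀ : Submodule (ZMod 2) Label, (j ∈ T → D = ⊥) ∧ D₀ ≤ D ∧
      (j ∉ T → ∀ x, (∀ d ∈ D, symp₁ x d = 0) → x ∈ D₀) ∧
      (∀ x ∈ D₀, ∀ y ∈ D₀, symp₁ x y = 0) ∧
      (∀ (r : ℕ) (U : Fin n → QOp (Fin r)), IsTransversal S U → ∀ p q : Fin r → Label,
        (∀ i, p i ∈ D₀) → conjCoeff (U j) q p ≠ 0 → ∀ i, q i ∈ D₀) ∧
      (∀ (r : ℕ) (U : Fin n → QOp (Fin r)), IsTransversal S U → ∀ p q q' : Fin r → Label,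
        (∀ i, p i ∈ D) → conjCoeff (U j) q p ≠ 0 → conjCoeff (U j) q' p ≠ 0 →
          ∀ i, q i - q' i ∈ D₀) ∧
      (∀ (r : ℕ) (U : Fin n → QOp (Fin r)), IsTransversal S U → ¬ IsClifford (U j) → D = D₀) := by
    intro j
    by_cases hj : j ∈ T
    · refine ⟨⊥, ⊥, fun _ => rfl, le_rfl, fun h => absurd hj h, ?_, ?_, ?_, fun _ _ _ _ => rfl⟩
      · intro x hx y _
        rw [(Submodule.mem_bot _).1 hx, symp₁_zero_left]
      · exact fun r U hU => hzero r U hU j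
      · exact fun r U hU p q q' hp hq hq' i =>
          Submodule.sub_mem _ (hzero r U hU j p q hp hq i) (hzero r U hU j p q' hp hq' i)
    rcases qubit_trichotomy hS hfree j with ⟨A, hA, hjA⟩ | ⟨z, hz, hax⟩ | hperm
    · exact absurd (hTmax A hA hjA) hj
    · have hmap : ∀ (r : ℕ) (U : Fin n → QOp (Fin r)), IsTransversal S U → ∀ p q : Fin r → Label,
          (∀ i, p i ∈ Submodule.span (ZMod 2) {z}) → conjCoeff (U j) q p ≠ 0 →
          ∀ i, q i ∈ Submodule.span (ZMod 2) {z} := fun r U hU p q hp hq i =>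
        mem_span_label_iff.2 (hax r U hU p q (fun i => mem_span_label_iff.1 (hp i)) hq i)
      refine ⟨Submodule.span (ZMod 2) {z}, Submodule.span (ZMod 2) {z}, fun h => absurd h hj,
        le_rfl, ?_, ?_, hmap, ?_, fun _ _ _ _ => rfl⟩
      · intro _ x hx
        exact mem_span_label_iff.2
          (label_eq_of_symp z x hz (hx z (mem_span_label_iff.2 (Or.inr rfl))))
      · intro x hx y hy
        rcases mem_span_label_iff.1 hx with rfl | rfl
        · simp
        · rcases mem_span_label_iff.1 hy with rfl | rfl
          · simp
          · exact symp₁_self _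
      · exact fun r U hU p q q' hp hq hq' i =>
          Submodule.sub_mem _ (hmap r U hU p q hp hq i) (hmap r U hU p q' hp hq' i)
    · refine ⟨⊤, ⊥, fun h => absurd h hj, bot_le, ?_, ?_, ?_, ?_, ?_⟩
      · intro _ x hx
        exact eq_zero_of_forall_symp₁ x fun d => hx d trivial
      · intro x hx y _
        rw [(Submodule.mem_bot _).1 hx, symp₁_zero_left]
      · exact fun r U hU => hzero r U hU j
      · intro r U hU p q q' _ hq hq' i
        rw [hperm r U hU p q q' hq hq', sub_self]
        exact Submodule.zero_mem _
      · exact fun r U hU hnc => absurd (isClifford_of_conjCoeff (hU.1 j) (hperm r U hU)) hnc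
  choose D D₀ h1 h2 h3 h4 h5 h6 h7 using key
  exact ⟨⟨T, hT, D, D₀, h1, h2, h3, h4, fun r U hU j => h5 j r U hU,
    fun r U hU j => h6 j r U hU, fun r U hU j => h7 j r U hU⟩⟩

namespace PauliFrame

variable (F : PauliFrame S)

/-- The labels that lie in `big j` at every qubit `j`. -/
def bigLabels : Submodule (ZMod 2) (Fin n → Label) := Submodule.pi Set.univ F.big

/-- The labels that lie in `small j` at every qubit `j`. -/
def smallLabels : Submodule (ZMod 2) (Fin n → Label) := Submodule.pi Set.univ F.small

lemma mem_bigLabels {v : Fin n → Label} : v ∈ F.bigLabels ↔ ∀ j, v j ∈ F.big j := by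
  simp [bigLabels, Submodule.mem_pi]

lemma mem_smallLabels {v : Fin n → Label} : v ∈ F.smallLabels ↔ ∀ j, v j ∈ F.small j := by
  simp [smallLabels, Submodule.mem_pi]

lemma smallLabels_isotropic {u v : Fin n → Label} (hu : u ∈ F.smallLabels)
    (hv : v ∈ F.smallLabels) : symp u v = 0 :=
  Finset.sum_eq_zero fun j _ =>
    F.isotropic j _ (F.mem_smallLabels.1 hu j) _ (F.mem_smallLabels.1 hv j)

/-- Symplectic reduction: a label commuting with the stabilizer and with all labels of
`F.bigLabels` that commute with the stabilizer is the sum of a stabilizer label and a label of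
`F.smallLabels`. -/
lemma exists_add_of_mem_perp (hS : IsStabilizer S) {v : Fin n → Label}
    (hv : v ∈ perp (stabLabels S)) (hvF : v ∈ perp (F.bigLabels ⊓ perp (stabLabels S))) :
    ∃ s ∈ stabLabels S, ∃ g ∈ F.smallLabels ⊓ perp (stabLabels S), v = s + g := by
  have h1 : v ∈ perp F.bigLabels ⊔ stabLabels S := by
    refine mem_of_forall_mem_perp fun w hw => ?_
    rw [symp_comm]
    refine hvF w ⟨mem_of_forall_mem_perp fun x hx => ?_, fun s hs =>
      hw s (Submodule.mem_sup_right hs)⟩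
    rw [symp_comm]
    exact hw x (Submodule.mem_sup_left hx)
  obtain ⟨w, hw, s, hs, rfl⟩ := Submodule.mem_sup.1 h1
  have hws : w ∈ perp (stabLabels S) := by
    have hsp : s ∈ perp (stabLabels S) := fun x hx => stabLabels_isotropic hS hs hx
    simpa using Submodule.sub_mem _ hv hsp
  have hwj : ∀ j ∉ F.T, w j ∈ F.small j := fun j hj => F.dual j hj _ fun d hd => by
    rw [← symp_single_right]
    refine hw _ (F.mem_bigLabels.2 fun i => ?_)
    by_cases hi : i = j
    · subst hi; rwa [Pi.single_eq_same]
    · rw [Pi.single_eq_of_ne hi]; exact Submodule.zero_mem _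
  -- The part of `w` on the qubits in a pure state is a stabilizer label.
  set t : Fin n → Label := fun j => if j ∈ F.T then w j else 0 with ht
  have htS : t ∈ stabLabels S := by
    refine F.pure t (fun j hj => by simp [ht, hj]) fun x hx hxT => ?_
    rw [← hws x hx]
    refine Finset.sum_congr rfl fun j _ => ?_
    by_cases hj : j ∈ F.T
    · simp [ht, hj]
    · simp [hxT j hj]
  refine ⟨s + t, Submodule.add_mem _ hs htS, w - t, ⟨F.mem_smallLabels.2 fun j => ?_,
    Submodule.sub_mem _ hws fun x hx => stabLabels_isotropic hS htS hx⟩, by abel⟩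
  by_cases hj : j ∈ F.T
  · simp [ht, hj]
  · simpa [ht, hj] using hwj j hj

end PauliFrame

end Frame

/-! ### Logical Pauli labels -/

section Logical

variable {n k r : ℕ} {S : Subgroup (unitaryGroup (Fin n → Fin 2) ℂ)}
  {E : Matrix (Fin n → Fin 2) (Fin k → Fin 2) ℂ}

lemma codeProjector_mul_encoding (hE : IsLogicalEncoding S E) : codeProjector S * E = E := by
  rw [← hE.range, Matrix.mul_assoc, hE.isometry, Matrix.mul_one]

lemma encoding_cancel (hE : IsLogicalEncoding S E) {β : Type} {M N : Matrix (Fin k → Fin 2) β ℂ}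
    (h : E * M = E * N) : M = N := by
  have := congrArg (Eᴴ * ·) h
  simpa only [← Matrix.mul_assoc, hE.isometry, Matrix.one_mul] using this

lemma eq_zero_of_tau_mul_eq_zero {ι β : Type} [Fintype ι] [DecidableEq ι] {v : ι → Label}
    {M : Matrix (ι → Fin 2) β ℂ} (h : tau v * M = 0) : M = 0 := by
  rw [← Matrix.one_mul M, ← tau_mul_self v, Matrix.mul_assoc, h, Matrix.mul_zero]

lemma encoding_mul_tau_ne_zero (hE : IsLogicalEncoding S E) (u : Fin k → Label) :
    E * tau u ≠ 0 := fun h =>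
  tau_ne_zero u (encoding_cancel hE (by rw [h, Matrix.mul_zero]))

/-- The physical Pauli string with label `v` implements, up to a phase, the logical Pauli string
with label `u`. -/
def Represents (S : Subgroup (unitaryGroup (Fin n → Fin 2) ℂ))
    (E : Matrix (Fin n → Fin 2) (Fin k → Fin 2) ℂ) (u : Fin k → Label) (v : Fin n → Label) : Prop :=
  v ∈ perp (stabLabels S) ∧ ∃ c : ℂ, c ≠ 0 ∧ tau v * E = c • (E * tau u)

lemma Represents.zero : Represents S E 0 0 :=
  ⟨Submodule.zero_mem _, 1, one_ne_zero, by simp [tau_zero]⟩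

lemma Represents.add {u u' : Fin k → Label} {v v' : Fin n → Label} (h : Represents S E u v)
    (h' : Represents S E u' v') : Represents S E (u + u') (v + v') := by
  obtain ⟨hv, c, hc, e⟩ := h
  obtain ⟨hv', c', hc', e'⟩ := h'
  obtain ⟨d, hd, hd'⟩ := exists_tau_mul v v'
  obtain ⟨f, hf, hf'⟩ := exists_tau_mul u u'
  have h1 : tau v * tau v' * E = (c' * c) • (E * (tau u * tau u')) := by
    rw [Matrix.mul_assoc, e', Matrix.mul_smul, ← Matrix.mul_assoc, e, Matrix.smul_mul, smul_smul,
      Matrix.mul_assoc]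
  rw [hd', hf', Matrix.smul_mul, Matrix.mul_smul, smul_smul] at h1
  refine ⟨Submodule.add_mem _ hv hv', d⁻¹ * (c' * c * f), ?_, ?_⟩
  · exact mul_ne_zero (inv_ne_zero (phase_ne_zero hd))
      (mul_ne_zero (mul_ne_zero hc' hc) (phase_ne_zero hf))
  · rw [mul_smul, ← h1, smul_smul, inv_mul_cancel₀ (phase_ne_zero hd), one_smul]

/-- The logical labels represented by labels in `N`. -/
def logicalLabels (S : Subgroup (unitaryGroup (Fin n → Fin 2) ℂ))
    (E : Matrix (Fin n → Fin 2) (Fin k → Fin 2) ℂ) (N : Submodule (ZMod 2) (Fin n → Label)) :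
    Submodule (ZMod 2) (Fin k → Label) where
  carrier := {u | ∃ v ∈ N, Represents S E u v}
  zero_mem' := ⟨0, N.zero_mem, Represents.zero⟩
  add_mem' := by
    rintro u u' ⟨v, hv, h⟩ ⟨v', hv', h'⟩
    exact ⟨v + v', N.add_mem hv hv', h.add h'⟩
  smul_mem' := by
    rintro a u ⟨v, hv, h⟩
    rcases zmod2_cases a with rfl | rfl
    · exact ⟨0, N.zero_mem, by rw [zero_smul]; exact Represents.zero⟩
    · exact ⟨v, hv, by rwa [one_smul]⟩

lemma symp_eq_zero_of_commute {ι : Type} [Fintype ι] [DecidableEq ι] {u v : ι → Label}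
    (h : tau u * tau v = tau v * tau u) : symp u v = 0 := by
  obtain ⟨c, hc, hc'⟩ := exists_tau_mul v u
  rw [tau_comm, hc', smul_smul] at h
  have h1 := (label_eq_of_smul_tau_eq (mul_ne_zero (sgn_ne_zero _) (phase_ne_zero hc)) h).2
  exact sgn_injective (by rw [sgn_zero]; exact mul_right_cancel₀ (phase_ne_zero hc) (by
    rw [h1, one_mul]))

lemma exists_represents (hS : IsStabilizer S) (hE : IsLogicalEncoding S E) (u : Fin k → Label) :
    ∃ v, Represents S E u v := by
  obtain ⟨P', hP', hcomm, he⟩ := hE.pauli (tau u)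
    (mem_pauliGroup_iff.2 ⟨1, by norm_num, u, (one_smul _ _).symm⟩)
  obtain ⟨c, hc, v, rfl⟩ := mem_pauliGroup_iff.1 hP'
  have hc0 := phase_ne_zero hc
  refine ⟨v, fun w hw => ?_, c⁻¹, inv_ne_zero hc0, ?_⟩
  · obtain ⟨g, hg, d, hd⟩ := hw
    have hd0 : d ≠ 0 := by rcases phase_of_mem hS hg hd with rfl | rfl <;> norm_num
    have h1 := (hcomm g hg).eq
    rw [hd, smul_mul_smul_comm, smul_mul_smul_comm, mul_comm d c] at h1
    exact symp_eq_zero_of_commute (smul_right_injective _ (mul_ne_zero hc0 hd0) h1).symm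
  · rw [← he, Matrix.smul_mul, smul_smul, inv_mul_cancel₀ hc0, one_smul]

/-- If `M` commutes with a Pauli string up to the sign `s`, then so do all Pauli strings in the
expansion of `M`. -/
lemma sgn_symp_of_coeff_ne_zero {ι : Type} [Fintype ι] [DecidableEq ι] {M : QOp ι}
    {w x : ι → Label} {s : ℂ} (h : M * tau w = s • (tau w * M)) (hx : coeff x M ≠ 0) :
    sgn (symp x w) = s := by
  have h1 : (tau x * (tau w * (M * tau w))).trace = s * (tau x * M).trace := by
    rw [h, Matrix.mul_smul, ← mul_assoc (tau w), tau_mul_self, one_mul, Matrix.mul_smul,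
      Matrix.trace_smul, smul_eq_mul]
  have h2 : (tau x * (tau w * (M * tau w))).trace = sgn (symp x w) * (tau x * M).trace := by
    rw [← mul_assoc, tau_comm, Matrix.smul_mul, Matrix.trace_smul, smul_eq_mul, ← mul_assoc,
      Matrix.trace_mul_comm, ← mul_assoc, ← mul_assoc, tau_mul_self, one_mul]
  have h3 : (tau x * M).trace ≠ 0 := right_ne_zero_of_mul hx
  exact mul_right_cancel₀ h3 (h2.symm.trans h1)

lemma eq_zero_of_forall_symp {ι : Type} [Fintype ι] [DecidableEq ι] {x : ι → Label}
    (h : ∀ w, symp x w = 0) : x = 0 := funext fun i =>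
  eq_zero_of_forall_symp₁ _ fun d => by rw [← symp_single_right]; exact h _

lemma Represents.symp_eq (hE : IsLogicalEncoding S E) {u u' : Fin k → Label} {v v' : Fin n → Label}
    (h : Represents S E u v) (h' : Represents S E u' v') : symp u u' = symp v v' := by
  obtain ⟨-, c, hc, e⟩ := h
  obtain ⟨-, c', hc', e'⟩ := h'
  have h1 : tau v * tau v' * E = (c' * c) • (E * (tau u * tau u')) := by
    rw [Matrix.mul_assoc, e', Matrix.mul_smul, ← Matrix.mul_assoc, e, Matrix.smul_mul, smul_smul,
      Matrix.mul_assoc]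
  have h2 : tau v' * tau v * E = (c * c') • (E * (tau u' * tau u)) := by
    rw [Matrix.mul_assoc, e, Matrix.mul_smul, ← Matrix.mul_assoc, e', Matrix.smul_mul, smul_smul,
      Matrix.mul_assoc]
  rw [tau_comm v v', Matrix.smul_mul, h2, tau_comm u u', Matrix.mul_smul, smul_smul, smul_smul]
    at h1
  obtain ⟨d, hd, hd'⟩ := exists_tau_mul u' u
  rw [hd', Matrix.mul_smul, smul_smul, smul_smul] at h1
  have h3 := smul_left_injective ℂ (encoding_mul_tau_ne_zero hE (u' + u)) h1
  have hne : c * c' * d ≠ 0 := mul_ne_zero (mul_ne_zero hc hc') (phase_ne_zero hd)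
  refine sgn_injective (mul_right_cancel₀ hne ?_)
  linear_combination -h3

/-- Every Pauli string that commutes with the stabilizer is a logical Pauli string. -/
lemma exists_represents_of_mem_perp (hS : IsStabilizer S) (hE : IsLogicalEncoding S E)
    {v : Fin n → Label} (hv : v ∈ perp (stabLabels S)) : ∃ u, Represents S E u v := by
  set M : QOp (Fin k) := Eᴴ * tau v * E with hM
  have hEM : tau v * E = E * M := by
    rw [hM, ← Matrix.mul_assoc, ← Matrix.mul_assoc, hE.range, ← tau_mul_codeProjector_comm hS hv,
      Matrix.mul_assoc, codeProjector_mul_encoding hE]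
  have hcomm : ∀ u' v', Represents S E u' v' → M * tau u' = sgn (symp v v') • (tau u' * M) := by
    rintro u' v' ⟨-, c, hc, e⟩
    refine encoding_cancel hE ?_
    have h1 : E * tau u' = c⁻¹ • (tau v' * E) := by
      rw [e, smul_smul, inv_mul_cancel₀ hc, one_smul]
    rw [← Matrix.mul_assoc, ← hEM, Matrix.mul_assoc, h1, Matrix.mul_smul, ← Matrix.mul_assoc,
      tau_comm, Matrix.smul_mul, Matrix.mul_smul, ← Matrix.mul_assoc E, h1, Matrix.smul_mul,
      Matrix.mul_assoc _ E, ← hEM, smul_comm, Matrix.mul_assoc]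
  have hM0 : M ≠ 0 := fun h0 => by
    rw [h0, Matrix.mul_zero] at hEM
    have hE0 := eq_zero_of_tau_mul_eq_zero hEM
    refine encoding_mul_tau_ne_zero hE 0 ?_
    rw [hE0, Matrix.zero_mul]
  obtain ⟨u, hu⟩ := exists_coeff_ne_zero hM0
  have huniq : ∀ x, coeff x M ≠ 0 → x = u := fun x hx => by
    rw [← sub_eq_zero]
    refine eq_zero_of_forall_symp fun w => ?_
    obtain ⟨v', hv'⟩ := exists_represents hS hE w
    have h1 := sgn_symp_of_coeff_ne_zero (hcomm w v' hv') hx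
    have h2 := sgn_symp_of_coeff_ne_zero (hcomm w v' hv') hu
    rw [label_sub, symp_add_left, sgn_injective (h1.trans h2.symm), label_add_self]
  refine ⟨u, hv, coeff u M, hu, ?_⟩
  rw [hEM, ← Matrix.mul_smul]
  congr 1
  conv_lhs => rw [← sum_coeff_smul_tau M]
  refine Finset.sum_eq_single u (fun x _ hx => ?_) (by simp)
  rw [show coeff x M = 0 by by_contra h; exact hx (huniq x h), zero_smul]

lemma represents_zero_of_mem (hS : IsStabilizer S) (hE : IsLogicalEncoding S E)
    {s : Fin n → Label} (hs : s ∈ stabLabels S) : Represents S E 0 s := by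
  refine ⟨fun x hx => stabLabels_isotropic hS hs hx, ?_⟩
  obtain ⟨g, hg, c, hc⟩ := hs
  have hc0 : c ≠ 0 := by rcases phase_of_mem hS hg hc with rfl | rfl <;> norm_num
  refine ⟨c⁻¹, inv_ne_zero hc0, ?_⟩
  have h1 : (g : QOp (Fin n)) * E = E := by
    rw [← codeProjector_mul_encoding hE, ← Matrix.mul_assoc, stab_mul_codeProjector hS hg]
  rw [tau_zero, Matrix.mul_one]
  conv_rhs => rw [← h1]
  rw [hc, Matrix.smul_mul, smul_smul, inv_mul_cancel₀ hc0, one_smul]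

variable (F : PauliFrame S)

/-- A logical label commuting with all logical labels of `F.bigLabels` is itself represented in
`F.smallLabels`. -/
lemma mem_logicalLabels_small_of_mem_perp (hS : IsStabilizer S) (hE : IsLogicalEncoding S E)
    {u : Fin k → Label} (hu : u ∈ perp (logicalLabels S E F.bigLabels)) :
    u ∈ logicalLabels S E F.smallLabels := by
  obtain ⟨v, hv⟩ := exists_represents hS hE u
  obtain ⟨s, hs, g, hg, rfl⟩ := F.exists_add_of_mem_perp hS hv.1 fun w hw => by
    obtain ⟨x, hx⟩ := exists_represents_of_mem_perp hS hE hw.2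
    rw [← hv.symp_eq hE hx]
    exact hu x ⟨w, hw.1, hx⟩
  refine ⟨g, hg.1, ?_⟩
  have := hv.add (represents_zero_of_mem hS hE hs)
  rwa [add_zero, add_comm s g, add_assoc, label_add_self, add_zero] at this

lemma logicalLabels_small_isotropic (hE : IsLogicalEncoding S E) {u u' : Fin k → Label}
    (hu : u ∈ logicalLabels S E F.smallLabels) (hu' : u' ∈ logicalLabels S E F.smallLabels) :
    symp u u' = 0 := by
  obtain ⟨v, hv, h⟩ := hu
  obtain ⟨v', hv', h'⟩ := hu'
  rw [h.symp_eq hE h', F.smallLabels_isotropic hv hv']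

lemma Represents.sub {u u' : Fin k → Label} {v v' : Fin n → Label} (h : Represents S E u v)
    (h' : Represents S E u' v') : Represents S E (u - u') (v - v') := by
  rw [label_sub, label_sub]; exact h.add h'

end Logical

/-! ### The logical action of a transversal gate on Pauli strings -/

section Block

variable {n k r : ℕ} {S : Subgroup (unitaryGroup (Fin n → Fin 2) ℂ)}
  {E : Matrix (Fin n → Fin 2) (Fin k → Fin 2) ℂ}

/-- Bit strings on a product of index sets as families of bit strings. -/
abbrev curryBits (r k : ℕ) : (Fin r × Fin k → Fin 2) ≃ (Fin r → Fin k → Fin 2) :=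
  Equiv.curry (Fin r) (Fin k) (Fin 2)

lemma blockEncoding_eq (E : Matrix (Fin n → Fin 2) (Fin k → Fin 2) ℂ) :
    blockEncoding r E = (piTensor fun _ : Fin r => E).submatrix id (curryBits r k) := rfl

lemma submatrix_smul_eq {α β γ δ : Type} (c : ℂ) (M : Matrix α β ℂ) (f : γ → α) (g : δ → β) :
    (c • M).submatrix f g = c • M.submatrix f g := rfl

lemma tau_prod (m : Fin r × Fin k → Label) :
    tau m = (piTensor fun i => tau fun l => m (i, l)).submatrix (curryBits r k) (curryBits r k) := by
  ext x y
  simp only [tau, piTensor_apply, Matrix.submatrix_apply]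
  exact Fintype.prod_prod_type _

lemma blockEncoding_mul_tau (E : Matrix (Fin n → Fin 2) (Fin k → Fin 2) ℂ)
    (m : Fin r × Fin k → Label) : blockEncoding r E * tau m =
      (piTensor fun i => E * tau fun l => m (i, l)).submatrix id (curryBits r k) := by
  rw [blockEncoding_eq, tau_prod, Matrix.submatrix_mul_equiv, piTensor_mul]

lemma mul_blockEncoding (A : Fin r → QOp (Fin n)) (E : Matrix (Fin n → Fin 2) (Fin k → Fin 2) ℂ) :
    piTensor A * blockEncoding r E = (piTensor fun i => A i * E).submatrix id (curryBits r k) := by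
  rw [blockEncoding_eq, ← piTensor_mul]
  rfl

lemma conjTranspose_mul_blockEncoding (A : Fin r → QOp (Fin n))
    (E : Matrix (Fin n → Fin 2) (Fin k → Fin 2) ℂ) :
    (blockEncoding r E)ᴴ * (piTensor A * blockEncoding r E) =
      (piTensor fun i => Eᴴ * (A i * E)).submatrix (curryBits r k) (curryBits r k) := by
  rw [mul_blockEncoding, blockEncoding_eq, Matrix.conjTranspose_submatrix, piTensor_conjTranspose,
    ← piTensor_mul (fun _ => Eᴴ)]
  exact Matrix.submatrix_mul_equiv _ _ _ (Equiv.refl _) _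

lemma blockEncoding_isometry (hE : IsLogicalEncoding S E) :
    (blockEncoding r E)ᴴ * blockEncoding r E = 1 := by
  have := conjTranspose_mul_blockEncoding (fun _ : Fin r => 1) E
  rw [piTensor_one, Matrix.one_mul] at this
  simp only [Matrix.one_mul, hE.isometry, piTensor_one] at this
  rw [this, Matrix.submatrix_one_equiv]

lemma blockEncoding_range (hE : IsLogicalEncoding S E) :
    blockEncoding r E * (blockEncoding r E)ᴴ = piTensor fun _ : Fin r => codeProjector S := by
  rw [blockEncoding_eq, Matrix.conjTranspose_submatrix, Matrix.submatrix_mul_equiv,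
    piTensor_conjTranspose, piTensor_mul, hE.range, Matrix.submatrix_id_id]

lemma blockProjector_mul_blockEncoding (hE : IsLogicalEncoding S E) :
    (piTensor fun _ : Fin r => codeProjector S) * blockEncoding r E = blockEncoding r E := by
  rw [← blockEncoding_range hE, Matrix.mul_assoc, blockEncoding_isometry hE, Matrix.mul_one]

/-- The Pauli strings in the conjugate of a logical Pauli string by the logical gate come from
Pauli strings in the conjugate of a physical representative by the transversal gate. -/
lemma exists_of_coeff_ne_zero (hS : IsStabilizer S) (hE : IsLogicalEncoding S E)
    {U : Fin n → QOp (Fin r)} (hU : IsTransversal S U) {W : QOp (Fin r × Fin k)}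
    (hW : ActsAs E U W) {m m' : Fin r × Fin k → Label} {v : Fin r → Fin n → Label}
    (hv : ∀ i, Represents S E (fun l => m (i, l)) (v i)) (hm' : coeff m' (W * tau m * Wᴴ) ≠ 0) :
    ∃ w : Fin r → Fin n → Label, (∀ i, Represents S E (fun l => m' (i, l)) (w i)) ∧
      ∀ j, conjCoeff (U j) (fun i => w i j) (fun i => v i j) ≠ 0 := by
  set B := blockEncoding r E with hB
  set G := transversalGate U with hG
  choose hperp c hc hcv using hv
  have h1 : B * tau m = (∏ i, (c i)⁻¹) • (blockTau v * B) := by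
    rw [hB, blockEncoding_mul_tau, blockTau, mul_blockEncoding]
    simp only [hcv]
    rw [piTensor_smul, submatrix_smul_eq, smul_smul, ← Finset.prod_mul_distrib]
    simp [inv_mul_cancel₀ (hc _)]
  have h2 : W * tau m * Wᴴ = (∏ i, (c i)⁻¹) • (Bᴴ * (G * blockTau v * Gᴴ * B)) := by
    have hGB : G * B = B * W := hW
    have hBG : Bᴴ * Gᴴ = Wᴴ * Bᴴ := by
      rw [← Matrix.conjTranspose_mul, hGB, Matrix.conjTranspose_mul]
    have hBB : Bᴴ * B = 1 := blockEncoding_isometry hE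
    have hPi : G * (B * Bᴴ) * Gᴴ = B * Bᴴ := by
      rw [blockEncoding_range hE]; exact transversal_conj_eq hU
    have hGG : Gᴴ * G = 1 := mul_eq_one_comm.1 (transversalGate_mul_conjTranspose hU.1)
    calc W * tau m * Wᴴ = (Bᴴ * B) * (W * tau m * Wᴴ) * (Bᴴ * B) := by
          rw [hBB, Matrix.one_mul, Matrix.mul_one]
      _ = Bᴴ * (B * W) * tau m * (Wᴴ * Bᴴ) * B := by simp only [Matrix.mul_assoc]
      _ = Bᴴ * G * (B * tau m) * Bᴴ * Gᴴ * B := by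
          rw [← hGB, ← hBG]; simp only [Matrix.mul_assoc]
      _ = (∏ i, (c i)⁻¹) • (Bᴴ * (G * blockTau v * (B * Bᴴ) * Gᴴ * B)) := by
          rw [h1]; simp only [Matrix.mul_smul, Matrix.smul_mul, Matrix.mul_assoc]
      _ = (∏ i, (c i)⁻¹) • (Bᴴ * (G * blockTau v * (Gᴴ * G) * (B * Bᴴ) * Gᴴ * B)) := by
          rw [hGG, Matrix.mul_one]
      _ = (∏ i, (c i)⁻¹) • (Bᴴ * (G * blockTau v * Gᴴ * (G * (B * Bᴴ) * Gᴴ) * B)) := by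
          simp only [Matrix.mul_assoc]
      _ = (∏ i, (c i)⁻¹) • (Bᴴ * (G * blockTau v * Gᴴ * B)) := by
          rw [hPi]; simp only [Matrix.mul_assoc]; rw [hBB, Matrix.mul_one]
  rw [h2, hG, transversal_conj_blockTau, Matrix.sum_mul, Matrix.mul_sum, coeff_smul, coeff_sum] at hm'
  obtain ⟨w, -, hw⟩ := Finset.exists_ne_zero_of_sum_ne_zero (right_ne_zero_of_mul hm')
  rw [Matrix.smul_mul, Matrix.mul_smul, coeff_smul, blockTau, hB,
    conjTranspose_mul_blockEncoding] at hw
  have hw1 := left_ne_zero_of_mul hw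
  have hw2 := right_ne_zero_of_mul hw
  have hwp : ∀ i, w i ∈ perp (stabLabels S) := fun i => by
    by_contra hcon
    have h0 : Eᴴ * (tau (w i) * E) = 0 := by
      have h3 := codeProjector_mul_tau_mul hS hcon
      have hEP : Eᴴ * codeProjector S = Eᴴ := by
        rw [← hE.range, ← Matrix.mul_assoc, hE.isometry, Matrix.one_mul]
      rw [← hEP]
      nth_rewrite 2 [← codeProjector_mul_encoding hE]
      calc Eᴴ * codeProjector S * (tau (w i) * (codeProjector S * E))
          = Eᴴ * (codeProjector S * tau (w i) * codeProjector S) * E := by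
            simp only [Matrix.mul_assoc]
        _ = 0 := by rw [h3, Matrix.mul_zero, Matrix.zero_mul]
    rw [piTensor_eq_zero (i := i) h0] at hw2
    simp [coeff] at hw2
  choose u hu using fun i => exists_represents_of_mem_perp hS hE (hwp i)
  choose d hd hdu using fun i => (hu i).2
  refine ⟨w, fun i => ?_, fun j => Finset.prod_ne_zero_iff.1 hw1 j (Finset.mem_univ j)⟩
  have h4 : (piTensor fun i => Eᴴ * (tau (w i) * E)).submatrix (curryBits r k) (curryBits r k) =
      (∏ i, d i) • tau fun x : Fin r × Fin k => u x.1 x.2 := by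
    rw [tau_prod, ← submatrix_smul_eq, ← piTensor_smul]
    simp only [hdu, Matrix.mul_smul, ← Matrix.mul_assoc, hE.isometry, Matrix.one_mul]
  rw [h4, coeff_smul, coeff_tau] at hw2
  have h5 : m' = fun x : Fin r × Fin k => u x.1 x.2 := by
    by_contra hne
    simp [hne] at hw2
  rw [h5]
  exact hu i

variable (F : PauliFrame S)

/-- The logical gate preserves the span of the Pauli strings represented in `F.smallLabels`. -/
lemma mem_small_of_coeff_ne_zero (hS : IsStabilizer S) (hE : IsLogicalEncoding S E)
    {U : Fin n → QOp (Fin r)} (hU : IsTransversal S U) {W : QOp (Fin r × Fin k)}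
    (hW : ActsAs E U W) {m m' : Fin r × Fin k → Label}
    (hm : ∀ i, (fun l => m (i, l)) ∈ logicalLabels S E F.smallLabels)
    (hm' : coeff m' (W * tau m * Wᴴ) ≠ 0) (i : Fin r) :
    (fun l => m' (i, l)) ∈ logicalLabels S E F.smallLabels := by
  choose v hv hrep using hm
  obtain ⟨w, hw, hc⟩ := exists_of_coeff_ne_zero hS hE hU hW hrep hm'
  exact ⟨w i, F.mem_smallLabels.2 fun j => F.map_small r U hU j _ _
    (fun i => F.mem_smallLabels.1 (hv i) j) (hc j) i, hw i⟩

/-- The logical gate maps a Pauli string represented in `F.bigLabels` into a single coset of those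
represented in `F.smallLabels`. -/
lemma sub_mem_small_of_coeff_ne_zero (hS : IsStabilizer S) (hE : IsLogicalEncoding S E)
    {U : Fin n → QOp (Fin r)} (hU : IsTransversal S U) {W : QOp (Fin r × Fin k)}
    (hW : ActsAs E U W) {m m' m'' : Fin r × Fin k → Label}
    (hm : ∀ i, (fun l => m (i, l)) ∈ logicalLabels S E F.bigLabels)
    (hm' : coeff m' (W * tau m * Wᴴ) ≠ 0) (hm'' : coeff m'' (W * tau m * Wᴴ) ≠ 0) (i : Fin r) :
    (fun l => m' (i, l) - m'' (i, l)) ∈ logicalLabels S E F.smallLabels := by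
  choose v hv hrep using hm
  obtain ⟨w, hw, hc⟩ := exists_of_coeff_ne_zero hS hE hU hW hrep hm'
  obtain ⟨w', hw', hc'⟩ := exists_of_coeff_ne_zero hS hE hU hW hrep hm''
  exact ⟨w i - w' i, F.mem_smallLabels.2 fun j => F.map_big r U hU j _ _ _
    (fun i => F.mem_bigLabels.1 (hv i) j) (hc j) (hc' j) i, (hw i).sub (hw' i)⟩

end Block

/-! ### Gates on some qubits of a register -/

section GateOn

lemma extend_add {ι : Type} {r : ℕ} {t : Fin r → ι} (b b' : Fin r → Label) (m m' : ι → Label) :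
    Function.extend t (b + b') (m + m') = Function.extend t b m + Function.extend t b' m' := by
  funext q
  by_cases hq : ∃ i, t i = q
  · classical
    simp only [Function.extend, hq, dif_pos, Pi.add_apply]
  · simp only [Pi.add_apply, Function.extend_apply' _ _ _ hq]

variable {ι : Type} [Fintype ι] [DecidableEq ι] {r : ℕ} {t : Fin r → ι}

lemma gateOn_conjTranspose (t : Fin r → ι) (V : QOp (Fin r)) :
    (gateOn t V)ᴴ = gateOn t Vᴴ := by
  ext x y
  simp only [gateOn, Matrix.conjTranspose_apply, Matrix.of_apply]
  have : (∀ q, (∀ i, t i ≠ q) → y q = x q) ↔ ∀ q, (∀ i, t i ≠ q) → x q = y q :=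
    forall₂_congr fun q _ => eq_comm
  simp only [this]
  split_ifs <;> simp

lemma gateOn_smul (t : Fin r → ι) (c : ℂ) (V : QOp (Fin r)) :
    gateOn t (c • V) = c • gateOn t V := by
  ext x y
  simp [gateOn]

lemma gateOn_sum (t : Fin r → ι) {κ : Type} (s : Finset κ) (V : κ → QOp (Fin r)) :
    gateOn t (∑ a ∈ s, V a) = ∑ a ∈ s, gateOn t (V a) := by
  ext x y
  simp only [gateOn, Matrix.of_apply, Matrix.sum_apply]
  split_ifs <;> simp

lemma gateOn_tau (ht : Function.Injective t) (b : Fin r → Label) :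
    gateOn t (tau b) = tau (Function.extend t b 0) := by
  ext x y
  simp only [gateOn, Matrix.of_apply, tau, piTensor_apply, Function.comp_apply]
  have h1 : ∀ q ∈ Finset.univ \ Finset.univ.image t,
      sigma (Function.extend t b 0 q) (x q) (y q) = if x q = y q then 1 else 0 := by
    intro q hq
    simp only [Finset.mem_sdiff, Finset.mem_univ, Finset.mem_image, true_and] at hq
    rw [Function.extend_apply' _ _ _ hq, Pi.zero_apply, sigma_zero, Matrix.one_apply]
  rw [← Finset.prod_sdiff (Finset.subset_univ (Finset.univ.image t)), Finset.prod_congr rfl h1,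
    Finset.prod_image (fun _ _ _ _ h => ht h), Finset.prod_ite_zero]
  simp only [ht.extend_apply, Finset.mem_sdiff, Finset.mem_univ, Finset.mem_image, true_and,
    not_exists, Finset.prod_const_one, ite_mul, one_mul, zero_mul]

lemma mulPhase_zero_zero : mulPhase 0 0 = 1 := by simp [mulPhase, yPhase, Prod.ext_iff]

lemma gateOn_mul (ht : Function.Injective t) (V V' : QOp (Fin r)) :
    gateOn t V * gateOn t V' = gateOn t (V * V') := by
  have key : ∀ b b' : Fin r → Label,
      gateOn t (tau b) * gateOn t (tau b') = gateOn t (tau b * tau b') := by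
    intro b b'
    rw [tau_mul, gateOn_smul, gateOn_tau ht, gateOn_tau ht, gateOn_tau ht, tau_mul, ← extend_add,
      add_zero]
    congr 1
    rw [← Finset.prod_subset (Finset.subset_univ (Finset.univ.image t)),
      Finset.prod_image (fun _ _ _ _ h => ht h)]
    · simp only [ht.extend_apply]
    · intro q _ hq
      simp only [Finset.mem_univ, Finset.mem_image, true_and] at hq
      rw [Function.extend_apply' _ _ _ hq, Function.extend_apply' _ _ _ hq]
      exact mulPhase_zero_zero
  rw [← sum_coeff_smul_tau V, ← sum_coeff_smul_tau V']
  simp only [gateOn_sum, gateOn_smul, Finset.sum_mul, Finset.mul_sum, Matrix.smul_mul,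
    Matrix.mul_smul, key]

/-- Conjugation by a gate on the qubits `t i` acts on these factors of a Pauli string only. -/
lemma coeff_gateOn_conj_ne_zero (ht : Function.Injective t) (V : QOp (Fin r)) (m : ι → Label)
    {b : Fin r → Label} (hb : coeff b (V * tau (m ∘ t) * Vᴴ) ≠ 0) :
    coeff (Function.extend t b m) (gateOn t V * tau m * (gateOn t V)ᴴ) ≠ 0 := by
  set ρ : ι → Label := Function.extend t 0 m with hρ
  have hsymp : ∀ b : Fin r → Label, symp ρ (Function.extend t b 0) = 0 := fun b => by
    refine Finset.sum_eq_zero fun q _ => ?_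
    by_cases hq : ∃ i, t i = q
    · obtain ⟨i, rfl⟩ := hq
      rw [hρ, ht.extend_apply, Pi.zero_apply, symp₁_zero_left]
    · rw [Function.extend_apply' _ _ _ hq, Pi.zero_apply, symp₁_zero_right]
  have hcomm : ∀ V : QOp (Fin r), tau ρ * gateOn t V = gateOn t V * tau ρ := fun V => by
    rw [← sum_coeff_smul_tau V]
    simp only [gateOn_sum, gateOn_smul, gateOn_tau ht, Finset.sum_mul, Finset.mul_sum,
      Matrix.smul_mul, Matrix.mul_smul, tau_comm_of_symp_eq_zero (hsymp _)]
  have hm : Function.extend t (m ∘ t) 0 + ρ = m := by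
    rw [hρ, ← extend_add, add_zero, zero_add]
    funext q
    by_cases hq : ∃ i, t i = q
    · obtain ⟨i, rfl⟩ := hq
      rw [ht.extend_apply]; rfl
    · rw [Function.extend_apply' _ _ _ hq]
  have hsum : ∀ b : Fin r → Label, Function.extend t b 0 + ρ = Function.extend t b m := fun b => by
    rw [hρ, ← extend_add, add_zero, zero_add]
  obtain ⟨c, hc, hcm⟩ := exists_tau_mul (Function.extend t (m ∘ t) 0) ρ
  have hc0 := phase_ne_zero hc
  rw [hm] at hcm
  have h1 : gateOn t V * tau m * (gateOn t V)ᴴ =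
      c⁻¹ • ∑ b : Fin r → Label, coeff b (V * tau (m ∘ t) * Vᴴ) •
        (tau (Function.extend t b 0) * tau ρ) := by
    have h2 : tau m = c⁻¹ • (gateOn t (tau (m ∘ t)) * tau ρ) := by
      rw [gateOn_tau ht, hcm, smul_smul, inv_mul_cancel₀ hc0, one_smul]
    rw [h2, Matrix.mul_smul, Matrix.smul_mul, gateOn_conjTranspose]
    congr 1
    rw [← Matrix.mul_assoc, Matrix.mul_assoc _ (tau ρ), hcomm, ← Matrix.mul_assoc, gateOn_mul ht,
      gateOn_mul ht]
    conv_lhs => rw [← sum_coeff_smul_tau (V * tau (m ∘ t) * Vᴴ)]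
    simp only [gateOn_sum, gateOn_smul, gateOn_tau ht, Finset.sum_mul, Matrix.smul_mul]
  rw [h1, coeff_smul, coeff_sum, Finset.sum_eq_single b]
  · rw [coeff_smul, tau_mul, coeff_smul, hsum, coeff_tau, if_pos rfl, mul_one]
    exact mul_ne_zero (inv_ne_zero hc0) (mul_ne_zero hb
      (Finset.prod_ne_zero_iff.2 fun i _ => phase_ne_zero (mulPhase_pow _ _)))
  · intro b' _ hne
    rw [coeff_smul, tau_mul, coeff_smul, hsum, coeff_tau, if_neg, mul_zero, mul_zero]
    intro heq
    refine hne (funext fun i => ?_)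
    have := congrFun heq (t i)
    rw [ht.extend_apply, ht.extend_apply] at this
    exact this.symm
  · simp

end GateOn

section LogicalQubit

variable {n k r : ℕ} {S : Subgroup (unitaryGroup (Fin n → Fin 2) ℂ)}
  {E : Matrix (Fin n → Fin 2) (Fin k → Fin 2) ℂ} (F : PauliFrame S)

lemma blockQubit_injective (s : Fin r → Fin k) :
    Function.Injective fun i => ((i, s i) : Fin r × Fin k) := fun _ _ h => (Prod.ext_iff.1 h).1

lemma extend_blockQubit (s : Fin r → Fin k) (b : Fin r → Label) (m : Fin r × Fin k → Label)
    (i : Fin r) (l : Fin k) :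
    Function.extend (fun i => (i, s i)) b m (i, l) = if l = s i then b i else m (i, l) := by
  split_ifs with h
  · subst h
    exact (blockQubit_injective s).extend_apply b m i
  · refine Function.extend_apply' _ _ _ ?_
    rintro ⟨i', hi'⟩
    obtain ⟨rfl, rfl⟩ := Prod.ext_iff.1 hi'
    exact h rfl

/-- A gate on one logical qubit per block changes each restriction `a i` of a label represented in
`F.smallLabels` by a single-qubit label represented there. -/
lemma single_sub_mem_small (hS : IsStabilizer S) (hE : IsLogicalEncoding S E)
    {U : Fin n → QOp (Fin r)} (hU : IsTransversal S U) {s : Fin r → Fin k} {V : QOp (Fin r)}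
    (hV : ActsAs E U (gateOn (fun i => (i, s i)) V)) {a b : Fin r → Label}
    (ha : ∀ i, ∃ u ∈ logicalLabels S E F.smallLabels, u (s i) = a i)
    (hb : coeff b (V * tau a * Vᴴ) ≠ 0) (i : Fin r) :
    Pi.single (s i) (b i - a i) ∈ logicalLabels S E F.smallLabels := by
  choose u hu hus using ha
  set m : Fin r × Fin k → Label := fun x => u x.1 x.2 with hm
  have hma : m ∘ (fun i => (i, s i)) = a := funext hus
  have h1 := mem_small_of_coeff_ne_zero F hS hE hU hV (m := m) hu
    (coeff_gateOn_conj_ne_zero (blockQubit_injective s) V m (by rw [hma]; exact hb)) i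
  have h2 := Submodule.sub_mem _ h1 (hu i)
  convert h2 using 1
  funext l
  rw [Pi.sub_apply, extend_blockQubit]
  by_cases hl : l = s i
  · subst hl
    rw [Pi.single_eq_same, if_pos rfl, hus]
  · rw [Pi.single_eq_of_ne hl, if_neg hl, hm, sub_self]

/-- A gate on one logical qubit per block maps the restriction of a label represented in
`F.bigLabels` to labels that differ by single-qubit labels represented in `F.smallLabels`. -/
lemma single_sub_mem_small_of_big (hS : IsStabilizer S) (hE : IsLogicalEncoding S E)
    {U : Fin n → QOp (Fin r)} (hU : IsTransversal S U) {s : Fin r → Fin k} {V : QOp (Fin r)}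
    (hV : ActsAs E U (gateOn (fun i => (i, s i)) V)) {a b b' : Fin r → Label}
    (ha : ∀ i, ∃ u ∈ logicalLabels S E F.bigLabels, u (s i) = a i)
    (hb : coeff b (V * tau a * Vᴴ) ≠ 0) (hb' : coeff b' (V * tau a * Vᴴ) ≠ 0) (i : Fin r) :
    Pi.single (s i) (b i - b' i) ∈ logicalLabels S E F.smallLabels := by
  choose u hu hus using ha
  set m : Fin r × Fin k → Label := fun x => u x.1 x.2 with hm
  have hma : m ∘ (fun i => (i, s i)) = a := funext hus
  have h1 := sub_mem_small_of_coeff_ne_zero F hS hE hU hV (m := m) hu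
    (coeff_gateOn_conj_ne_zero (blockQubit_injective s) V m (by rw [hma]; exact hb))
    (coeff_gateOn_conj_ne_zero (blockQubit_injective s) V m (by rw [hma]; exact hb')) i
  convert h1 using 1
  funext l
  rw [extend_blockQubit, extend_blockQubit]
  by_cases hl : l = s i
  · subst hl
    rw [Pi.single_eq_same, if_pos rfl, if_pos rfl]
  · rw [Pi.single_eq_of_ne hl, if_neg hl, if_neg hl, sub_self]

lemma symp₁_eq_zero_of_single_mem (hE : IsLogicalEncoding S E) {s : Fin k} {x y : Label}
    (hx : Pi.single s x ∈ logicalLabels S E F.smallLabels)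
    (hy : Pi.single s y ∈ logicalLabels S E F.smallLabels) : symp₁ x y = 0 := by
  have := logicalLabels_small_isotropic F hE hx hy
  rwa [symp_single_right, Pi.single_eq_same] at this

/-- If no single-qubit label on the logical qubit `s` is represented in `F.smallLabels`, then the
labels represented in `F.bigLabels` restrict to all labels at `s`. -/
lemma exists_mem_big_apply_eq (hS : IsStabilizer S) (hE : IsLogicalEncoding S E) {s : Fin k}
    (hs : ∀ x, Pi.single s x ∈ logicalLabels S E F.smallLabels → x = 0) (y : Label) :
    ∃ u ∈ logicalLabels S E F.bigLabels, u s = y := by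
  by_contra hcon
  have hy : y ∉ (logicalLabels S E F.bigLabels).map (LinearMap.proj s) := fun h => by
    obtain ⟨u, hu, rfl⟩ := Submodule.mem_map.1 h
    exact hcon ⟨u, hu, rfl⟩
  obtain ⟨f, hf, hle⟩ := Submodule.exists_le_ker_of_notMem hy
  have hfx : ∀ x : Label, f x = symp₁ (f (0, 1), f (1, 0)) x := fun x => by
    have hx : x = x.1 • ((1, 0) : Label) + x.2 • ((0, 1) : Label) := by simp
    conv_lhs => rw [hx]
    rw [map_add, map_smul, map_smul, symp₁, smul_eq_mul, smul_eq_mul]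
    ring
  have h0 := hs (f (0, 1), f (1, 0)) (mem_logicalLabels_small_of_mem_perp F hS hE fun u hu => by
    rw [symp_single_left, ← hfx]
    exact hle ⟨u, hu, rfl⟩)
  exact hf (by rw [hfx, h0, symp₁_zero_left])

end LogicalQubit

/-! ### The span of the `Z` operators -/

section ZSpan

variable {ι : Type} [Fintype ι] [DecidableEq ι]

/-- A label of a product of `Z` operators. -/
def IsZLabel (m : ι → Label) : Prop := ∀ q, (m q).1 = 0

lemma tau_mul_of_isZLabel {u v : ι → Label} (hu : IsZLabel u) (hv : IsZLabel v) :
    tau u * tau v = tau (u + v) := by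
  rw [tau_mul, Finset.prod_eq_one, one_smul]
  intro q _
  simp [mulPhase, yPhase, hu q, hv q, Prod.ext_iff]

lemma zAt_eq_tau (i : ι) : zAt i = tau (Pi.single i (0, 1)) := by
  rw [zAt, pauliString, tau]
  congr 1
  funext q
  by_cases h : q = i
  · subst h; simp [sigma, labelCode]
  · simp [sigma, labelCode, h]

lemma tau_mem_zSpan {m : ι → Label} (hm : IsZLabel m) : tau m ∈ zSpan ι := by
  refine Submodule.subset_span ?_
  have key : ∀ s : Finset ι, tau (fun q => if q ∈ s then m q else 0) ∈
      Submonoid.closure {M : QOp ι | ∃ i, M = zAt i ∨ M = -zAt i} := by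
    intro s
    induction s using Finset.induction_on with
    | empty =>
      have : tau (fun q => if q ∈ (∅ : Finset ι) then m q else 0) = 1 := by
        simp only [Finset.notMem_empty, if_false]
        exact tau_zero
      rw [this]
      exact Submonoid.one_mem _
    | insert a s ha ih =>
      have h1 : (fun q => if q ∈ insert a s then m q else 0) =
          Pi.single a (m a) + fun q => if q ∈ s then m q else 0 := by
        funext q
        by_cases hq : q = a
        · subst hq; simp [ha]
        · simp [hq]
      have hz : IsZLabel (fun q => if q ∈ s then m q else 0) := fun q => by
        dsimp only
        split_ifs
        · exact hm q
        · rfl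
      have hza : IsZLabel (Pi.single a (m a)) := fun q => by
        by_cases hq : q = a
        · subst hq; rw [Pi.single_eq_same]; exact hm q
        · rw [Pi.single_eq_of_ne hq]; rfl
      rw [h1, ← tau_mul_of_isZLabel hza hz]
      refine Submonoid.mul_mem _ ?_ ih
      rcases zmod2_cases (m a).2 with h | h
      · have : m a = 0 := Prod.ext (hm a) h
        rw [this, Pi.single_zero, tau_zero]
        exact Submonoid.one_mem _
      · have : m a = (0, 1) := Prod.ext (hm a) h
        rw [this, ← zAt_eq_tau]
        exact Submonoid.subset_closure ⟨a, Or.inl rfl⟩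
  simpa using key Finset.univ

/-- Invariance of the span need only be tested on products of `Z` operators. -/
lemma keepsZSpan_of_tau {W : QOp ι} (h : ∀ m, IsZLabel m → W * tau m * Wᴴ ∈ zSpan ι) :
    KeepsZSpan W := by
  have hclos : ∀ M ∈ Submonoid.closure {M : QOp ι | ∃ i, M = zAt i ∨ M = -zAt i},
      ∃ c : ℂ, ∃ m, IsZLabel m ∧ M = c • tau m := by
    intro M hM
    have hsingle : ∀ i : ι, IsZLabel (Pi.single i ((0, 1) : Label)) := fun i q => by
      by_cases hq : q = i
      · subst hq; simp
      · simp [hq]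
    induction hM using Submonoid.closure_induction with
    | mem x hx =>
      obtain ⟨i, rfl | rfl⟩ := hx
      · exact ⟨1, _, hsingle i, by rw [one_smul, zAt_eq_tau]⟩
      · exact ⟨-1, _, hsingle i, by rw [neg_one_smul, zAt_eq_tau]⟩
    | one => exact ⟨1, 0, fun _ => rfl, by rw [one_smul, tau_zero]⟩
    | mul x y _ _ hx hy =>
      obtain ⟨c, m, hm, rfl⟩ := hx
      obtain ⟨d, m', hm', rfl⟩ := hy
      refine ⟨c * d, m + m', fun q => ?_, ?_⟩
      · rw [Pi.add_apply, Prod.fst_add, hm q, hm' q, add_zero]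
      · rw [smul_mul_smul_comm, tau_mul_of_isZLabel hm hm']
  intro M hM
  induction hM using Submodule.span_induction with
  | mem x hx =>
    obtain ⟨c, m, hm, rfl⟩ := hclos x hx
    rw [Matrix.mul_smul, Matrix.smul_mul]
    exact Submodule.smul_mem _ _ (h m hm)
  | zero => simp
  | add x y _ _ hx hy =>
    rw [Matrix.mul_add, Matrix.add_mul]
    exact Submodule.add_mem _ hx hy
  | smul a x _ hx =>
    rw [Matrix.mul_smul, Matrix.smul_mul]
    exact Submodule.smul_mem _ _ hx

end ZSpan

/-! ### Gates on one logical qubit per block -/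

section LocalClifford

/-- The single-qubit criterion for a Clifford gate: Pauli matrices go to multiples of Pauli
matrices. -/
lemma isClifford_singleQubit {A : Matrix (Fin 2) (Fin 2) ℂ} (hA : A * Aᴴ = 1)
    (h : ∀ q, ∃ q' : Label, ∃ c : ℂ, A * sigma q * Aᴴ = c • sigma q') :
    IsClifford (piTensor fun _ : Fin 1 => A) := by
  refine isClifford_of_conjCoeff (Matrix.mem_unitaryGroup_iff.2 ?_) fun p q q' hq hq' => ?_
  · change _ * (piTensor fun _ : Fin 1 => A)ᴴ = 1
    rw [piTensor_conjTranspose, piTensor_mul, hA, piTensor_one]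
  · choose f c hf using h
    have key : ∀ x : Fin 1 → Label, conjCoeff (piTensor fun _ : Fin 1 => A) x p ≠ 0 →
        x = fun i => f (p i) := by
      intro x hx
      have h1 : (piTensor fun _ : Fin 1 => A) * tau p * (piTensor fun _ : Fin 1 => A)ᴴ =
          (∏ i, c (p i)) • tau fun i => f (p i) := by
        rw [tau, piTensor_conjTranspose, piTensor_mul, piTensor_mul]
        simp only [hf, piTensor_smul]
        rfl
      rw [conjCoeff, h1, coeff_smul, coeff_tau] at hx
      by_contra hne
      simp [hne] at hx
    rw [key q hq, key q' hq']

lemma sigma_mul_self (q : Label) : sigma q * sigma q = 1 := by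
  rw [sigma_mul, label_add_self, sigma_zero]
  rcases label_cases q with h | h | h | h <;> rw [h] <;>
    simp [mulPhase, yPhase, Prod.ext_iff]

lemma sigma_anticomm {p q : Label} (h : symp₁ p q = 1) :
    sigma p * sigma q = -(sigma q * sigma p) := by
  rw [sigma_mul, sigma_mul, mulPhase_comm, h, sgn_one, add_comm q p, neg_one_mul, neg_smul]

lemma label_cases_of_symp_z : ∀ z q : Label, symp₁ z (0, 1) = 1 →
    q = 0 ∨ q = z ∨ q = (0, 1) ∨ q = z + (0, 1) := by decide

/-- A Hermitian single-qubit Clifford gate that exchanges `Z` with a given Pauli matrix: the sum of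
the two, normalized. -/
lemma exists_clifford_axis {z : Label} (hz : z ≠ 0) : ∃ A : Matrix (Fin 2) (Fin 2) ℂ,
    Aᴴ = A ∧ IsClifford (piTensor fun _ : Fin 1 => A) ∧
      A * sigma (0, 1) * A = sigma z ∧ A * sigma z * A = sigma (0, 1) ∧ A * A = 1 := by
  by_cases hzz : symp₁ z (0, 1) = 0
  · have : z = (0, 1) := (label_eq_of_symp (0, 1) z (by decide) hzz).resolve_left hz
    subst this
    refine ⟨1, by simp, isClifford_singleQubit (by simp) fun q => ⟨q, 1, by simp⟩, by simp, by simp,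
      by simp⟩
  · have h1 : symp₁ z (0, 1) = 1 := (zmod2_cases _).resolve_left hzz
    set x := sigma z with hx
    set y := sigma (0, 1) with hy
    have hxx : x * x = 1 := sigma_mul_self z
    have hyy : y * y = 1 := sigma_mul_self (0, 1)
    have hxy : x * y = -(y * x) := sigma_anticomm h1
    set c : ℂ := (Real.sqrt 2 : ℂ)⁻¹ with hc
    have hcc : c * c = 2⁻¹ := by
      rw [hc, ← mul_inv, ← Complex.ofReal_mul, Real.mul_self_sqrt (by norm_num)]
      norm_num
    have hcs : star c = c := by
      rw [hc, star_inv₀]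
      simp
    have hxyx : x * y * x = -y := by rw [hxy, neg_mul, mul_assoc, hxx, mul_one]
    set A := c • (x + y) with hA
    have hAh : Aᴴ = A := by
      rw [hA, Matrix.conjTranspose_smul, hcs, Matrix.conjTranspose_add, hx, hy,
        sigma_conjTranspose, sigma_conjTranspose]
    have hconj : ∀ M, A * M * A = (2⁻¹ : ℂ) • ((x + y) * M * (x + y)) := fun M => by
      rw [hA, Matrix.smul_mul, Matrix.smul_mul, Matrix.mul_smul, smul_smul, hcc]
    have h2 : ∀ M : Matrix (Fin 2) (Fin 2) ℂ, (2⁻¹ : ℂ) • (M + M) = M := fun M => by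
      rw [← two_smul ℂ M, smul_smul]; norm_num
    have hAA : A * A = 1 := by
      have := hconj 1
      rw [mul_one, mul_one] at this
      rw [this, ← h2 1]
      congr 1
      rw [add_mul, mul_add, mul_add, hxx, hyy, hxy]
      abel
    have hAy : A * y * A = x := by
      rw [hconj]
      refine Eq.trans (congrArg _ ?_) (h2 x)
      have e : (x + y) * y * (x + y) = x * y * x + x * (y * y) + y * y * x + y * y * y := by
        noncomm_ring
      rw [e, hxyx, hyy, mul_one, one_mul, one_mul]
      abel
    have hAx : A * x * A = y := by
      rw [← hAy]
      calc A * (A * y * A) * A = (A * A) * y * (A * A) := by simp only [mul_assoc]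
        _ = y := by rw [hAA, one_mul, mul_one]
    refine ⟨A, hAh, isClifford_singleQubit (by rw [hAh, hAA]) fun q => ?_, hAy, hAx, hAA⟩
    rw [hAh]
    rcases label_cases_of_symp_z z q h1 with rfl | rfl | rfl | rfl
    · exact ⟨0, 1, by rw [sigma_zero, mul_one, hAA, one_smul]⟩
    · exact ⟨(0, 1), 1, by rw [← hx, hAx, one_smul]⟩
    · exact ⟨z, 1, by rw [← hy, hAy, one_smul]⟩
    · refine ⟨z + (0, 1), -1, ?_⟩
      have hp : mulPhase z (0, 1) ≠ 0 := phase_ne_zero (mulPhase_pow _ _)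
      have hxyq : sigma (z + (0, 1)) = (mulPhase z (0, 1))⁻¹ • (x * y) := by
        rw [hx, hy, sigma_mul, smul_smul, inv_mul_cancel₀ hp, one_smul]
      have hflip : A * (x * y) * A = -(x * y) := by
        calc A * (x * y) * A = A * x * (A * A) * y * A := by rw [hAA, mul_one]; simp only [mul_assoc]
          _ = (A * x * A) * (A * y * A) := by simp only [mul_assoc]
          _ = -(x * y) := by rw [hAx, hAy, hxy, neg_neg]
      have hs : ∀ (B M : Matrix (Fin 2) (Fin 2) ℂ) (d : ℂ), B * (d • M) * B = d • (B * M * B) :=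
        fun B M d => by rw [Matrix.mul_smul, Matrix.smul_mul]
      rw [hxyq, hs, hflip, neg_one_smul, smul_neg]

/-- A gate that preserves the span of the Pauli strings with letters in `{I, zᵢ}` preserves the span
of the `Z` operators up to a local Clifford gate. -/
lemma exists_localClifford {r : ℕ} {V : QOp (Fin r)} {z : Fin r → Label} (hz : ∀ i, z i ≠ 0)
    (h : ∀ a b : Fin r → Label, (∀ i, a i = 0 ∨ a i = z i) → coeff b (V * tau a * Vᴴ) ≠ 0 →
      ∀ i, b i = 0 ∨ b i = z i) :
    ∃ L : QOp (Fin r), IsLocalClifford L ∧ KeepsZSpan (Lᴴ * V * L) := by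
  choose A hAh hAC hAz hzA hAA using fun i => exists_clifford_axis (hz i)
  refine ⟨piTensor A, ⟨A, hAC, rfl⟩, keepsZSpan_of_tau fun m hm => ?_⟩
  have hL : (piTensor A)ᴴ = piTensor A := by
    rw [piTensor_conjTranspose]
    simp only [hAh]
  have hm' : ∀ i, m i = 0 ∨ m i = (0, 1) := fun i => by
    rcases zmod2_cases (m i).2 with h0 | h0
    · exact Or.inl (Prod.ext (hm i) h0)
    · exact Or.inr (Prod.ext (hm i) h0)
  have h1 : piTensor A * tau m * piTensor A = tau fun i => if m i = 0 then 0 else z i := by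
    rw [tau, piTensor_mul, piTensor_mul, tau]
    congr 1
    funext i
    rcases hm' i with h0 | h0 <;> rw [h0]
    · rw [if_pos rfl, sigma_zero, mul_one, hAA]
    · rw [if_neg (by decide), hAz]
  have h2 : ∀ b : Fin r → Label, (∀ i, b i = 0 ∨ b i = z i) →
      piTensor A * tau b * piTensor A ∈ zSpan (Fin r) := by
    intro b hb
    have : piTensor A * tau b * piTensor A = tau fun i => if b i = 0 then 0 else (0, 1) := by
      rw [tau, piTensor_mul, piTensor_mul, tau]
      congr 1
      funext i
      rcases hb i with h0 | h0 <;> rw [h0]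
      · rw [if_pos rfl, sigma_zero, mul_one, hAA]
      · rw [if_neg (hz i), hzA]
    rw [this]
    refine tau_mem_zSpan fun i => ?_
    split_ifs <;> rfl
  set a : Fin r → Label := fun i => if m i = 0 then 0 else z i with ha
  have h3 : (piTensor A)ᴴ * V * piTensor A * tau m * ((piTensor A)ᴴ * V * piTensor A)ᴴ =
      piTensor A * (V * tau a * Vᴴ) * piTensor A := by
    rw [Matrix.conjTranspose_mul, Matrix.conjTranspose_mul, hL, hL, ← h1]
    simp only [mul_assoc]
  rw [h3, ← sum_coeff_smul_tau (V * tau a * Vᴴ), Finset.mul_sum, Finset.sum_mul]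
  refine Submodule.sum_mem _ fun b _ => ?_
  rw [Matrix.mul_smul, Matrix.smul_mul]
  by_cases hb : coeff b (V * tau a * Vᴴ) = 0
  · rw [hb, zero_smul]; exact Submodule.zero_mem _
  · refine Submodule.smul_mem _ _ (h2 b (h a b (fun i => ?_) hb))
    simp only [ha]
    split_ifs
    · exact Or.inl rfl
    · exact Or.inr rfl

end LocalClifford

section LogicalGate

variable {n k r : ℕ} {S : Subgroup (unitaryGroup (Fin n → Fin 2) ℂ)}
  {E : Matrix (Fin n → Fin 2) (Fin k → Fin 2) ℂ} (F : PauliFrame S)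

lemma bigLabels_eq_smallLabels (h : ∀ j, F.big j = F.small j) : F.bigLabels = F.smallLabels := by
  rw [PauliFrame.bigLabels, PauliFrame.smallLabels, funext h]

/-- The axis of a logical qubit `s`: the nontrivial Pauli of `s` represented in `F.smallLabels` if
there is one, and otherwise any nontrivial restriction to `s` of a label represented there. -/
lemma exists_logical_axis (hS : IsStabilizer S) (hE : IsLogicalEncoding S E)
    (hF : ∀ j, F.big j = F.small j) (s : Fin k) :
    ∃ z : Label, z ≠ 0 ∧
      (∀ x, Pi.single s x ∈ logicalLabels S E F.smallLabels → x = 0 ∨ x = z) ∧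
      ∃ u ∈ logicalLabels S E F.smallLabels, u s = z := by
  by_cases hK : ∀ x, Pi.single s x ∈ logicalLabels S E F.smallLabels → x = 0
  · obtain ⟨u, hu, hus⟩ := exists_mem_big_apply_eq F hS hE hK (0, 1)
    rw [bigLabels_eq_smallLabels F hF] at hu
    exact ⟨(0, 1), by decide, fun x hx => Or.inl (hK x hx), u, hu, hus⟩
  · push Not at hK
    obtain ⟨z, hz, hz0⟩ := hK
    exact ⟨z, hz0, fun x hx => label_eq_of_symp z x hz0 (symp₁_eq_zero_of_single_mem F hE hx hz),
      _, hz, Pi.single_eq_same _ _⟩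

/-- With all physical qubits pure or with a preserved axis, the axes of the logical qubits are
preserved by `V`: it changes a label along these axes by single-qubit labels represented in
`F.smallLabels`, which lie on the axes as well. -/
theorem exists_localClifford_of_actsAs (hS : IsStabilizer S) (hE : IsLogicalEncoding S E)
    (hF : ∀ j, F.big j = F.small j) {U : Fin n → QOp (Fin r)} (hU : IsTransversal S U)
    {s : Fin r → Fin k} {V : QOp (Fin r)} (hV : ActsAs E U (gateOn (fun i => (i, s i)) V)) :
    ∃ L : QOp (Fin r), IsLocalClifford L ∧ KeepsZSpan (Lᴴ * V * L) := by
  choose z hz hzK u hu hus using fun i => exists_logical_axis F hS hE hF (s i)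
  refine exists_localClifford hz fun a b ha hb i => ?_
  have h1 := single_sub_mem_small F hS hE hU hV (a := a) (fun i => ?_) hb i
  · rcases hzK i _ h1 with h | h
    · rw [sub_eq_zero.1 h]; exact ha i
    · rcases ha i with h0 | h0
      · rw [h0, sub_zero] at h; exact Or.inr h
      · rw [h0, sub_eq_iff_eq_add, label_add_self] at h; exact Or.inl h
  · rcases ha i with h0 | h0
    · exact ⟨0, Submodule.zero_mem _, by rw [h0]; rfl⟩
    · exact ⟨u i, hu i, by rw [hus, h0]⟩

end LogicalGate

/-! ### Hadamard and Toffoli -/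

section HadamardToffoli

/-- The Hadamard gate exchanges `X` and `Z`. -/
lemma coeff_hadamard_ne_zero (q : Label) :
    coeff (fun _ => q.swap) (hadamardGate * tau (fun _ => q) * hadamardGateᴴ) ≠ 0 := by
  have h2 : (Real.sqrt 2 : ℂ) ≠ 0 := by
    rw [Complex.ofReal_ne_zero]; positivity
  rw [coeff, hadamardGate, tau, tau, piTensor_conjTranspose, piTensor_mul, piTensor_mul,
    piTensor_mul, trace_piTensor]
  refine mul_ne_zero (inv_ne_zero (pow_ne_zero _ two_ne_zero))
    (Finset.prod_ne_zero_iff.2 fun i _ => ?_)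
  rw [Matrix.conjTranspose_smul, Matrix.smul_mul, Matrix.mul_smul, Matrix.smul_mul,
    Matrix.mul_smul, Matrix.mul_smul, smul_smul, Matrix.trace_smul, smul_eq_mul]
  refine mul_ne_zero (mul_ne_zero (star_ne_zero.2 (inv_ne_zero h2)) (inv_ne_zero h2)) ?_
  have hh : (!![1, 1; 1, -1] : Matrix (Fin 2) (Fin 2) ℂ)ᴴ = !![1, 1; 1, -1] := by
    ext a b
    fin_cases a <;> fin_cases b <;> simp
  rw [hh]
  rcases label_cases q with rfl | rfl | rfl | rfl <;>
    simp [sigma, labelCode, pauliMat, Matrix.trace_fin_two, mul_add]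

/-- The permutation of basis states by the Toffoli gate. -/
def toffoliPerm (x : Fin 3 → Fin 2) : Fin 3 → Fin 2 := ![x 0, x 1, x 2 + x 0 * x 1]

lemma toffoliPerm_toffoliPerm : ∀ x, toffoliPerm (toffoliPerm x) = x := by decide

lemma toffoli_conj_apply (M : QOp (Fin 3)) (x y : Fin 3 → Fin 2) :
    (toffoliGate * M * toffoliGateᴴ) x y = M (toffoliPerm x) (toffoliPerm y) := by
  have h : ∀ x y, toffoliGate x y = if y = toffoliPerm x then 1 else 0 := fun x y => by
    rw [toffoliGate, Matrix.of_apply]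
    refine if_congr ⟨fun h => ?_, fun h => ?_⟩ rfl rfl
    · rw [h]; exact (toffoliPerm_toffoliPerm y).symm
    · rw [h]; exact (toffoliPerm_toffoliPerm x).symm
  simp [Matrix.mul_apply, Matrix.conjTranspose_apply, h, apply_ite]

lemma sum_threeBits {M : Type} [AddCommMonoid M] (f : (Fin 3 → Fin 2) → M) :
    ∑ x, f x = ∑ a : Fin 2, ∑ b : Fin 2, ∑ c : Fin 2, f ![a, b, c] := by
  have h : Function.Bijective fun x : Fin 2 × Fin 2 × Fin 2 => ![x.1, x.2.1, x.2.2] := by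
    decide
  rw [← h.sum_comp, Fintype.sum_prod_type]
  simp only [Fintype.sum_prod_type]

/-- Conjugation by the Toffoli gate multiplies `Y` on the target by the controlled `Z` gate of the
controls, whose Pauli expansion contains both `I` and `Z` on the first control. -/
lemma coeff_toffoli_ne_zero (q : Label) (hq : q = (0, 0) ∨ q = (0, 1)) :
    coeff ![q, 0, (1, 1)] (toffoliGate * tau ![0, 0, (1, 1)] * toffoliGateᴴ) ≠ 0 := by
  refine mul_ne_zero (inv_ne_zero (pow_ne_zero _ two_ne_zero)) ?_
  have h : (1 + 1 : Fin 2) = 0 := rfl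
  have hN := toffoli_conj_apply (tau ![0, 0, (1, 1)])
  generalize toffoliGate * tau ![0, 0, (1, 1)] * toffoliGateᴴ = N at hN ⊢
  simp only [Matrix.trace, Matrix.diag_apply, Matrix.mul_apply, hN]
  rcases hq with rfl | rfl <;>
    simp [sum_threeBits, toffoliPerm, tau, piTensor_apply, Fin.prod_univ_three, sigma, labelCode,
      pauliMat, Fin.sum_univ_two, Matrix.one_apply, h]

lemma label_eq_y : ∀ x : Label, x ≠ 0 → symp₁ x x.swap = 0 → x = (1, 1) := by decide

variable {n k : ℕ} {S : Subgroup (unitaryGroup (Fin n → Fin 2) ℂ)}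
  {E : Matrix (Fin n → Fin 2) (Fin k → Fin 2) ℂ}

theorem not_hadamard_and_toffoli (F : PauliFrame S) (hS : IsStabilizer S)
    (hE : IsLogicalEncoding S E) (s : Fin k) :
    ¬ (GateIsTransversal S E s hadamardGate ∧ GateIsTransversal S E s toffoliGate) := by
  rintro ⟨⟨U, hU, hUW⟩, U', hU', hUW'⟩
  have hT0 := coeff_toffoli_ne_zero (0, 0) (Or.inl rfl)
  have hTz := coeff_toffoli_ne_zero (0, 1) (Or.inr rfl)
  by_cases hK : ∀ x, Pi.single s x ∈ logicalLabels S E F.smallLabels → x = 0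
  · -- Every logical Pauli of `s` extends to `F.bigLabels`, so the Toffoli gate would be Clifford.
    have h1 := single_sub_mem_small_of_big F hS hE hU' hUW'
      (fun i => exists_mem_big_apply_eq F hS hE hK _) hTz hT0 0
    exact absurd (hK _ h1) (by decide)
  · -- The Hadamard gate forces the axis of `s` to be `Y`, which the Toffoli gate does not preserve.
    push Not at hK
    obtain ⟨x, hx, hx0⟩ := hK
    have h1 := single_sub_mem_small F hS hE hU hUW (a := fun _ => x) (fun _ => ⟨_, hx, by simp⟩)
      (coeff_hadamard_ne_zero x) 0
    have h2 : Pi.single s x.swap ∈ logicalLabels S E F.smallLabels := by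
      have := Submodule.add_mem _ h1 hx
      rwa [← Pi.single_add, sub_add_cancel] at this
    obtain rfl := label_eq_y x hx0 (symp₁_eq_zero_of_single_mem F hE hx h2)
    have h3 := single_sub_mem_small F hS hE hU' hUW' (a := ![0, 0, (1, 1)]) (fun i => by
      fin_cases i
      · exact ⟨0, Submodule.zero_mem _, rfl⟩
      · exact ⟨0, Submodule.zero_mem _, rfl⟩
      · exact ⟨_, hx, by simp⟩) hTz 0
    exact absurd (symp₁_eq_zero_of_single_mem F hE hx h3) (by decide)

end HadamardToffoli

/-! ### Construction of logical Pauli operators -/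

section Eigenvectors

variable {ι : Type} [Fintype ι] [DecidableEq ι]

/-- Commuting Pauli strings that commute with a nonzero idempotent `R` have a joint eigenvector in
the range of `R`: given an eigenvector `ψ` of the others, either `ψ + τψ` is one, or `τψ = -ψ`. -/
lemma exists_joint_eigenvector {R : QOp ι} (hR : R * R = R) (hR0 : R ≠ 0)
    (s : Finset (ι → Label)) (hcomm : ∀ v ∈ s, tau v * R = R * tau v)
    (hiso : ∀ u ∈ s, ∀ v ∈ s, symp u v = 0) :
    ∃ ψ : (ι → Fin 2) → ℂ, ψ ≠ 0 ∧ R *ᵥ ψ = ψ ∧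
      ∀ v ∈ s, ∃ ε : ℂ, (ε = 1 ∨ ε = -1) ∧ tau v *ᵥ ψ = ε • ψ := by
  induction s using Finset.induction_on with
  | empty =>
    have h : ∃ φ : (ι → Fin 2) → ℂ, R *ᵥ φ ≠ 0 := by
      by_contra! h
      exact hR0 (Matrix.ext_of_mulVec_single fun j => by rw [h, Matrix.zero_mulVec])
    obtain ⟨φ, hφ⟩ := h
    exact ⟨R *ᵥ φ, hφ, by rw [Matrix.mulVec_mulVec, hR], by simp⟩
  | insert a s ha ih =>
    obtain ⟨ψ, hψ0, hRψ, hψ⟩ := ih (fun v hv => hcomm v (Finset.mem_insert_of_mem hv))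
      (fun u hu v hv => hiso u (Finset.mem_insert_of_mem hu) v (Finset.mem_insert_of_mem hv))
    by_cases h : ψ + tau a *ᵥ ψ = 0
    · refine ⟨ψ, hψ0, hRψ, fun v hv => ?_⟩
      rcases Finset.mem_insert.1 hv with rfl | hv
      · exact ⟨-1, Or.inr rfl, by rw [neg_one_smul]; exact eq_neg_of_add_eq_zero_right h⟩
      · exact hψ v hv
    · refine ⟨ψ + tau a *ᵥ ψ, h, ?_, fun v hv => ?_⟩
      · rw [Matrix.mulVec_add, hRψ, Matrix.mulVec_mulVec, ← hcomm a (Finset.mem_insert_self _ _),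
          ← Matrix.mulVec_mulVec, hRψ]
      · rcases Finset.mem_insert.1 hv with rfl | hv'
        · refine ⟨1, Or.inl rfl, ?_⟩
          rw [Matrix.mulVec_add, Matrix.mulVec_mulVec, tau_mul_self, Matrix.one_mulVec, one_smul,
            add_comm]
        · obtain ⟨ε, hε, he⟩ := hψ v hv'
          refine ⟨ε, hε, ?_⟩
          rw [Matrix.mulVec_add, Matrix.mulVec_mulVec,
            tau_comm_of_symp_eq_zero (hiso v hv a (Finset.mem_insert_self _ _)),
            ← Matrix.mulVec_mulVec, he, Matrix.mulVec_smul, smul_add]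

/-- Pauli strings with labels in an isotropic space have signs that make them a representation of
that space: the eigenvalues at a joint eigenvector, which is then fixed. -/
lemma exists_signs {R : QOp ι} (hR : R * R = R) (hR0 : R ≠ 0)
    (N : Submodule (ZMod 2) (ι → Label)) (hcomm : ∀ v ∈ N, tau v * R = R * tau v)
    (hiso : ∀ u ∈ N, ∀ v ∈ N, symp u v = 0) :
    ∃ (ψ : (ι → Fin 2) → ℂ) (ε : (ι → Label) → ℂ), ψ ≠ 0 ∧ R *ᵥ ψ = ψ ∧
      (∀ v, ε v = 1 ∨ ε v = -1) ∧ (∀ v ∈ N, (ε v • tau v) *ᵥ ψ = ψ) ∧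
      ∀ u ∈ N, ∀ v ∈ N, (ε u • tau u) * (ε v • tau v) = ε (u + v) • tau (u + v) := by
  classical
  obtain ⟨ψ, hψ0, hRψ, hψ⟩ := exists_joint_eigenvector hR hR0 (Finset.univ.filter (· ∈ N))
    (fun v hv => hcomm v (Finset.mem_filter.1 hv).2)
    (fun u hu v hv => hiso u (Finset.mem_filter.1 hu).2 v (Finset.mem_filter.1 hv).2)
  have h1 : ∀ v, ∃ ε : ℂ, (ε = 1 ∨ ε = -1) ∧ (v ∈ N → tau v *ᵥ ψ = ε • ψ) := fun v => by
    by_cases hv : v ∈ N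
    · obtain ⟨ε, hε, he⟩ := hψ v (Finset.mem_filter.2 ⟨Finset.mem_univ _, hv⟩)
      exact ⟨ε, hε, fun _ => he⟩
    · exact ⟨1, Or.inl rfl, fun h => absurd h hv⟩
  choose ε hε he using h1
  have hεε : ∀ v, ε v * ε v = 1 := fun v => by rcases hε v with h | h <;> rw [h] <;> norm_num
  have hfix : ∀ v ∈ N, (ε v • tau v) *ᵥ ψ = ψ := fun v hv => by
    rw [Matrix.smul_mulVec, he v hv, smul_smul, hεε, one_smul]
  refine ⟨ψ, ε, hψ0, hRψ, hε, hfix, fun u hu v hv => ?_⟩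
  obtain ⟨c, -, hc⟩ := exists_tau_mul u v
  have h2 : (ε u • tau u) * (ε v • tau v) = (ε u * ε v * c) • tau (u + v) := by
    rw [smul_mul_smul_comm, hc, smul_smul]
  have h3 : ((ε u • tau u) * (ε v • tau v)) *ᵥ ψ = ψ := by
    rw [← Matrix.mulVec_mulVec, hfix v hv, hfix u hu]
  rw [h2, Matrix.smul_mulVec, he _ (N.add_mem hu hv), smul_smul] at h3
  have h4 : ε u * ε v * c * ε (u + v) = 1 :=
    smul_left_injective ℂ hψ0 (h3.trans (one_smul ℂ ψ).symm)
  rw [h2]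
  congr 1
  linear_combination ε (u + v) * h4 - ε u * ε v * c * hεε (u + v)

end Eigenvectors

section Encoding

variable {n : ℕ} {S : Subgroup (unitaryGroup (Fin n → Fin 2) ℂ)}

/-- A symplectic basis for the logical labels: `ℓz` parametrizes a complement of the stabilizer
labels in their sum with an isotropic space `N`, and `ℓx` a commuting dual system. -/
lemma exists_symplectic_basis {N : Submodule (ZMod 2) (Fin n → Label)}
    (hN : N ≤ perp (stabLabels S)) (hiso : ∀ u ∈ N, ∀ v ∈ N, symp u v = 0) :
    ∃ (k : ℕ) (ℓz ℓx : (Fin k → ZMod 2) →ₗ[ZMod 2] (Fin n → Label)),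
      (∀ a, ℓz a ∈ N) ∧ (∀ g ∈ N, ∃ s ∈ stabLabels S, ∃ a, g = s + ℓz a) ∧
      (∀ a, ℓx a ∈ perp (stabLabels S)) ∧ (∀ a b, symp (ℓx a) (ℓz b) = ∑ l, a l * b l) ∧
      ∀ a b, symp (ℓx a) (ℓx b) = 0 := by
  obtain ⟨C', hC'⟩ := Submodule.exists_isCompl (stabLabels S ⊓ N)
  set C := C' ⊓ N with hC
  set bas := Module.finBasis (ZMod 2) C
  set k := Module.finrank (ZMod 2) C
  set ℓz : (Fin k → ZMod 2) →ₗ[ZMod 2] (Fin n → Label) :=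
    C.subtype ∘ₗ bas.equivFun.symm.toLinearMap with hℓz
  have hzC : ∀ a, ℓz a ∈ C := fun a => (bas.equivFun.symm a).2
  have hzN : ∀ a, ℓz a ∈ N := fun a => (hzC a).2
  have hzsurj : ∀ c ∈ C, ∃ a, ℓz a = c := fun c hc =>
    ⟨bas.equivFun ⟨c, hc⟩, by simp [hℓz]⟩
  have hdecomp : ∀ g ∈ N, ∃ s ∈ stabLabels S, ∃ a, g = s + ℓz a := by
    intro g hg
    have : g ∈ (stabLabels S ⊓ N) ⊔ C' := by rw [hC'.sup_eq_top]; trivial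
    obtain ⟨s, hs, c, hc, rfl⟩ := Submodule.mem_sup.1 this
    have hcN : c ∈ N := by simpa using N.sub_mem hg hs.2
    obtain ⟨a, ha⟩ := hzsurj c ⟨hc, hcN⟩
    exact ⟨s, hs.1, a, by rw [ha]⟩
  have hinj : LinearMap.ker ((stabLabels S).mkQ ∘ₗ ℓz) = ⊥ := by
    rw [LinearMap.ker_eq_bot']
    intro a ha
    have h1 : ℓz a ∈ stabLabels S := by simpa using ha
    have h2 : ℓz a ∈ (stabLabels S ⊓ N) ⊓ C' := ⟨⟨h1, hzN a⟩, (hzC a).1⟩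
    rw [hC'.inf_eq_bot, Submodule.mem_bot] at h2
    have h3 : bas.equivFun.symm a = 0 := Subtype.ext h2
    simpa only [LinearEquiv.apply_symm_apply, map_zero] using congrArg bas.equivFun h3
  obtain ⟨f, hf⟩ := LinearMap.exists_leftInverse_of_injective _ hinj
  have hfz : ∀ a, f ((stabLabels S).mkQ (ℓz a)) = a := fun a => LinearMap.congr_fun hf a
  choose y hy using fun l : Fin k =>
    exists_symp_eq ((LinearMap.proj l ∘ₗ f) ∘ₗ (stabLabels S).mkQ)
  have hyz : ∀ l a, symp (y l) (ℓz a) = a l := fun l a => by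
    rw [hy]; exact congrFun (hfz a) l
  have hyS : ∀ l, y l ∈ perp (stabLabels S) := fun l s hs => by
    rw [hy]
    have : (stabLabels S).mkQ s = 0 := by simpa using hs
    rw [LinearMap.comp_apply, this, map_zero]
  have hzz : ∀ a b, symp (ℓz a) (ℓz b) = 0 := fun a b => hiso _ (hzN a) _ (hzN b)
  -- Triangular corrections make the dual system commute.
  set d : Fin k → Fin k → ZMod 2 := fun l m => if m < l then symp (y l) (y m) else 0 with hd
  set x : Fin k → Fin n → Label := fun l => y l + ℓz (d l) with hx
  have hxx : ∀ l m, symp (x l) (x m) = 0 := fun l m => by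
    have h1 : symp (x l) (x m) = symp (y l) (y m) + d m l + d l m := by
      simp only [hx, symp_add_left, symp_add_right, hyz, hzz]
      rw [symp_comm (ℓz _), hyz]
      ring
    rw [h1]
    rcases lt_trichotomy l m with h | rfl | h
    · simp only [hd, h, if_true, if_neg h.not_gt]
      rw [symp_comm (y m), label_add_self, zero_add]
    · simp [hd, symp_self]
    · simp only [hd, h, if_true, if_neg h.not_gt]
      rw [add_zero, label_add_self]
  refine ⟨k, ℓz, Fintype.linearCombination (ZMod 2) x, hzN, hdecomp, fun a => ?_, fun a b => ?_,
    fun a b => ?_⟩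
  · rw [Fintype.linearCombination_apply]
    exact Submodule.sum_mem _ fun l _ => Submodule.smul_mem _ _
      (Submodule.add_mem _ (hyS l) (hN (hzN _)))
  · simp only [Fintype.linearCombination_apply, symp_sum_left, symp_smul_left, hx, symp_add_left,
      hyz, hzz, add_zero]
  · simp only [Fintype.linearCombination_apply, symp_sum_left, symp_sum_right, symp_smul_left,
      symp_smul_right, hxx, mul_zero, Finset.sum_const_zero]

lemma tau_apply {ι : Type} [Fintype ι] (u : ι → Label) (x y : ι → Fin 2) :
    tau u x y = if (fun l => bit (x l)) = (fun l => bit (y l)) + fun l => (u l).1 then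
      (∏ l, yPhase (u l)) * sgn (∑ l, (u l).2 * bit (y l)) else 0 := by
  classical
  simp only [tau, piTensor_apply, sigma_apply]
  rw [Finset.prod_ite_zero, Finset.prod_mul_distrib, sgn_sum]
  simp [funext_iff]

/-- The data from which an encoding map is built: commuting families of signed logical Pauli
operators and a unit vector `ψ` of the code fixed by the `Z` family. -/
structure EncodingData (S : Subgroup (unitaryGroup (Fin n → Fin 2) ℂ)) (k : ℕ) where
  ℓz : (Fin k → ZMod 2) →ₗ[ZMod 2] (Fin n → Label)
  ℓx : (Fin k → ZMod 2) →ₗ[ZMod 2] (Fin n → Label)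
  perp_z : ∀ a, ℓz a ∈ perp (stabLabels S)
  perp_x : ∀ a, ℓx a ∈ perp (stabLabels S)
  symp_xz : ∀ a b, symp (ℓx a) (ℓz b) = ∑ l, a l * b l
  maximal : ∀ v ∈ perp (stabLabels S), (∀ a, symp v (ℓz a) = 0) →
    ∃ s ∈ stabLabels S, ∃ a, v = s + ℓz a
  εz : (Fin k → ZMod 2) → ℂ
  εx : (Fin k → ZMod 2) → ℂ
  sign_z : ∀ a, εz a = 1 ∨ εz a = -1
  sign_x : ∀ a, εx a = 1 ∨ εx a = -1
  mul_x : ∀ a b, (εx a • tau (ℓx a)) * (εx b • tau (ℓx b)) = εx (a + b) • tau (ℓx (a + b))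
  ψ : (Fin n → Fin 2) → ℂ
  unit : star ψ ⬝ᵥ ψ = 1
  code : codeProjector S *ᵥ ψ = ψ
  fixed : ∀ a, (εz a • tau (ℓz a)) *ᵥ ψ = ψ

lemma exists_encodingData (hS : IsStabilizer S) {N : Submodule (ZMod 2) (Fin n → Label)}
    (hN : N ≤ perp (stabLabels S)) (hiso : ∀ u ∈ N, ∀ v ∈ N, symp u v = 0)
    (hmax : ∀ v ∈ perp (stabLabels S), v ∈ perp N → ∃ s ∈ stabLabels S, ∃ g ∈ N, v = s + g) :
    ∃ (k : ℕ) (D : EncodingData S k), ∀ a, D.ℓz a ∈ N := by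
  obtain ⟨k, ℓz, ℓx, hzN, hdecomp, hxS, hxz, hxx⟩ := exists_symplectic_basis hN hiso
  obtain ⟨ψ, ε, hψ0, hPψ, hε, hfix, -⟩ := exists_signs (codeProjector_mul_self hS)
    (codeProjector_ne_zero hS) N (fun v hv => tau_mul_codeProjector_comm hS (hN hv)) hiso
  obtain ⟨-, ε', -, -, hε', -, hmul⟩ := exists_signs (R := (1 : QOp (Fin n))) (one_mul 1)
    one_ne_zero (LinearMap.range ℓx) (fun v _ => by rw [mul_one, one_mul])
    (by rintro _ ⟨a, rfl⟩ _ ⟨b, rfl⟩; exact hxx a b)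
  obtain ⟨t, ht⟩ : ∃ t : ℝ, star ψ ⬝ᵥ ψ = t ∧ 0 < t := by
    refine ⟨∑ i, Complex.normSq (ψ i), ?_, ?_⟩
    · rw [Complex.ofReal_sum]
      exact Finset.sum_congr rfl fun i _ => (Complex.normSq_eq_conj_mul_self).symm
    · obtain ⟨i, hi⟩ := Function.ne_iff.1 hψ0
      exact Finset.sum_pos' (fun i _ => Complex.normSq_nonneg _)
        ⟨i, Finset.mem_univ _, Complex.normSq_pos.2 hi⟩
  set c : ℂ := (((Real.sqrt t)⁻¹ : ℝ) : ℂ) with hc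
  have hcc : star c * c * (t : ℂ) = 1 := by
    rw [hc, Complex.star_def, Complex.conj_ofReal, ← Complex.ofReal_mul, ← Complex.ofReal_mul,
      ← mul_inv, Real.mul_self_sqrt ht.2.le, inv_mul_cancel₀ ht.2.ne', Complex.ofReal_one]
  refine ⟨k, ⟨ℓz, ℓx, fun a => hN (hzN a), hxS, hxz, fun v hv hvz => ?_, fun a => ε (ℓz a),
    fun a => ε' (ℓx a), fun a => hε _, fun a => hε' _, fun a b => ?_, c • ψ, ?_, ?_, fun a => ?_⟩,
    hzN⟩
  · obtain ⟨s, hs, g, hg, rfl⟩ := hmax v hv fun g hg => by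
      obtain ⟨s, hs, a, rfl⟩ := hdecomp g hg
      rw [symp_add_right, hv s hs, hvz, add_zero]
    obtain ⟨s', hs', a, rfl⟩ := hdecomp g hg
    exact ⟨s + s', Submodule.add_mem _ hs hs', a, by rw [add_assoc]⟩
  · rw [hmul _ ⟨a, rfl⟩ _ ⟨b, rfl⟩, map_add]
  · rw [star_smul, smul_dotProduct, dotProduct_smul, ht.1, smul_eq_mul, smul_eq_mul, ← mul_assoc,
      hcc]
  · rw [Matrix.mulVec_smul, hPψ]
  · rw [Matrix.mulVec_smul, hfix _ (hzN a)]

namespace EncodingData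

variable {k : ℕ} (D : EncodingData S k)

/-- The signed logical `X` operators. -/
noncomputable def X (a : Fin k → ZMod 2) : QOp (Fin n) := D.εx a • tau (D.ℓx a)

/-- The signed logical `Z` operators. -/
noncomputable def Z (a : Fin k → ZMod 2) : QOp (Fin n) := D.εz a • tau (D.ℓz a)

/-- The encoding map `|y⟩ ↦ X(y)ψ`. -/
noncomputable def encoding : Matrix (Fin n → Fin 2) (Fin k → Fin 2) ℂ :=
  Matrix.of fun x y => (D.X (fun l => bit (y l)) *ᵥ D.ψ) x

lemma X_mul (a b : Fin k → ZMod 2) : D.X a * D.X b = D.X (a + b) := D.mul_x a b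

lemma X_conjTranspose (a : Fin k → ZMod 2) : (D.X a)ᴴ = D.X a := by
  rw [X, Matrix.conjTranspose_smul, tau_conjTranspose]
  rcases D.sign_x a with h | h <;> rw [h] <;> simp

lemma Z_conjTranspose (a : Fin k → ZMod 2) : (D.Z a)ᴴ = D.Z a := by
  rw [Z, Matrix.conjTranspose_smul, tau_conjTranspose]
  rcases D.sign_z a with h | h <;> rw [h] <;> simp

lemma Z_mulVec (a : Fin k → ZMod 2) : D.Z a *ᵥ D.ψ = D.ψ := D.fixed a

lemma Z_mul_X (a b : Fin k → ZMod 2) :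
    D.Z a * D.X b = sgn (∑ l, a l * b l) • (D.X b * D.Z a) := by
  rw [Z, X, smul_mul_smul_comm, smul_mul_smul_comm, tau_comm, symp_comm, D.symp_xz, smul_smul,
    smul_smul]
  simp only [mul_comm]

lemma X_zero : D.X 0 = 1 := by
  have h1 : D.X 0 * D.X 0 = D.X 0 := by rw [X_mul, add_zero]
  have h2 : D.X 0 * D.X 0 = 1 := by
    rw [X, smul_mul_smul_comm, tau_mul_self]
    rcases D.sign_x 0 with h | h <;> rw [h] <;> simp
  rw [← h1, h2]

lemma dotProduct_X_mulVec {a : Fin k → ZMod 2} (ha : a ≠ 0) :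
    star D.ψ ⬝ᵥ (D.X a *ᵥ D.ψ) = 0 := by
  obtain ⟨l, hl⟩ := Function.ne_iff.1 ha
  have hl1 : a l = 1 := (zmod2_cases _).resolve_left hl
  have hZX : D.Z (Pi.single l 1) * D.X a = -(D.X a * D.Z (Pi.single l 1)) := by
    rw [Z_mul_X, Finset.sum_eq_single l]
    · rw [Pi.single_eq_same, hl1, one_mul, sgn_one, neg_one_smul]
    · intro m _ hm; rw [Pi.single_eq_of_ne hm, zero_mul]
    · simp
  have h1 : star D.ψ ⬝ᵥ (D.X a *ᵥ D.ψ) = -(star D.ψ ⬝ᵥ (D.X a *ᵥ D.ψ)) := by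
    nth_rewrite 1 [← D.Z_mulVec (Pi.single l 1)]
    rw [Matrix.star_mulVec, ← Matrix.dotProduct_mulVec, Z_conjTranspose, Matrix.mulVec_mulVec, hZX,
      Matrix.neg_mulVec, ← Matrix.mulVec_mulVec, Z_mulVec, dotProduct_neg]
  exact self_eq_neg.1 h1

lemma mul_encoding (A : QOp (Fin n)) : A * D.encoding =
    Matrix.of fun x y => ((A * D.X fun l => bit (y l)) *ᵥ D.ψ) x := by
  ext x y
  rw [Matrix.of_apply, ← Matrix.mulVec_mulVec]
  rfl

lemma encoding_isometry : D.encodingᴴ * D.encoding = 1 := by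
  ext y y'
  have h1 : (D.encodingᴴ * D.encoding) y y' =
      star (D.X (fun l => bit (y l)) *ᵥ D.ψ) ⬝ᵥ (D.X (fun l => bit (y' l)) *ᵥ D.ψ) := rfl
  rw [h1, Matrix.star_mulVec, ← Matrix.dotProduct_mulVec, Matrix.mulVec_mulVec, X_conjTranspose,
    X_mul, Matrix.one_apply]
  split_ifs with h
  · rw [h, label_add_self, X_zero, Matrix.one_mulVec, D.unit]
  · refine D.dotProduct_X_mulVec fun h0 => h ?_
    rw [← label_sub, sub_eq_zero] at h0
    exact funext fun l => bit_bijective.1 (congrFun h0 l)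

/-- The logical Pauli string with label `u` is implemented by the corresponding product of signed
logical operators. -/
lemma mul_encoding_eq (u : Fin k → Label) :
    ((∏ l, yPhase (u l)) • (D.X (fun l => (u l).1) * D.Z fun l => (u l).2)) * D.encoding =
      D.encoding * tau u := by
  rw [mul_encoding]
  ext x y
  obtain ⟨y', hy'⟩ : ∃ y' : Fin k → Fin 2,
      (fun l => bit (y' l)) = (fun l => bit (y l)) + fun l => (u l).1 := by
    choose y' hy' using fun l => bit_bijective.2 (bit (y l) + (u l).1)
    exact ⟨y', funext hy'⟩
  rw [Matrix.mul_apply, Finset.sum_eq_single y', tau_apply, if_pos hy', Matrix.of_apply]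
  · rw [encoding, Matrix.of_apply, hy', Matrix.smul_mul, Matrix.mul_assoc, Z_mul_X,
      Matrix.mul_smul, ← Matrix.mul_assoc, X_mul, smul_smul, Matrix.smul_mulVec,
      ← Matrix.mulVec_mulVec, Z_mulVec, Pi.smul_apply, smul_eq_mul, mul_comm, add_comm]
  · intro y'' _ hne
    rw [tau_apply, if_neg, mul_zero]
    intro h
    exact hne (funext fun l => bit_bijective.1 (congrFun (h.trans hy'.symm) l))
  · simp

lemma codeProjector_mul_encoding (hS : IsStabilizer S) :
    codeProjector S * D.encoding = D.encoding := by
  rw [mul_encoding]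
  ext x y
  rw [Matrix.of_apply, encoding, Matrix.of_apply, X, Matrix.mul_smul,
    ← tau_mul_codeProjector_comm hS (D.perp_x _), ← Matrix.smul_mul, ← Matrix.mulVec_mulVec, D.code]

/-- The product implementing the logical Pauli string `u` is itself a Pauli operator. -/
lemma exists_phase_mul (u : Fin k → Label) : ∃ c : ℂ, c ^ 4 = 1 ∧
    (∏ l, yPhase (u l)) • (D.X (fun l => (u l).1) * D.Z fun l => (u l).2) =
      c • tau (D.ℓx (fun l => (u l).1) + D.ℓz fun l => (u l).2) := by
  obtain ⟨c, hc, hcm⟩ := exists_tau_mul (D.ℓx fun l => (u l).1) (D.ℓz fun l => (u l).2)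
  have hs : ∀ e : ℂ, e = 1 ∨ e = -1 → e ^ 4 = 1 := by rintro e (rfl | rfl) <;> norm_num
  refine ⟨(∏ l, yPhase (u l)) * (D.εx (fun l => (u l).1) * D.εz (fun l => (u l).2) * c), ?_, ?_⟩
  · rw [mul_pow, mul_pow, mul_pow, hc, hs _ (D.sign_x _), hs _ (D.sign_z _), ← Finset.prod_pow]
    simp [yPhase_pow]
  · rw [X, Z, smul_mul_smul_comm, hcm, smul_smul, smul_smul, mul_assoc]

lemma represents (u : Fin k → Label) :
    Represents S D.encoding u (D.ℓx (fun l => (u l).1) + D.ℓz fun l => (u l).2) := by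
  obtain ⟨c, hc, h⟩ := D.exists_phase_mul u
  have hc0 := phase_ne_zero hc
  refine ⟨Submodule.add_mem _ (D.perp_x _) (D.perp_z _), c⁻¹, inv_ne_zero hc0, ?_⟩
  rw [← mul_encoding_eq, h, Matrix.smul_mul, smul_smul, inv_mul_cancel₀ hc0, one_smul]

end EncodingData

/-- The range projector of a map under which a physical Pauli string implements a logical one
commutes with that string. -/
lemma tau_mul_range_comm {k : ℕ} {E : Matrix (Fin n → Fin 2) (Fin k → Fin 2) ℂ} (hE : E ≠ 0)
    {w : Fin n → Label} {u : Fin k → Label} {c : ℂ} (h : tau w * E = c • (E * tau u)) :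
    tau w * (E * Eᴴ) = E * Eᴴ * tau w := by
  have hcc : c * c = 1 := by
    have h1 : tau w * (tau w * E) = (c * c) • E := by
      rw [h, Matrix.mul_smul, ← Matrix.mul_assoc, h, Matrix.smul_mul, smul_smul, Matrix.mul_assoc,
        tau_mul_self, Matrix.mul_one]
    rw [← Matrix.mul_assoc, tau_mul_self, Matrix.one_mul] at h1
    exact smul_left_injective ℂ hE (h1.symm.trans (one_smul ℂ E).symm)
  have hc : star c = c := by
    rcases mul_self_eq_one_iff.1 hcc with rfl | rfl <;> simp
  have h2 : Eᴴ * tau w = c • (tau u * Eᴴ) := by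
    have := congrArg Matrix.conjTranspose h
    rwa [Matrix.conjTranspose_mul, Matrix.conjTranspose_smul, Matrix.conjTranspose_mul,
      tau_conjTranspose, tau_conjTranspose, hc] at this
  rw [← Matrix.mul_assoc, h, Matrix.mul_assoc, h2, Matrix.smul_mul, Matrix.mul_smul,
    Matrix.mul_assoc]

/-- If a stabilizer element fixes `Q`, the Pauli coefficient of `Q` at its label is determined by
the coefficient at the identity. -/
lemma coeff_eq_of_stab_mul {g : unitaryGroup (Fin n → Fin 2) ℂ} {c : ℂ} {v : Fin n → Label}
    (hc : c = 1 ∨ c = -1) (hg : (g : QOp (Fin n)) = c • tau v) {Q : QOp (Fin n)}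
    (hQ : (g : QOp (Fin n)) * Q = Q) : coeff v Q = c * coeff 0 Q := by
  have hcc : c * c = 1 := by rcases hc with rfl | rfl <;> norm_num
  have : tau v * Q = c • Q := by
    conv_rhs => rw [← hQ, hg, Matrix.smul_mul, smul_smul, hcc, one_smul]
  rw [coeff, this, Matrix.trace_smul, coeff, tau_zero, Matrix.one_mul, smul_eq_mul]
  ring

/-- The range of the encoding map is the code: its projector has only stabilizer elements in its
Pauli expansion, with the coefficients of the code projector up to a factor. -/
lemma EncodingData.encoding_range (hS : IsStabilizer S) {k : ℕ} (D : EncodingData S k) :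
    D.encoding * D.encodingᴴ = codeProjector S := by
  set E := D.encoding with hEdef
  set Q := E * Eᴴ with hQdef
  have hiso : Eᴴ * E = 1 := D.encoding_isometry
  have hE0 : E ≠ 0 := fun h => by
    rw [h, Matrix.mul_zero] at hiso
    exact zero_ne_one hiso
  have hQQ : Q * Q = Q := by
    rw [hQdef, Matrix.mul_assoc, ← Matrix.mul_assoc Eᴴ, hiso, Matrix.one_mul]
  have hQ0 : Q ≠ 0 := fun h => hE0 (by
    rw [← Matrix.mul_one E, ← hiso, ← Matrix.mul_assoc, ← hQdef, h, Matrix.zero_mul])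
  have hPE : codeProjector S * E = E := D.codeProjector_mul_encoding hS
  have hgE : ∀ g ∈ S, (g : QOp (Fin n)) * E = E := fun g hg => by
    conv_lhs => rw [← hPE, ← Matrix.mul_assoc, stab_mul_codeProjector hS hg]
    exact hPE
  have hgQ : ∀ g ∈ S, (g : QOp (Fin n)) * Q = Q := fun g hg => by
    rw [hQdef, ← Matrix.mul_assoc, hgE g hg]
  have hcomm : ∀ {v w : Fin n → Label}, coeff v Q ≠ 0 → tau w * Q = Q * tau w → symp v w = 0 := by
    intro v w hv h
    refine sgn_injective ?_
    rw [sgn_zero]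
    exact sgn_symp_of_coeff_ne_zero (by rw [one_smul, h]) hv
  have hsupp : ∀ v, coeff v Q ≠ 0 → v ∈ stabLabels S := by
    intro v hv
    have hrep : ∀ u : Fin k → Label,
        symp v (D.ℓx (fun l => (u l).1) + D.ℓz fun l => (u l).2) = 0 := fun u => by
      obtain ⟨-, c, -, hc⟩ := D.represents u
      exact hcomm hv (tau_mul_range_comm hE0 hc)
    have hz : ∀ a, symp v (D.ℓz a) = 0 := fun a => by
      have := hrep fun l => (0, a l)
      simpa [← Pi.zero_def] using this
    have hx : ∀ a, symp v (D.ℓx a) = 0 := fun a => by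
      have := hrep fun l => (a l, 0)
      simpa [← Pi.zero_def] using this
    have hs : v ∈ perp (stabLabels S) := by
      rintro s ⟨g, hg, c, hc⟩
      have hcs := phase_of_mem hS hg hc
      have hcc : c * c = 1 := by rcases hcs with rfl | rfl <;> norm_num
      refine hcomm hv (tau_mul_range_comm (u := 0) (c := c) hE0 ?_)
      rw [tau_zero, Matrix.mul_one]
      conv_rhs => rw [← hgE g hg, hc, Matrix.smul_mul, smul_smul, hcc, one_smul]
    obtain ⟨s, hs', a, rfl⟩ := D.maximal v hs hz
    have ha : a = 0 := funext fun l => by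
      have h1 := hx (Pi.single l 1)
      rw [symp_comm, symp_add_right, D.perp_x _ s hs', D.symp_xz, Finset.sum_eq_single l] at h1
      · simpa using h1
      · intro m _ hm; rw [Pi.single_eq_of_ne hm, zero_mul]
      · simp
    rwa [ha, map_zero, add_zero]
  have hp0 : coeff 0 (codeProjector S) ≠ 0 :=
    (coeff_codeProjector_ne_zero_iff hS 0).2 (Submodule.zero_mem _)
  have hprop : coeff 0 (codeProjector S) • Q = coeff 0 Q • codeProjector S := by
    refine eq_of_coeff_eq fun v => ?_
    rw [coeff_smul, coeff_smul]
    by_cases hv : v ∈ stabLabels S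
    · obtain ⟨g, hg, c, hc⟩ := hv
      have hcs := phase_of_mem hS hg hc
      rw [coeff_eq_of_stab_mul hcs hc (hgQ g hg),
        coeff_eq_of_stab_mul hcs hc (stab_mul_codeProjector hS hg)]
      ring
    · rw [show coeff v Q = 0 by by_contra h; exact hv (hsupp v h),
        show coeff v (codeProjector S) = 0 by
          by_contra h; exact hv ((coeff_codeProjector_ne_zero_iff hS v).1 h), mul_zero, mul_zero]
  -- Both sides are proportional idempotents.
  set μ : ℂ := (coeff 0 (codeProjector S))⁻¹ * coeff 0 Q with hμ
  have hQμ : Q = μ • codeProjector S := by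
    rw [hμ, mul_smul, ← hprop, smul_smul, inv_mul_cancel₀ hp0, one_smul]
  have hμ0 : μ ≠ 0 := fun h => hQ0 (by rw [hQμ, h, zero_smul])
  have hμμ : μ * μ = μ := by
    rw [hQμ, smul_mul_smul_comm, codeProjector_mul_self hS] at hQQ
    exact smul_left_injective ℂ (codeProjector_ne_zero hS) hQQ
  rw [hQμ, mul_left_cancel₀ hμ0 (hμμ.trans (mul_one μ).symm), one_smul]

/-- A code has an encoding under which all products of logical `Z` operators are represented in a
given isotropic space `N` of labels, provided that `N` is maximal modulo the stabilizer. -/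
theorem exists_isLogicalEncoding (hS : IsStabilizer S) {N : Submodule (ZMod 2) (Fin n → Label)}
    (hN : N ≤ perp (stabLabels S)) (hiso : ∀ u ∈ N, ∀ v ∈ N, symp u v = 0)
    (hmax : ∀ v ∈ perp (stabLabels S), v ∈ perp N → ∃ s ∈ stabLabels S, ∃ g ∈ N, v = s + g) :
    ∃ (k : ℕ) (E : Matrix (Fin n → Fin 2) (Fin k → Fin 2) ℂ), IsLogicalEncoding S E ∧
      ∀ u, IsZLabel u → u ∈ logicalLabels S E N := by
  obtain ⟨k, D, hD⟩ := exists_encodingData hS hN hiso hmax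
  refine ⟨k, D.encoding, ⟨D.encoding_isometry, D.encoding_range hS, fun P hP => ?_⟩, fun u hu => ?_⟩
  · obtain ⟨c, hc, u, rfl⟩ := mem_pauliGroup_iff.1 hP
    obtain ⟨d, hd, h⟩ := D.exists_phase_mul u
    refine ⟨(c * d) • tau (D.ℓx (fun l => (u l).1) + D.ℓz fun l => (u l).2),
      mem_pauliGroup_iff.2 ⟨c * d, by rw [mul_pow, hc, hd, one_mul], _, rfl⟩, fun g hg => ?_, ?_⟩
    · obtain ⟨w, hw, e, -, he⟩ := exists_label hS hg
      have := tau_comm_of_symp_eq_zero ((D.represents u).1 w hw)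
      rw [he]
      exact ((show Commute (tau w) (tau _) from this.symm).smul_left e).smul_right (c * d)
    · rw [mul_smul, ← h, Matrix.smul_mul, D.mul_encoding_eq, Matrix.mul_smul]
  · refine ⟨_, ?_, D.represents u⟩
    have h0 : (fun l => (u l).1) = 0 := funext hu
    rw [h0, map_zero, zero_add]
    exact hD _

end Encoding

section ChosenPaulis

variable {n r : ℕ} {S : Subgroup (unitaryGroup (Fin n → Fin 2) ℂ)}

/-- If the two spaces of labels agree at every qubit, an encoding exists under which all logical `Z`
operators are represented in the preserved space; the logical action of a transversal
gate then maps `Z` strings to combinations of `Z` strings. -/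
theorem exists_encoding_keepsZSpan (hS : IsStabilizer S) (F : PauliFrame S)
    (hF : ∀ j, F.big j = F.small j) {U : Fin n → QOp (Fin r)} (hU : IsTransversal S U) :
    ∃ (k : ℕ) (E : Matrix (Fin n → Fin 2) (Fin k → Fin 2) ℂ) (W : QOp (Fin r × Fin k)),
      IsLogicalEncoding S E ∧ ActsAs E U W ∧ KeepsZSpan W := by
  obtain ⟨k, E, hE, hz⟩ := exists_isLogicalEncoding hS
    (N := F.smallLabels ⊓ perp (stabLabels S)) inf_le_right
    (fun u hu v hv => F.smallLabels_isotropic hu.1 hv.1)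
    (fun v hv hvN => F.exists_add_of_mem_perp hS hv (by
      rwa [bigLabels_eq_smallLabels F hF]))
  have hz' : ∀ u, IsZLabel u → u ∈ logicalLabels S E F.smallLabels := fun u hu => by
    obtain ⟨v, hv, h⟩ := hz u hu
    exact ⟨v, hv.1, h⟩
  set B := blockEncoding r E
  have hW : ActsAs E U (Bᴴ * (transversalGate U * B)) := by
    have hPB := blockProjector_mul_blockEncoding (r := r) hE
    change transversalGate U * B = B * (Bᴴ * (transversalGate U * B))
    rw [← Matrix.mul_assoc, blockEncoding_range hE, ← Matrix.mul_assoc, ← hU.2.eq,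
      Matrix.mul_assoc, hPB]
  refine ⟨k, E, _, hE, hW, keepsZSpan_of_tau fun m hm => ?_⟩
  rw [← sum_coeff_smul_tau (_ * tau m * _)]
  refine Submodule.sum_mem _ fun m' _ => ?_
  by_cases hm' : coeff m' (Bᴴ * (transversalGate U * B) * tau m *
      (Bᴴ * (transversalGate U * B))ᴴ) = 0
  · rw [hm', zero_smul]; exact Submodule.zero_mem _
  · refine Submodule.smul_mem _ _ (tau_mem_zSpan ?_)
    rintro ⟨i, l⟩
    have h1 := mem_small_of_coeff_ne_zero F hS hE hU hW
      (fun i => hz' _ fun l => hm (i, l)) hm' i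
    -- A label commuting with all `Z` operators has no `X` part.
    have h2 := logicalLabels_small_isotropic F hE h1 (hz' (Pi.single l (0, 1)) fun q => by
      by_cases hq : q = l
      · subst hq; rw [Pi.single_eq_same]
      · rw [Pi.single_eq_of_ne hq]; rfl)
    rw [symp_single_right] at h2
    simpa [symp₁] using h2

end ChosenPaulis

end StabilizerCode

theorem mainTheorem5 (n : ℕ) (S : Subgroup (unitaryGroup (Fin n → Fin 2) ℂ))
    (hS : IsStabilizer S) (hfree : FreeOfTriviallyEncodedQubits S) :
    -- an `r`-qubit logical gate `V`, on one logical qubit per block, for given logical Paulis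
    (∀ (k : ℕ) (E : Matrix (Fin n → Fin 2) (Fin k → Fin 2) ℂ), IsLogicalEncoding S E →
      ∀ (r : ℕ) (U : Fin n → QOp (Fin r)), IsTransversal S U → (∀ j, ¬ IsClifford (U j)) →
      ∀ (s : Fin r → Fin k) (V : QOp (Fin r)), ActsAs E U (gateOn (fun i => (i, s i)) V) →
        ∃ L : QOp (Fin r), IsLocalClifford L ∧ KeepsZSpan (Lᴴ * V * L)) ∧
    -- any logical gate on `Q^{⊗r}`, for a suitable choice of the logical Paulis of `Q`
    (∀ (r : ℕ) (U : Fin n → QOp (Fin r)), IsTransversal S U → (∀ j, ¬ IsClifford (U j)) →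
      ∃ (k : ℕ) (E : Matrix (Fin n → Fin 2) (Fin k → Fin 2) ℂ) (W : QOp (Fin r × Fin k)),
        IsLogicalEncoding S E ∧ ActsAs E U W ∧ KeepsZSpan W) ∧
    -- Hadamard and Toffoli are not both transversal
    (∀ (k : ℕ) (E : Matrix (Fin n → Fin 2) (Fin k → Fin 2) ℂ), IsLogicalEncoding S E →
      ∀ s : Fin k, ¬ (GateIsTransversal S E s hadamardGate ∧
        GateIsTransversal S E s toffoliGate)) := by
  obtain ⟨F⟩ := StabilizerCode.exists_pauliFrame hS hfree
  exact ⟨fun k E hE r U hU hnc s V hV => StabilizerCode.exists_localClifford_of_actsAs F hS hE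
      (fun j => F.big_eq_small r U hU j (hnc j)) hU hV,
    fun r U hU hnc => StabilizerCode.exists_encoding_keepsZSpan hS F
      (fun j => F.big_eq_small r U hU j (hnc j)) hU,
    fun k E hE s => StabilizerCode.not_hadamard_and_toffoli F hS hE s⟩
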